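/- \textbf{Setting.} Let $\mathcal O=\mathbb C\{x_1,\dots,x_n\}$ and let $\mathcal D_{x,t}$ be the ring of germs at the origin of $\mathbb C^n\times\mathbb C^p$ of linear differential operators with analytic coefficients in the variables $x=(x_1,\dots,x_n)$, $t=(t_1,\dots,t_p)$. For $f=(f_1,\dots,f_p)\in\mathcal O^p$ let $N_f=\mathcal D_{x,t}/I_f$, where $I_f$ is the left ideal generated by $t_j-f_j$ $(1\le j\le p)$ and $\partial_{x_i}+\sum_j\frac{\partial f_j}{\partial x_i}\partial_{t_j}$ $(1\le i\le n)$; this is the stalk at $0$ of the direct image of $\mathcal O$ under the graph embedding $x\mapsto(x,f(x))$, also written $\mathcal D_{x,t}f_1^{s_1}\cdots f_p^{s_p}$. Let $F_d(\mathcal D_{x,t})$ be the filtration by the order of operators, let $V_k(\mathcal D_{x,t})$ be the filtration given by the weights $0$ for $x_i,\partial_{x_i}$, $-1$ for $t_j$ and $1$ for $\partial_{t_j}$, and let $F_{d,k}(\mathcal D_{x,t})=F_d\cap V_k$. Endow $N_f$ with the bifiltration $F_{d,k}(N_f)=F_{d,k}(\mathcal D_{x,t})\cdot\overline 1$. For $\mathcal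 D=\mathcal D_{x,t}$ and $\mathbf n,\mathbf m\in\mathbb Z^r$, $\mathcal D^r[\mathbf n][\mathbf m]$ is $\mathcal D^r$ with $F_{d,k}=\bigoplus_l F_{d-n_l,k-m_l}(\mathcal D)$. A bifiltered free resolution of a bifiltered module $M$ is an exact sequence $\cdots\to\mathcal L_1\to\mathcal L_0\to M\to0$ of left $\mathcal D$-modules, $\mathcal L_i=\mathcal D^{r_i}[\mathbf n^{(i)}][\mathbf m^{(i)}]$, inducing exact sequences on all the $F_{d,k}$. For a bifiltered module $M$ put $\mathrm{gr}^V\mathbf R(M)=\bigoplus_{d,k}F_{d,k}(M)/F_{d,k-1}(M)$. The resolution is minimal if for all $i\ge1$ the image of $\mathrm{gr}^V\mathbf R(\mathcal L_i)\to\mathrm{gr}^V\mathbf R(\mathcal L_{i-1})$ lies in $\mathfrak m\,\mathrm{gr}^V\mathbf R(\mathcal L_{i-1})$, where $\mathfrak m$ is the two-sided ideal of the bigraded ring $\mathrm{gr}^V\mathbf R(\mathcal D)$ generated by the classes of the coordinates $x_i,t_j$ and by the elements of bidegree $(1,k)$, $k\in\mathbb Z$. The Betti numbers $\beta_i(f)=r_i$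 and the shifts $[\mathbf n^{(i)}][\mathbf m^{(i)}]$ (up to order, i.e. the multiset of the pairs $(n^{(i)}_l,m^{(i)}_l)$) are those of a minimal bifiltered free resolution of $N_f$; for $i<0$ set $\beta_i(f)=0$, with empty shifts. Put $\beta_f(T)=\sum_i\beta_i(f)T^i$. \textbf{Proposition.} Let $f_1,\dots,f_p\in\mathcal O$ and let $g\in\sum_j\mathcal Of_j$. Given a minimal bifiltered free resolution of $N_f$ with ranks $\beta_i(f)$ and shifts $[\mathbf n^{(i)}][\mathbf m^{(i)}]$, the module $N_{f,g}$ (defined with $p+1$ variables $t$) has a minimal bifiltered free resolution, and for every such resolution and every $i\in\mathbb Z$ $$\beta_i(f,g)=\beta_i(f)+\beta_{i-1}(f),\qquad\text{i.e.}\qquad \beta_{(f,g)}(T)=(1+T)\,\beta_f(T),$$ and the $i$-th vector shift of $N_{f,g}$ is, up to order, $$[\mathbf n^{(i)},\mathbf n^{(i-1)}]\,[\mathbf m^{(i)},\mathbf m^{(i-1)}-\mathbf 1],\qquad \mathbf 1=(1,\dots,1).$$ \textbf{Corollary.} If $f_1,\dots,f_p$ and $f'_1,\dots,f'_p$ generate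 the same ideal $I$ of $\mathcal O$, then any minimal bifiltered free resolutions of $N_f$ and $N_{f'}$ have the same Betti numbers and, for each $i$, the same $i$-th shifts up to order. In particular, the Betti numbers and shifts of $N_f$ are invariants of $I$ when $p$ is minimal, i.e. $p=\dim_{\mathbb C}(I/\mathfrak m_{\mathcal O}I)$, where $\mathfrak m_{\mathcal O}$ is the maximal ideal of $\mathcal O$. -/

import Mathlib

namespace AnalyticDMod

noncomputable section

/-! ### Convergent power series -/

/-- A power series converges if it converges absolutely on some polydisc of positive radius around
the origin. -/
def IsConvergent {ι : Type} (a : MvPowerSeries ι ℂ) : Prop :=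
  ∃ r : ℝ, 0 < r ∧ Summable fun α : ι →₀ ℕ => ‖MvPowerSeries.coeff α a‖ * r ^ α.degree

theorem summable_of_le {ι : Type} {a : MvPowerSeries ι ℂ} {q r : ℝ} (hq : 0 < q) (hqr : q ≤ r)
    (ha : Summable fun α : ι →₀ ℕ => ‖MvPowerSeries.coeff α a‖ * r ^ α.degree) :
    Summable fun α : ι →₀ ℕ => ‖MvPowerSeries.coeff α a‖ * q ^ α.degree :=
  Summable.of_nonneg_of_le (fun _ => mul_nonneg (norm_nonneg _) (pow_nonneg hq.le _))
    (fun _ => mul_le_mul_of_nonneg_left (pow_le_pow_left₀ hq.le hqr _) (norm_nonneg _)) ha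

theorem IsConvergent.add {ι : Type} {a b : MvPowerSeries ι ℂ} (ha : IsConvergent a)
    (hb : IsConvergent b) : IsConvergent (a + b) := by
  obtain ⟨r, hr, ha⟩ := ha
  obtain ⟨s, hs, hb⟩ := hb
  have hq : 0 < min r s := lt_min hr hs
  refine ⟨min r s, hq, ?_⟩
  refine Summable.of_nonneg_of_le (fun _ => mul_nonneg (norm_nonneg _) (pow_nonneg hq.le _))
    (fun α => ?_)
    ((summable_of_le hq (min_le_left _ _) ha).add (summable_of_le hq (min_le_right _ _) hb))
  rw [map_add, ← add_mul]
  exact mul_le_mul_of_nonneg_right (norm_add_le _ _) (pow_nonneg hq.le _)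

theorem IsConvergent.mul {ι : Type} {a b : MvPowerSeries ι ℂ} (ha : IsConvergent a)
    (hb : IsConvergent b) : IsConvergent (a * b) := by
  classical
  obtain ⟨r, hr, ha⟩ := ha
  obtain ⟨s, hs, hb⟩ := hb
  have hq : 0 < min r s := lt_min hr hs
  have ha' := summable_of_le hq (min_le_left _ _) ha
  have hb' := summable_of_le hq (min_le_right _ _) hb
  generalize min r s = q at hq ha' hb'
  refine ⟨q, hq, ?_⟩
  have hab := summable_sum_mul_antidiagonal_of_summable_mul
    (Summable.mul_of_nonneg ha' hb'
      (fun _ => mul_nonneg (norm_nonneg _) (pow_nonneg hq.le _))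
      (fun _ => mul_nonneg (norm_nonneg _) (pow_nonneg hq.le _)))
  refine Summable.of_nonneg_of_le (fun _ => mul_nonneg (norm_nonneg _) (pow_nonneg hq.le _))
    (fun α => ?_) hab
  rw [MvPowerSeries.coeff_mul]
  refine (mul_le_mul_of_nonneg_right (norm_sum_le _ _) (pow_nonneg hq.le _)).trans (le_of_eq ?_)
  rw [Finset.sum_mul]
  refine Finset.sum_congr rfl fun x hx => ?_
  rw [← Finset.HasAntidiagonal.mem_antidiagonal.mp hx, map_add, pow_add, norm_mul]
  ring

theorem IsConvergent.algebraMap {ι : Type} (c : ℂ) :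
    IsConvergent (algebraMap ℂ (MvPowerSeries ι ℂ) c) := by
  classical
  refine ⟨1, one_pos, summable_of_ne_finset_zero (s := {0}) fun α hα => ?_⟩
  have hα' : α ≠ 0 := by simpa using hα
  simp [MvPowerSeries.algebraMap_apply, MvPowerSeries.coeff_C, hα']

/-- The convergent power series form a subalgebra of the formal ones. -/
def convSubalgebra (ι : Type) : Subalgebra ℂ (MvPowerSeries ι ℂ) where
  carrier := {a | IsConvergent a}
  mul_mem' := IsConvergent.mul
  add_mem' := IsConvergent.add
  algebraMap_mem' := IsConvergent.algebraMap

/-- `ℂ{z_i : i ∈ ι}`, the algebra of convergent power series. -/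
def Conv (ι : Type) : Type := convSubalgebra ι

instance (ι : Type) : CommRing (Conv ι) := inferInstanceAs (CommRing (convSubalgebra ι))

instance (ι : Type) : Algebra ℂ (Conv ι) := inferInstanceAs (Algebra ℂ (convSubalgebra ι))

/-- The coefficient of `z^α` of a convergent power series. -/
def Conv.coeff {ι : Type} (α : ι →₀ ℕ) (a : Conv ι) : ℂ := MvPowerSeries.coeff α a.1

variable {ι κ : Type}

/-- The coordinate function `z_i`. -/
def coord (i : ι) : Conv ι :=
  ⟨MvPowerSeries.X i, by
    classical
    change IsConvergent _
    refine ⟨1, one_pos, summable_of_ne_finset_zero (s := {Finsupp.single i 1}) fun α hα => ?_⟩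
    have hα' : α ≠ Finsupp.single i 1 := by simpa using hα
    simp [MvPowerSeries.coeff_X, hα']⟩

theorem pderiv_mem (i : ι) (a : Conv ι) :
    MvPowerSeries.pderiv ℂ i a.1 ∈ convSubalgebra ι := by
  obtain ⟨a, ha⟩ := a
  obtain ⟨r, hr, ha⟩ := (ha : IsConvergent a)
  refine ⟨r / 2, by positivity, ?_⟩
  have hinj : Function.Injective fun α : ι →₀ ℕ => α + Finsupp.single i 1 :=
    fun _ _ h => add_right_cancel h
  refine Summable.of_nonneg_of_le (fun α => by positivity) (fun α => ?_)
    ((ha.comp_injective hinj).mul_left r⁻¹)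
  have h1 : ((α i : ℝ) + 1) ≤ 2 ^ α.degree := by
    have h2 : α i + 1 ≤ 2 ^ α.degree :=
      (Nat.succ_le_succ (Finsupp.le_degree i α)).trans (Nat.lt_two_pow_self)
    exact_mod_cast h2
  have h3 : ‖((α i : ℂ) + 1)‖ = (α i : ℝ) + 1 := by
    have h4 : ((α i : ℂ) + 1) = ((α i + 1 : ℕ) : ℂ) := by push_cast; ring
    rw [h4, Complex.norm_natCast]
    push_cast
    ring
  rw [MvPowerSeries.coeff_pderiv, norm_mul, h3, div_pow]
  simp only [Function.comp, map_add, Finsupp.degree_single, pow_succ]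
  calc ‖MvPowerSeries.coeff (α + Finsupp.single i 1) a‖ * (α i + 1) * (r ^ α.degree / 2 ^ α.degree)
      ≤ ‖MvPowerSeries.coeff (α + Finsupp.single i 1) a‖ * 2 ^ α.degree
          * (r ^ α.degree / 2 ^ α.degree) := by gcongr
    _ = _ := by field_simp

/-- `∂/∂z_i` as a `ℂ`-linear endomorphism of `ℂ{z}`. -/
def pderivEnd (i : ι) : Module.End ℂ (Conv ι) where
  toFun a := ⟨MvPowerSeries.pderiv ℂ i a.1, pderiv_mem i a⟩
  map_add' _ _ := Subtype.ext (map_add _ _ _)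
  map_smul' _ _ := Subtype.ext (Derivation.map_smul _ _ _)

/-- Multiplication by `a ∈ ℂ{z}` as a `ℂ`-linear endomorphism of `ℂ{z}`. -/
def mulEnd (a : Conv ι) : Module.End ℂ (Conv ι) := LinearMap.mulLeft ℂ a

/-- The inclusion `ℂ{z_i : i ∈ ι} → ℂ{z_k : k ∈ κ}` induced by an injection `ι ↪ κ` of the sets of
variables. -/
def incl (e : ι ↪ κ) (a : Conv ι) : Conv κ :=
  ⟨MvPowerSeries.rename e a.1, by
    change IsConvergent _
    obtain ⟨a, ha⟩ := a
    obtain ⟨r, hr, ha⟩ := (ha : IsConvergent a)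
    refine ⟨r, hr, ?_⟩
    have hinj : Function.Injective (Finsupp.embDomain (M := ℕ) e) := Finsupp.embDomain_injective e
    refine (hinj.summable_iff ?_).mp (ha.congr fun α => ?_)
    · intro x hx
      rw [MvPowerSeries.coeff_rename_eq_zero, norm_zero, zero_mul]
      rintro ⟨y, rfl⟩
      exact hx ⟨y, Finsupp.embDomain_eq_mapDomain e y⟩
    · simp only [Function.comp]
      rw [MvPowerSeries.coeff_embDomain_rename, Finsupp.embDomain_eq_mapDomain,
        Finsupp.degree_mapDomain]⟩

/-! ### The ring of analytic differential operators and its bifiltration -/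

/-- The algebra of endomorphisms of `ℂ{z}` generated by the multiplications by
convergent power series and the `∂/∂z_i`. -/
def diffOpSubalgebra (ι : Type) : Subalgebra ℂ (Module.End ℂ (Conv ι)) :=
  Algebra.adjoin ℂ (Set.range (mulEnd (ι := ι)) ∪ Set.range (pderivEnd (ι := ι)))

/-- `𝒟`: the ring of germs at the origin of linear differential operators with analytic
coefficients. -/
def DiffOp (ι : Type) : Type := diffOpSubalgebra ι

instance (ι : Type) : Ring (DiffOp ι) := inferInstanceAs (Ring (diffOpSubalgebra ι))

instance (ι : Type) : Algebra ℂ (DiffOp ι) := inferInstanceAs (Algebra ℂ (diffOpSubalgebra ι))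

/-- A convergent power series as an operator of order `0`. -/
def fn (a : Conv ι) : DiffOp ι :=
  ⟨mulEnd a, Algebra.subset_adjoin (Or.inl ⟨a, rfl⟩)⟩

/-- The operator `∂_i = ∂/∂z_i`. -/
def del (i : ι) : DiffOp ι :=
  ⟨pderivEnd i, Algebra.subset_adjoin (Or.inr ⟨i, rfl⟩)⟩

theorem del_commute (i j : ι) : Commute (del i) (del j) := by
  refine Subtype.ext (LinearMap.ext fun a => Subtype.ext ?_)
  change MvPowerSeries.pderiv ℂ i (MvPowerSeries.pderiv ℂ j a.1)
    = MvPowerSeries.pderiv ℂ j (MvPowerSeries.pderiv ℂ i a.1)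
  classical
  ext α
  simp only [MvPowerSeries.coeff_pderiv, Finsupp.add_apply, Finsupp.single_apply]
  rw [add_right_comm]
  by_cases h : i = j
  · subst h; rfl
  · have h' : ¬ j = i := fun q => h q.symm
    simp only [h, h', if_false]
    push_cast
    ring

/-- `∂^β = ∏ ∂_i ^ β_i`. -/
def delPow [Fintype ι] (β : ι →₀ ℕ) : DiffOp ι :=
  Finset.univ.noncommProd (fun i => del i ^ β i)
    fun i _ j _ _ => (del_commute i j).pow_pow _ _

variable [Fintype ι]

/-- `F_k^{(u,v)}(𝒟)`: the operators `∑ g_β(z) ∂^β` (finite sum), `g_β = ∑_α a_{αβ} z^α`, all of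
whose terms with `a_{αβ} ≠ 0` satisfy `∑ u_i α_i + ∑ v_i β_i ≤ k`. -/
def weightFil (u v : ι → ℤ) (k : ℤ) : Submodule ℂ (DiffOp ι) :=
  Submodule.span ℂ {P | ∃ (g : Conv ι) (β : ι →₀ ℕ),
    (∀ α : ι →₀ ℕ, g.coeff α ≠ 0 →
      Finsupp.weight u α + Finsupp.weight v β ≤ k) ∧ P = fn g * delPow β}

/-- `F_{d,k}(𝒟) = F_d^{(0,1)}(𝒟) ∩ F_k^{(u,v)}(𝒟)`. -/
def biFil (u v : ι → ℤ) (d k : ℤ) : AddSubgroup (DiffOp ι) :=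
  (weightFil (fun _ => 0) (fun _ => 1) d ⊓ weightFil u v k).toAddSubgroup

/-- The bifiltration of the free module `𝒟^r[n][m]`: the `l`-th component of an element of
`F_{d,k}` lies in `F_{d - n_l, k - m_l}(𝒟)`. -/
def freeFil (u v : ι → ℤ) {r : ℕ} (n m : Fin r → ℤ) (d k : ℤ) : AddSubgroup (Fin r → DiffOp ι) :=
  AddSubgroup.pi Set.univ fun l => biFil u v (d - n l) (k - m l)

/-! ### Minimal bifiltered free resolutions -/

/-- Representatives in `𝒟` of the generators of bidegree `(d,k)` of the maximal bigraded two-sided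
ideal `𝔪` of `gr^V(R(𝒟)) = ⨁_{d,k} F_{d,k}(𝒟) / F_{d,k-1}(𝒟)`: the coordinates `z_i`, of bidegree
`(0, u_i)`, and all elements of bidegree `(1, k)`. -/
def maxIdealGens (u v : ι → ℤ) (d k : ℤ) : Set (DiffOp ι) :=
  {P | d = 0 ∧ ∃ i, u i = k ∧ P = fn (coord i)} ∪ {P | d = 1 ∧ P ∈ biFil u v 1 k}

/-- For a bifiltered left `𝒟`-module `(M, F)`, the preimage in `F_{d,k}(M)` of the component of
bidegree `(d,k)`, a subgroup of `F_{d,k}(M) / F_{d,k-1}(M)`, of the bigraded submodule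
`𝔪 · gr^V(R(M))` of `gr^V(R(M)) = ⨁_{d,k} F_{d,k}(M) / F_{d,k-1}(M)`. It is spanned by the products
`P · G · y` of homogeneous elements with `G` a generator of `𝔪`. -/
def maxIdealMul (u v : ι → ℤ) {M : Type} [AddCommGroup M] [Module (DiffOp ι) M]
    (F : ℤ → ℤ → AddSubgroup M) (d k : ℤ) : AddSubgroup M :=
  F d (k - 1) ⊔ AddSubgroup.closure
    {z | ∃ (d₁ d₂ d₃ k₁ k₂ k₃ : ℤ) (P G : DiffOp ι) (y : M),
      d₁ + d₂ + d₃ = d ∧ k₁ + k₂ + k₃ = k ∧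
      P ∈ biFil u v d₁ k₁ ∧ G ∈ maxIdealGens u v d₂ k₂ ∧ y ∈ F d₃ k₃ ∧ z = P • G • y}

/-- A bifiltered free resolution `⋯ → 𝓛₁ → 𝓛₀ → M → 0`, `𝓛_i = 𝒟^{r_i}[n^{(i)}][m^{(i)}]`, of a left
`𝒟`-module `M` with a bifiltration `F`, for the weights `(u,v)`. -/
structure BifilteredFreeResolution (u v : ι → ℤ) {M : Type}
    [AddCommGroup M] [Module (DiffOp ι) M] (F : ℤ → ℤ → AddSubgroup M) where
  rank : ℕ → ℕ
  n : ∀ i, Fin (rank i) → ℤ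
  m : ∀ i, Fin (rank i) → ℤ
  φ : ∀ i, (Fin (rank (i + 1)) → DiffOp ι) →ₗ[DiffOp ι] (Fin (rank i) → DiffOp ι)
  ε : (Fin (rank 0) → DiffOp ι) →ₗ[DiffOp ι] M
  ε_surjective : Function.Surjective ε
  exact_zero : Function.Exact (φ 0) ε
  exact_succ : ∀ i, Function.Exact (φ (i + 1)) (φ i)
  fil_ε : ∀ d k, ε '' (freeFil u v (n 0) (m 0) d k : Set _) = F d k
  fil_exact_zero : ∀ d k, φ 0 '' (freeFil u v (n 1) (m 1) d k : Set _) =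
    {y | y ∈ freeFil u v (n 0) (m 0) d k ∧ ε y = 0}
  fil_exact_succ : ∀ i d k,
    φ (i + 1) '' (freeFil u v (n (i + 2)) (m (i + 2)) d k : Set _) =
      {y | y ∈ freeFil u v (n (i + 1)) (m (i + 1)) d k ∧ φ i y = 0}

/-- A bifiltered free resolution is minimal if the resolution of `gr^V(R(M))` by the bigraded free
modules `gr^V(R(𝓛_i))` that it induces is minimal, i.e. the image of each differential
`gr^V(R(𝓛_{i+1})) → gr^V(R(𝓛_i))` is contained in `𝔪 · gr^V(R(𝓛_i))`. (The induced sequence is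
automatically exact, because the sequences of the `F_{d,k}` are.) -/
structure MinimalBifilteredFreeResolution (u v : ι → ℤ) {M : Type}
    [AddCommGroup M] [Module (DiffOp ι) M] (F : ℤ → ℤ → AddSubgroup M) extends
    BifilteredFreeResolution u v F where
  minimal : ∀ i d k, ∀ y ∈ freeFil u v (n (i + 1)) (m (i + 1)) d k,
    φ i y ∈ maxIdealMul u v (freeFil u v (n i) (m i)) d k

namespace MinimalBifilteredFreeResolution

variable {u v : ι → ℤ} {M : Type} [AddCommGroup M] [Module (DiffOp ι) M]
  {F : ℤ → ℤ → AddSubgroup M}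

/-- The `i`-th Betti number (`0` for `i < 0`). -/
def betti (R : MinimalBifilteredFreeResolution u v F) : ℤ → ℕ
  | Int.ofNat i => R.rank i
  | Int.negSucc _ => 0

/-- The `i`-th vector shift `[n^{(i)}][m^{(i)}]`, as the multiset of the pairs `(n^{(i)}_l, m^{(i)}_l)`
(empty for `i < 0`). -/
def shifts (R : MinimalBifilteredFreeResolution u v F) : ℤ → Multiset (ℤ × ℤ)
  | Int.ofNat i => Finset.univ.val.map fun l : Fin (R.rank i) => (R.n i l, R.m i l)
  | Int.negSucc _ => 0

/-- The generating series `∑ β_i T^i`. -/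
def bettiSeries (R : MinimalBifilteredFreeResolution u v F) : PowerSeries ℤ :=
  PowerSeries.mk fun i => (R.betti i : ℤ)

end MinimalBifilteredFreeResolution

/-! ### The geometric module `N_f` -/

variable {n p : ℕ}

/-- The weights of the `V`-filtration along `t_1 = ⋯ = t_p = 0` for the variables
`(x_1, …, x_n, t_1, …, t_p)`: `0` for `x_i`, `-1` for `t_j`. -/
def vU (n p : ℕ) : Fin n ⊕ Fin p → ℤ := Sum.elim (fun _ => 0) (fun _ => -1)

/-- The corresponding weights for the derivations: `0` for `∂_{x_i}`, `1` for `∂_{t_j}`. -/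
def vV (n p : ℕ) : Fin n ⊕ Fin p → ℤ := Sum.elim (fun _ => 0) (fun _ => 1)

/-- A function `a(x)` of `x_1, …, x_n` as an element of `ℂ{x,t}`. -/
def liftX (p : ℕ) (a : Conv (Fin n)) : Conv (Fin n ⊕ Fin p) := incl ⟨Sum.inl, Sum.inl_injective⟩ a

/-- The left ideal `I` of `𝒟_{x,t}` generated by the `t_j - f_j` and the
`∂_{x_i} + ∑_j (∂f_j/∂x_i) ∂_{t_j}`. -/
def geomIdeal (f : Fin p → Conv (Fin n)) :
    Submodule (DiffOp (Fin n ⊕ Fin p)) (DiffOp (Fin n ⊕ Fin p)) :=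
  Submodule.span (DiffOp (Fin n ⊕ Fin p))
    (Set.range (fun j : Fin p => fn (coord (Sum.inr j)) - fn (liftX p (f j))) ∪
     Set.range (fun i : Fin n => del (Sum.inl i) +
       ∑ j : Fin p, fn (liftX p (pderivEnd i (f j))) * del (Sum.inr j)))

/-- The geometric module `N_f = 𝒟_{x,t} f_1^{s_1} ⋯ f_p^{s_p} ≃ (i_{f+} 𝓞)_0 ≃ 𝒟_{x,t} / I`, `i_f` being
the graph embedding `x ↦ (x, f(x))`: `𝒟_{x,t} / I` is the transfer module `𝒟_{x,t} / ∑_j 𝒟_{x,t} (t_j - f_j)`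
of `i_f`, tensored over `𝒟_x` with `𝓞 = 𝒟_x / ∑_i 𝒟_x ∂_{x_i}`, where `∂_{x_i}` acts on the right as
`∂_{x_i} + ∑_j (∂f_j/∂x_i) ∂_{t_j}`. The class of `1` is the generator `f^s`. -/
abbrev GeomModule (f : Fin p → Conv (Fin n)) : Type := DiffOp (Fin n ⊕ Fin p) ⧸ geomIdeal f

/-- The bifiltration `F_{d,k}(N_f) = F_{d,k}(𝒟_{x,t}) · f^s`. -/
def geomFil (f : Fin p → Conv (Fin n)) (d k : ℤ) : AddSubgroup (GeomModule f) :=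
  (biFil (vU n p) (vV n p) d k).map (geomIdeal f).mkQ.toAddMonoidHom

/-- Minimal bifiltered free resolutions of `N_f`. -/
abbrev GeomResolution (f : Fin p → Conv (Fin n)) : Type :=
  MinimalBifilteredFreeResolution (vU n p) (vV n p) (geomFil f)

/-- The family `(f, g) = (f_1, …, f_p, g)`. -/
def adjoinFn (f : Fin p → Conv (Fin n)) (g : Conv (Fin n)) : Fin (p + 1) → Conv (Fin n) :=
  Fin.snoc (α := fun _ => Conv (Fin n)) f g

end

end AnalyticDMod

/-!
Why the shifts of `N_{f,g}` are those of a mapping cone.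

Uniqueness. Bifiltered free modules are projective with respect to strict surjections, so two minimal
bifiltered free resolutions of a module are compared by filtered maps that are mutually inverse up to
homotopy. Minimality makes the homotopies vanish modulo `𝔪`, and an element of `𝔪 · gr^V(R(𝒟^r))` has
no constant term in the components of its own bidegree. Hence the constant terms of the comparison
maps are mutually inverse matrices between the basis vectors of any given bidegree, and computing the
trace of their product in two ways shows that the shifts agree
(`MinimalBifilteredFreeResolution.shifts_eq`).

Adjoining `0`. Put `s = t_{p+1}`, and let `𝒟'` be the ring of operators in the variables of `𝒟` and in
`s`. The ideal of `(f, 0)` is `𝒟' I_f + 𝒟' s` (`extIdeal_geomIdeal`). Every operator of `𝒟'` is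
uniquely of the form `Q s + ∑_m ∂_s^m c_m` with `Q ∈ 𝒟'` and `c_m ∈ 𝒟`, and the terms lie in the steps
of the bifiltration that one expects (`AddsOne.decomp_unique`, `AddsOne.exists_decomp`). So modulo
`s` the extension of a resolution `𝓛` of `N_f` to `𝒟'` is a direct sum of copies of `𝓛`, one for each
power of `∂_s`, and right multiplication by `s` is injective. Therefore the mapping cone of right
multiplication by `s` on the extension of `𝓛` is a strict resolution of `N_{f,0}` (`AddsOne.cone`). It
is minimal because `s ∈ 𝔪`, and as `s` has bidegree `(0,-1)` its shifts are those of the claim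
(`AddsOne.shifts_cone`).

Coordinate changes. Let `f = M f'` for an invertible matrix `M` of functions of `x`. The coordinate
change `t ↦ M t` preserves the weights, so conjugation with it is an automorphism of `𝒟` that
preserves the bifiltration and `𝔪`; it carries `I_f` to `I_{f'}` if the determinant of `M` is constant
(`IsTransition.opConj_mem`). That these substitutions make sense for convergent power series, and
that derivations and homomorphisms of `ℂ{z}` are determined by the coordinates, is proved on the way.
If `g = ∑ a_j f_j` then a shear carries `(f, 0)` to `(f, g)` (`HasShifts.adjoin`).

If `f` and `f'` generate the same ideal then `(f, f')` arises by adjoining functions of the ideal to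
`f` and, up to a permutation, to `f'`. The shifts of `N_f` and `N_{f'}` thus have the same image under
the `p`-th iterate of an operation that is injective on families of shifts that vanish in negative
degrees (`shifts_eq_of_span_eq`).
-/

namespace AnalyticDMod

noncomputable section

open Finsupp (single weight)
open scoped NNReal ENNReal Topology

variable {ι κ : Type}

section

/-! ### Coefficients and weights of convergent power series -/

@[ext]
theorem Conv.ext {a b : Conv ι} (h : ∀ α, a.coeff α = b.coeff α) : a = b :=
  Subtype.ext (MvPowerSeries.ext h)

@[simp] theorem Conv.coeff_zero (α : ι →₀ ℕ) : (0 : Conv ι).coeff α = 0 := rfl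

@[simp] theorem Conv.coeff_add (α : ι →₀ ℕ) (a b : Conv ι) :
    (a + b).coeff α = a.coeff α + b.coeff α := rfl

@[simp] theorem Conv.coeff_smul (α : ι →₀ ℕ) (c : ℂ) (a : Conv ι) :
    (c • a).coeff α = c * a.coeff α := rfl

theorem Conv.coeff_mul [DecidableEq ι] (α : ι →₀ ℕ) (a b : Conv ι) :
    (a * b).coeff α = ∑ x ∈ Finset.HasAntidiagonal.antidiagonal α, a.coeff x.1 * b.coeff x.2 :=
  MvPowerSeries.coeff_mul _ _ _

theorem Conv.coeff_one [DecidableEq ι] (α : ι →₀ ℕ) :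
    (1 : Conv ι).coeff α = if α = 0 then 1 else 0 :=
  MvPowerSeries.coeff_one (R := ℂ) α

theorem Conv.coeff_coord [DecidableEq ι] (α : ι →₀ ℕ) (i : ι) :
    (coord i : Conv ι).coeff α = if α = single i 1 then 1 else 0 :=
  MvPowerSeries.coeff_X _ _

theorem Conv.coeff_pderiv (α : ι →₀ ℕ) (i : ι) (a : Conv ι) :
    (pderivEnd i a).coeff α = a.coeff (α + single i 1) * (α i + 1) :=
  MvPowerSeries.coeff_pderiv _ _

theorem Conv.coeff_coord_mul [DecidableEq ι] (α : ι →₀ ℕ) (i : ι) (a : Conv ι) :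
    (coord i * a).coeff α = if single i 1 ≤ α then a.coeff (α - single i 1) else 0 := by
  have := MvPowerSeries.coeff_monomial_mul α (single i 1) a.1 (1 : ℂ)
  rw [one_mul] at this
  exact this

theorem Conv.coeff_add_single_coord_mul (α : ι →₀ ℕ) (i : ι) (a : Conv ι) :
    (coord i * a).coeff (α + single i 1) = a.coeff α := by
  classical
  rw [Conv.coeff_coord_mul, if_pos le_add_self, add_tsub_cancel_right]

/-- The constant term `a(0)` of a convergent power series, as a ring homomorphism. -/
def Conv.const : Conv ι →+* ℂ :=
  (MvPowerSeries.constantCoeff (σ := ι) (R := ℂ)).comp (convSubalgebra ι).val.toRingHom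

theorem Conv.const_apply (a : Conv ι) : Conv.const a = a.coeff 0 := by
  change MvPowerSeries.constantCoeff a.1 = MvPowerSeries.coeff 0 a.1
  rw [MvPowerSeries.coeff_zero_eq_constantCoeff_apply]

@[simp] theorem Conv.const_coord (i : ι) : Conv.const (coord i : Conv ι) = 0 :=
  MvPowerSeries.constantCoeff_X i

theorem pderivEnd_mul (i : ι) (a b : Conv ι) :
    pderivEnd i (a * b) = a * pderivEnd i b + pderivEnd i a * b := by
  rw [mul_comm (pderivEnd i a) b]
  exact Subtype.ext (Derivation.leibniz _ a.1 b.1)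

@[simp] theorem pderivEnd_one (i : ι) : pderivEnd i (1 : Conv ι) = 0 :=
  Subtype.ext MvPowerSeries.pderiv_one

theorem pderivEnd_coord [DecidableEq ι] (i j : ι) :
    pderivEnd i (coord j : Conv ι) = if i = j then 1 else 0 := by
  refine Subtype.ext ?_
  change MvPowerSeries.pderiv ℂ i (MvPowerSeries.X j) = _
  rw [MvPowerSeries.pderiv_X, Pi.single_apply]
  by_cases h : j = i
  · rw [if_pos h, if_pos h.symm]; rfl
  · rw [if_neg h, if_neg (Ne.symm h)]; rfl

/-- All monomials of `g` have `u`-weight at most `a`. -/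
def HasWeight (u : ι → ℤ) (g : Conv ι) (a : ℤ) : Prop :=
  ∀ α : ι →₀ ℕ, g.coeff α ≠ 0 → weight u α ≤ a

namespace HasWeight

variable {u : ι → ℤ} {g h : Conv ι} {a b : ℤ}

theorem mono (hg : HasWeight u g a) (hab : a ≤ b) : HasWeight u g b :=
  fun α hα => (hg α hα).trans hab

theorem zero : HasWeight u (0 : Conv ι) a := fun _ h => absurd rfl h

theorem add (hg : HasWeight u g a) (hh : HasWeight u h a) : HasWeight u (g + h) a := by
  intro α hα
  by_cases h0 : g.coeff α = 0
  · exact hh α fun h1 => hα (by rw [Conv.coeff_add, h0, h1, add_zero])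
  · exact hg α h0

theorem smul (c : ℂ) (hg : HasWeight u g a) : HasWeight u (c • g) a :=
  fun α hα => hg α fun h => hα (by rw [Conv.coeff_smul, h, mul_zero])

theorem mul (hg : HasWeight u g a) (hh : HasWeight u h b) : HasWeight u (g * h) (a + b) := by
  classical
  intro α hα
  rw [Conv.coeff_mul] at hα
  obtain ⟨x, hx, hne⟩ := Finset.exists_ne_zero_of_sum_ne_zero hα
  rw [← Finset.HasAntidiagonal.mem_antidiagonal.mp hx, map_add]
  exact add_le_add (hg _ (left_ne_zero_of_mul hne)) (hh _ (right_ne_zero_of_mul hne))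

theorem one (ha : 0 ≤ a) : HasWeight u (1 : Conv ι) a := by
  classical
  intro α hα
  rw [Conv.coeff_one] at hα
  by_cases h : α = 0
  · rw [h, map_zero]; exact ha
  · rw [if_neg h] at hα; exact absurd rfl hα

theorem sum {σ : Type} (s : Finset σ) (G : σ → Conv ι) (hG : ∀ i ∈ s, HasWeight u (G i) a) :
    HasWeight u (∑ i ∈ s, G i) a := by
  classical
  induction s using Finset.induction_on with
  | empty => rw [Finset.sum_empty]; exact zero
  | insert i s hi ih =>
    rw [Finset.sum_insert hi]
    exact (hG _ (Finset.mem_insert_self _ _)).add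
      (ih fun j hj => hG j (Finset.mem_insert_of_mem hj))

theorem coord (i : ι) (ha : u i ≤ a) : HasWeight u (coord i) a := by
  classical
  intro α hα
  rw [Conv.coeff_coord] at hα
  by_cases h : α = single i 1
  · rw [h, Finsupp.weight_single, one_smul]; exact ha
  · rw [if_neg h] at hα; exact absurd rfl hα

theorem pderiv (i : ι) (hg : HasWeight u g a) : HasWeight u (pderivEnd i g) (a - u i) := by
  intro α hα
  rw [Conv.coeff_pderiv] at hα
  have := hg _ (left_ne_zero_of_mul hα)
  rw [map_add, Finsupp.weight_single, one_smul] at this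
  omega

theorem const_eq_zero (hg : HasWeight u g a) (ha : a < 0) : Conv.const g = 0 := by
  rw [Conv.const_apply]
  by_contra h
  have := hg 0 h
  rw [map_zero] at this
  omega

end HasWeight

theorem weight_zero_fun (α : ι →₀ ℕ) : weight (fun _ : ι => (0 : ℤ)) α = 0 := by
  simp [Finsupp.weight_apply, Finsupp.sum]

theorem hasWeight_zero_fun {g : Conv ι} {a : ℤ} (ha : 0 ≤ a) :
    HasWeight (fun _ => 0) g a := fun α _ => by rw [weight_zero_fun]; exact ha

theorem hasWeight_of_nonpos {u : ι → ℤ} (hu : ∀ i, u i ≤ 0) (g : Conv ι) {a : ℤ} (ha : 0 ≤ a) :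
    HasWeight u g a := fun α _ => by
  rw [Finsupp.weight_apply]
  exact (Finset.sum_nonpos fun i _ => smul_nonpos_of_nonneg_of_nonpos (Nat.zero_le _) (hu i)).trans ha

theorem weight_one_nonneg (β : ι →₀ ℕ) : 0 ≤ weight (fun _ : ι => (1 : ℤ)) β := by
  rw [Finsupp.weight_apply]
  exact Finset.sum_nonneg fun i _ => by simp

theorem weight_one_eq_zero {β : ι →₀ ℕ} (h : weight (fun _ : ι => (1 : ℤ)) β ≤ 0) : β = 0 := by
  rw [Finsupp.weight_apply] at h
  ext i
  have h2 := (Finset.sum_eq_zero_iff_of_nonneg (s := β.support)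
    (f := fun i => β i • (1 : ℤ)) fun i _ => by simp).mp
      (le_antisymm h (Finset.sum_nonneg fun i _ => by simp))
  by_cases hi : i ∈ β.support
  · simpa using h2 i hi
  · simpa using hi

/-! ### Relations in the ring of differential operators -/

theorem DiffOp.ext {P Q : DiffOp ι} (h : ∀ a, P.1 a = Q.1 a) : P = Q :=
  Subtype.ext (LinearMap.ext h)

/-- The inclusion `ℂ{z} → 𝒟` as an algebra homomorphism. -/
def fnHom : Conv ι →ₐ[ℂ] DiffOp ι :=
  AlgHom.ofLinearMap
    { toFun := fn
      map_add' := fun a b => DiffOp.ext fun c => add_mul a b c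
      map_smul' := fun r a => DiffOp.ext fun c => smul_mul_assoc r a c }
    (DiffOp.ext fun c => one_mul c) fun a b => DiffOp.ext fun c => mul_assoc a b c

theorem fn_add (a b : Conv ι) : fn (a + b) = fn a + fn b := map_add fnHom a b
theorem fn_sub (a b : Conv ι) : fn (a - b) = fn a - fn b := map_sub fnHom a b
theorem fn_neg (a : Conv ι) : fn (-a) = -fn a := map_neg fnHom a
theorem fn_mul (a b : Conv ι) : fn (a * b) = fn a * fn b := map_mul fnHom a b
theorem fn_zero : fn (0 : Conv ι) = 0 := map_zero fnHom
theorem fn_one : fn (1 : Conv ι) = 1 := map_one fnHom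
theorem fn_smul (c : ℂ) (a : Conv ι) : fn (c • a) = c • fn a := map_smul fnHom c a
theorem fn_sum {σ : Type} (s : Finset σ) (G : σ → Conv ι) :
    fn (∑ i ∈ s, G i) = ∑ i ∈ s, fn (G i) := map_sum fnHom G s

theorem fn_commute (a b : Conv ι) : Commute (fn a) (fn b) := by
  rw [Commute, SemiconjBy, ← fn_mul, mul_comm, fn_mul]

theorem fn_injective : Function.Injective (fn : Conv ι → DiffOp ι) := fun a b h => by
  have : (fn a).1 1 = (fn b).1 1 := by rw [h]
  simpa using (show a * 1 = b * 1 from this)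

theorem del_mul_fn (i : ι) (a : Conv ι) : del i * fn a = fn a * del i + fn (pderivEnd i a) :=
  DiffOp.ext fun b => pderivEnd_mul i a b

theorem del_mul_coord [DecidableEq ι] (i j : ι) :
    del i * fn (coord j) = fn (coord j) * del i + if i = j then 1 else 0 := by
  rw [del_mul_fn, pderivEnd_coord]
  split_ifs
  · rw [fn_one]
  · rw [fn_zero]

theorem algebraMap_eq_fn (c : ℂ) : algebraMap ℂ (DiffOp ι) c = fn (algebraMap ℂ (Conv ι) c) :=
  (fnHom.commutes c).symm

/-- Induction along multiplication by the generators of `𝒟`. -/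
theorem DiffOp.induction {p : DiffOp ι → Prop} (P : DiffOp ι) (hfn : ∀ a, p (fn a))
    (hdel : ∀ i, p (del i)) (hadd : ∀ P Q, p P → p Q → p (P + Q))
    (hmul : ∀ P Q, p P → p Q → p (P * Q)) : p P := by
  obtain ⟨P, hP⟩ := P
  induction hP using Algebra.adjoin_induction with
  | mem x hx =>
    rcases hx with ⟨a, rfl⟩ | ⟨i, rfl⟩
    · exact hfn a
    · exact hdel i
  | algebraMap r =>
    have := hfn (algebraMap ℂ (Conv ι) r)
    rw [← algebraMap_eq_fn] at this
    exact this
  | add x y hx hy ihx ihy => exact hadd ⟨x, hx⟩ ⟨y, hy⟩ ihx ihy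
  | mul x y hx hy ihx ihy => exact hmul ⟨x, hx⟩ ⟨y, hy⟩ ihx ihy

/-- Induction on a multi-exponent by raising one exponent by one. -/
theorem exponent_induction {p : (ι →₀ ℕ) → Prop} (β : ι →₀ ℕ) (h0 : p 0)
    (h1 : ∀ i β, p β → p (single i 1 + β)) : p β := by
  classical
  induction β using Finsupp.induction with
  | zero => exact h0
  | single_add i b f _ _ ih =>
    clear * - ih h1
    induction b with
    | zero => simpa using ih
    | succ b ihb =>
      rw [add_comm b 1, Finsupp.single_add, add_assoc]
      exact h1 _ _ ihb

/-- The coefficients of the commutator `[∑ g_β ∂^β, z_i]`. -/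
def lowerCoeffs (i : ι) : ((ι →₀ ℕ) →₀ Conv ι) →ₗ[ℂ] ((ι →₀ ℕ) →₀ Conv ι) :=
  Finsupp.lsum ℂ fun β => (β i : ℂ) • Finsupp.lsingle (β - single i 1)

theorem lowerCoeffs_single (i : ι) (β : ι →₀ ℕ) (g : Conv ι) :
    lowerCoeffs i (single β g) = single (β - single i 1) ((β i : ℂ) • g) := by
  simp [lowerCoeffs]

theorem lowerCoeffs_apply (i : ι) (G : (ι →₀ ℕ) →₀ Conv ι) (γ : ι →₀ ℕ) :
    lowerCoeffs i G γ = ((γ i + 1 : ℕ) : ℂ) • G (γ + single i 1) := by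
  classical
  induction G using Finsupp.induction_linear with
  | zero => simp
  | add G H hG hH => rw [map_add, Finsupp.add_apply, hG, hH, Finsupp.add_apply, smul_add]
  | single β g =>
    rw [lowerCoeffs_single, Finsupp.single_apply, Finsupp.single_apply]
    by_cases h : β = γ + single i 1
    · rw [if_pos h, if_pos (by rw [h, add_tsub_cancel_right]), h]
      simp
    · rw [if_neg h, smul_zero]
      split_ifs with h2
      · have : β i = 0 := by
          by_contra h3
          refine h ?_
          rw [← h2, tsub_add_cancel_of_le]
          rw [Finsupp.single_le_iff]
          omega
        rw [this]; simp
      · rfl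

section DelPow

variable [Fintype ι]

theorem delPow_pairwise (β : ι →₀ ℕ) :
    ((Finset.univ : Finset ι) : Set ι).Pairwise (Function.onFun Commute fun i => del i ^ β i) :=
  fun i _ j _ _ => (del_commute i j).pow_pow _ _

theorem delPow_eq (β : ι →₀ ℕ) :
    delPow β = Finset.univ.noncommProd (fun i => del i ^ β i) (delPow_pairwise β) := rfl

@[simp] theorem delPow_zero : delPow (0 : ι →₀ ℕ) = 1 := by
  rw [delPow_eq, Finset.noncommProd_eq_pow_card _ _ _ 1 (fun i _ => by simp), one_pow]

theorem delPow_add (β γ : ι →₀ ℕ) : delPow (β + γ) = delPow β * delPow γ := by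
  rw [delPow_eq, delPow_eq β, delPow_eq γ, ← Finset.noncommProd_mul_distrib]
  · exact Finset.noncommProd_congr rfl (fun i _ => by simp [pow_add]) _
  · exact fun i _ j _ _ => (del_commute i j).pow_pow _ _

theorem delPow_single (i : ι) : delPow (single i 1) = del i := by
  classical
  rw [delPow_eq]
  refine (Finset.mul_noncommProd_erase _ (Finset.mem_univ i) _ (delPow_pairwise _)).symm.trans
    ((congrArg₂ (· * ·) ?_ ((Finset.noncommProd_eq_pow_card _ _ _ 1 ?_).trans (one_pow _))).trans
      (mul_one _))
  · rw [Finsupp.single_eq_same, pow_one]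
  · intro j hj
    rw [Finsupp.single_eq_of_ne (Finset.ne_of_mem_erase hj), pow_zero]

theorem delPow_single_add (i : ι) (β : ι →₀ ℕ) :
    delPow (single i 1 + β) = del i * delPow β := by
  rw [delPow_add, delPow_single]

theorem delPow_mul_coord (β : ι →₀ ℕ) (i : ι) :
    delPow β * fn (coord i) = fn (coord i) * delPow β + (β i : ℂ) • delPow (β - single i 1) := by
  classical
  refine exponent_induction (p := fun β => delPow β * fn (coord i) =
    fn (coord i) * delPow β + (β i : ℂ) • delPow (β - single i 1)) β (by simp) fun j β ih => ?_
  rw [delPow_single_add, mul_assoc, ih, mul_add, ← mul_assoc, del_mul_coord, add_mul,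
    mul_smul_comm, ← delPow_single_add, ← delPow_single_add, mul_assoc,
    ← delPow_single_add, add_assoc]
  congr 1
  by_cases hij : j = i
  · subst hij
    rw [if_pos rfl, one_mul, add_tsub_cancel_left]
    rcases Nat.eq_zero_or_pos (β j) with h0 | h0
    · simp [h0]
    · have : single j 1 + (β - single j 1) = β := by
        refine add_tsub_cancel_of_le ?_
        rw [Finsupp.single_le_iff]
        exact h0
      rw [this, Finsupp.add_apply, Finsupp.single_eq_same, Nat.cast_add, Nat.cast_one, add_smul,
        one_smul]
  · rw [if_neg hij, zero_mul, zero_add, Finsupp.add_apply,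
      Finsupp.single_eq_of_ne (Ne.symm hij), zero_add]
    rcases Nat.eq_zero_or_pos (β i) with h0 | h0
    · simp [h0]
    · congr 2
      refine (add_tsub_assoc_of_le ?_ _).symm
      rw [Finsupp.single_le_iff]
      exact h0

/-! ### The normal form of a differential operator -/

/-- The operator `∑ g_β ∂^β` with a given finite family of coefficients. -/
def nf : ((ι →₀ ℕ) →₀ Conv ι) →ₗ[ℂ] DiffOp ι :=
  Finsupp.lsum ℂ fun β => (LinearMap.mulRight ℂ (delPow β)).comp fnHom.toLinearMap

@[simp] theorem nf_single (β : ι →₀ ℕ) (g : Conv ι) : nf (single β g) = fn g * delPow β := by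
  unfold nf
  rw [Finsupp.lsum_single]
  rfl

/-- The operators in normal form are stable under left multiplication by the generators of `𝒟`. -/
theorem nf_surjective : Function.Surjective (nf (ι := ι)) := by
  suffices h : ∀ P : DiffOp ι, ∀ Q ∈ LinearMap.range (nf (ι := ι)),
      P * Q ∈ LinearMap.range (nf (ι := ι)) by
    intro P
    have := h P 1 ⟨single 0 1, by rw [nf_single, fn_one, delPow_zero, mul_one]⟩
    rwa [mul_one] at this
  intro P
  refine DiffOp.induction (p := fun P => ∀ Q ∈ LinearMap.range (nf (ι := ι)),
    P * Q ∈ LinearMap.range (nf (ι := ι))) P ?_ ?_ ?_ ?_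
  · rintro a _ ⟨G, rfl⟩
    induction G using Finsupp.induction_linear with
    | zero => rw [map_zero, mul_zero]; exact zero_mem _
    | add G H hG hH => rw [map_add, mul_add]; exact add_mem hG hH
    | single β g => exact ⟨single β (a * g), by rw [nf_single, nf_single, fn_mul, mul_assoc]⟩
  · rintro i _ ⟨G, rfl⟩
    induction G using Finsupp.induction_linear with
    | zero => rw [map_zero, mul_zero]; exact zero_mem _
    | add G H hG hH => rw [map_add, mul_add]; exact add_mem hG hH
    | single β g =>
      refine ⟨single (single i 1 + β) g + single β (pderivEnd i g), ?_⟩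
      rw [map_add, nf_single, nf_single, nf_single, ← mul_assoc, del_mul_fn, add_mul,
        delPow_single_add, mul_assoc]
  · intro P Q hP hQ R hR
    rw [add_mul]
    exact add_mem (hP R hR) (hQ R hR)
  · intro P Q hP hQ R hR
    rw [mul_assoc]
    exact hP _ (hQ R hR)

theorem nf_mul_coord (G : (ι →₀ ℕ) →₀ Conv ι) (i : ι) :
    nf G * fn (coord i) = fn (coord i) * nf G + nf (lowerCoeffs i G) := by
  induction G using Finsupp.induction_linear with
  | zero => simp
  | add G H hG hH => simp only [map_add, add_mul, mul_add, hG, hH]; abel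
  | single β g =>
    rw [lowerCoeffs_single, nf_single, nf_single, mul_assoc, delPow_mul_coord, mul_add,
      ← mul_assoc, (fn_commute g _).eq, mul_assoc, fn_smul, mul_smul_comm, smul_mul_assoc]

/-- The coefficients of a differential operator are unique: commutators with the coordinates lower
the order. -/
theorem nf_injective : Function.Injective (nf (ι := ι)) := by
  rw [injective_iff_map_eq_zero]
  suffices h : ∀ (N : ℕ) (G : (ι →₀ ℕ) →₀ Conv ι), (∀ β, N ≤ β.degree → G β = 0) →
      nf G = 0 → G = 0 by
    intro G hG
    refine h (G.support.sup Finsupp.degree + 1) G (fun β hβ => ?_) hG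
    by_contra h
    have := Finset.le_sup (f := Finsupp.degree) (Finsupp.mem_support_iff.mpr h)
    omega
  intro N
  induction N with
  | zero => exact fun G hG _ => Finsupp.ext fun β => hG β (Nat.zero_le _)
  | succ N ih =>
    intro G hG h0
    have hlow : ∀ γ i, G (γ + single i 1) = 0 := by
      intro γ i
      have h1 : lowerCoeffs i G = 0 := by
        refine ih _ (fun β hβ => ?_) ?_
        · rw [lowerCoeffs_apply, hG, smul_zero]
          rw [map_add, Finsupp.degree_single]
          omega
        · have := nf_mul_coord G i
          rwa [h0, zero_mul, mul_zero, zero_add, eq_comm] at this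
      have h2 := lowerCoeffs_apply i G γ
      rw [h1, Finsupp.zero_apply, eq_comm] at h2
      exact (smul_eq_zero_iff_right (Nat.cast_ne_zero.mpr (Nat.succ_ne_zero _))).mp h2
    have hG0 : G = single 0 (G 0) := by
      classical
      ext1 β
      rw [Finsupp.single_apply]
      split_ifs with h
      · rw [h]
      · obtain ⟨i, hi⟩ := Finsupp.ne_iff.mp (Ne.symm h)
        have : β = (β - single i 1) + single i 1 := by
          rw [tsub_add_cancel_of_le]
          rw [Finsupp.single_le_iff]
          simpa [Nat.one_le_iff_ne_zero] using hi
        rw [this]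
        exact hlow _ _
    rw [hG0, nf_single, delPow_zero, mul_one] at h0
    rw [hG0, fn_injective (h0.trans fn_zero.symm), Finsupp.single_zero]

/-- The normal form as a linear isomorphism. -/
def nfEquiv : ((ι →₀ ℕ) →₀ Conv ι) ≃ₗ[ℂ] DiffOp ι :=
  LinearEquiv.ofBijective nf ⟨nf_injective, nf_surjective⟩

/-- The coefficients `g_β` of `P = ∑ g_β ∂^β`. -/
def symb : DiffOp ι →ₗ[ℂ] ((ι →₀ ℕ) →₀ Conv ι) := nfEquiv.symm.toLinearMap

@[simp] theorem nf_symb (P : DiffOp ι) : nf (symb P) = P := nfEquiv.apply_symm_apply P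

@[simp] theorem symb_nf (G : (ι →₀ ℕ) →₀ Conv ι) : symb (nf G) = G := nfEquiv.symm_apply_apply G

theorem symb_term (g : Conv ι) (β : ι →₀ ℕ) : symb (fn g * delPow β) = single β g := by
  rw [← nf_single, symb_nf]

theorem symb_fn (g : Conv ι) : symb (fn g) = single 0 g := by
  rw [← symb_term, delPow_zero, mul_one]

theorem symb_injective : Function.Injective (symb (ι := ι)) := nfEquiv.symm.injective

theorem symb_mul_coord (P : DiffOp ι) (i : ι) (β : ι →₀ ℕ) :
    symb (P * fn (coord i)) β =
      coord i * symb P β + ((β i + 1 : ℕ) : ℂ) • symb P (β + single i 1) := by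
  have h : ∀ G : (ι →₀ ℕ) →₀ Conv ι, symb (fn (coord i) * nf G) β = coord i * G β := by
    classical
    intro G
    induction G using Finsupp.induction_linear with
    | zero => simp
    | add G H hG hH => simp only [map_add, mul_add, Finsupp.add_apply, hG, hH]
    | single γ g =>
      rw [nf_single, ← mul_assoc, ← fn_mul, symb_term, Finsupp.single_apply, Finsupp.single_apply]
      split_ifs <;> simp
  conv_lhs => rw [← nf_symb P]
  rw [nf_mul_coord, map_add, Finsupp.add_apply, h, symb_nf, lowerCoeffs_apply]

/-- An additive property of operators holds as soon as it holds for the terms of the normal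
form. -/
theorem DiffOp.sum_induction {p : DiffOp ι → Prop} (P : DiffOp ι) (h0 : p 0)
    (hadd : ∀ P Q, p P → p Q → p (P + Q))
    (hterm : ∀ β, p (fn (symb P β) * delPow β)) : p P := by
  have h : nf (symb P) = ∑ β ∈ (symb P).support, fn (symb P β) * delPow β := by
    conv_lhs => rw [← Finsupp.sum_single (symb P), Finsupp.sum, map_sum]
    simp only [nf_single]
  rw [← nf_symb P, h]
  exact Finset.sum_induction _ p hadd h0 fun β _ => hterm β

/-! ### The filtrations in terms of the normal form -/

theorem term_mem_weightFil {u v : ι → ℤ} {k : ℤ} {g : Conv ι} {β : ι →₀ ℕ}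
    (h : HasWeight u g (k - weight v β)) : fn g * delPow β ∈ weightFil u v k :=
  Submodule.subset_span ⟨g, β, fun α hα => by have := h α hα; omega, rfl⟩

theorem mem_weightFil {u v : ι → ℤ} {k : ℤ} {P : DiffOp ι} :
    P ∈ weightFil u v k ↔ ∀ β, HasWeight u (symb P β) (k - weight v β) := by
  classical
  constructor
  · intro hP
    induction hP using Submodule.span_induction with
    | mem P hP =>
      obtain ⟨g, β, h, rfl⟩ := hP
      intro γ
      rw [symb_term, Finsupp.single_apply]
      split_ifs with hγ
      · subst hγ
        intro α hα
        have := h α hα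
        omega
      · exact HasWeight.zero
    | zero => intro γ; rw [map_zero]; exact HasWeight.zero
    | add P Q _ _ hP hQ =>
      intro γ
      rw [map_add]
      exact (hP γ).add (hQ γ)
    | smul c P _ hP =>
      intro γ
      rw [map_smul]
      exact (hP γ).smul c
  · exact fun h => DiffOp.sum_induction P (zero_mem _) (fun _ _ => add_mem)
      fun β => term_mem_weightFil (h β)

section Mul

variable {u v : ι → ℤ}

theorem fn_mul_mem_weightFil {g : Conv ι} {a k : ℤ} (hg : HasWeight u g a) {P : DiffOp ι}
    (hP : P ∈ weightFil u v k) : fn g * P ∈ weightFil u v (a + k) := by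
  rw [mem_weightFil] at hP
  refine DiffOp.sum_induction (p := fun Q => fn g * Q ∈ weightFil u v (a + k)) P
    (by rw [mul_zero]; exact zero_mem _)
    (fun _ _ h1 h2 => by rw [mul_add]; exact add_mem h1 h2) fun β => ?_
  rw [← mul_assoc, ← fn_mul]
  exact term_mem_weightFil ((hg.mul (hP β)).mono (by omega))

theorem del_mul_mem_weightFil (huv : ∀ i, 0 ≤ u i + v i) (i : ι) {k : ℤ} {P : DiffOp ι}
    (hP : P ∈ weightFil u v k) : del i * P ∈ weightFil u v (v i + k) := by
  rw [mem_weightFil] at hP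
  refine DiffOp.sum_induction (p := fun Q => del i * Q ∈ weightFil u v (v i + k)) P
    (by rw [mul_zero]; exact zero_mem _)
    (fun _ _ h1 h2 => by rw [mul_add]; exact add_mem h1 h2) fun β => ?_
  rw [← mul_assoc, del_mul_fn, add_mul, mul_assoc, ← delPow_single_add]
  refine add_mem (term_mem_weightFil ((hP β).mono ?_)) (term_mem_weightFil (((hP β).pderiv i).mono ?_))
  · rw [map_add, Finsupp.weight_single, one_smul]
    omega
  · have := huv i
    omega

/-- `F_k F_l ⊆ F_{k+l}`: moving `∂_i` past a function replaces a pair `z_i ∂_i` by `1`, which does not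
raise the weight as `u_i + v_i ≥ 0`. -/
theorem weightFil_mul (huv : ∀ i, 0 ≤ u i + v i) {k l : ℤ} {P Q : DiffOp ι}
    (hP : P ∈ weightFil u v k) (hQ : Q ∈ weightFil u v l) : P * Q ∈ weightFil u v (k + l) := by
  have hdel : ∀ β, delPow β * Q ∈ weightFil u v (weight v β + l) := fun β => by
    refine exponent_induction (p := fun β => delPow β * Q ∈ weightFil u v (weight v β + l)) β
      (by simpa using hQ) fun i β ih => ?_
    rw [delPow_single_add, mul_assoc]
    have := del_mul_mem_weightFil huv i ih
    rwa [map_add, Finsupp.weight_single, one_smul, add_assoc]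
  rw [mem_weightFil] at hP
  refine DiffOp.sum_induction (p := fun P => P * Q ∈ weightFil u v (k + l)) P
    (by rw [zero_mul]; exact zero_mem _)
    (fun _ _ h1 h2 => by rw [add_mul]; exact add_mem h1 h2) fun β => ?_
  rw [mul_assoc]
  have := fn_mul_mem_weightFil (hP β) (hdel β)
  rwa [show k - weight v β + (weight v β + l) = k + l by omega] at this

theorem weightFil_mono {k l : ℤ} (h : k ≤ l) {P : DiffOp ι} (hP : P ∈ weightFil u v k) :
    P ∈ weightFil u v l := by
  rw [mem_weightFil] at hP ⊢
  exact fun β => (hP β).mono (by omega)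

theorem biFil_mul (huv : ∀ i, 0 ≤ u i + v i) {d e k l : ℤ} {P Q : DiffOp ι}
    (hP : P ∈ biFil u v d k) (hQ : Q ∈ biFil u v e l) : P * Q ∈ biFil u v (d + e) (k + l) :=
  ⟨weightFil_mul (fun _ => by norm_num) hP.1 hQ.1, weightFil_mul huv hP.2 hQ.2⟩

theorem biFil_mono {d e k l : ℤ} (h : d ≤ e) (h' : k ≤ l) {P : DiffOp ι}
    (hP : P ∈ biFil u v d k) : P ∈ biFil u v e l :=
  ⟨weightFil_mono h hP.1, weightFil_mono h' hP.2⟩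

/-- A term `g ∂^β` belongs to `F_{d,k}` when `|β| ≤ d` and the weights of `g` are bounded. -/
theorem term_mem_biFil {d k : ℤ} {g : Conv ι} {β : ι →₀ ℕ}
    (hd : weight (fun _ => (1 : ℤ)) β ≤ d) (h : HasWeight u g (k - weight v β)) :
    fn g * delPow β ∈ biFil u v d k :=
  ⟨term_mem_weightFil (hasWeight_zero_fun (by omega)), term_mem_weightFil h⟩

theorem fn_mem_biFil {k : ℤ} {g : Conv ι} (h : HasWeight u g k) : fn g ∈ biFil u v 0 k := by
  have := term_mem_biFil (u := u) (v := v) (d := 0) (k := k) (g := g) (β := 0)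
    (by simp) (by simpa using h)
  simpa using this

theorem one_mem_biFil : (1 : DiffOp ι) ∈ biFil u v 0 0 := by
  rw [← fn_one]
  exact fn_mem_biFil (HasWeight.one le_rfl)

theorem del_mem_biFil (i : ι) : (del i : DiffOp ι) ∈ biFil u v 1 (v i) := by
  have := term_mem_biFil (u := u) (v := v) (d := 1) (k := v i) (g := 1) (β := single i 1)
    (by simp [Finsupp.weight_single]) (by
      rw [Finsupp.weight_single, one_smul, sub_self]; exact HasWeight.one le_rfl)
  rwa [fn_one, one_mul, delPow_single] at this

theorem symb_eq_zero_of_mem {d : ℤ} {P : DiffOp ι}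
    (hP : P ∈ weightFil (fun _ => 0) (fun _ => 1) d) {β : ι →₀ ℕ}
    (hβ : d < weight (fun _ => (1 : ℤ)) β) : symb P β = 0 := by
  ext α
  by_contra h
  have := mem_weightFil.mp hP β α h
  rw [weight_zero_fun] at this
  omega

theorem biFil_eq_zero {d k : ℤ} (hd : d < 0) {P : DiffOp ι} (hP : P ∈ biFil u v d k) : P = 0 :=
  symb_injective (Finsupp.ext fun β => by
    rw [map_zero]
    exact symb_eq_zero_of_mem hP.1 (hd.trans_le (weight_one_nonneg β)))

/-- Operators of order `0` are functions. -/
theorem exists_fn_of_mem_biFil {k : ℤ} {P : DiffOp ι} (hP : P ∈ biFil u v 0 k) :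
    ∃ g, P = fn g ∧ HasWeight u g k := by
  refine ⟨symb P 0, symb_injective (Finsupp.ext fun β => ?_), ?_⟩
  · rw [symb_fn]
    by_cases h : β = 0
    · rw [h, Finsupp.single_eq_same]
    · rw [Finsupp.single_eq_of_ne h]
      refine symb_eq_zero_of_mem hP.1 ?_
      by_contra h2
      exact h (weight_one_eq_zero (not_lt.mp h2))
  · simpa using mem_weightFil.mp hP.2 0

/-- Induction on an element of `F_{d,k}` through the terms of its normal form. -/
theorem biFil_induction {d k : ℤ} {p : DiffOp ι → Prop} {P : DiffOp ι} (hP : P ∈ biFil u v d k)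
    (h0 : p 0) (hadd : ∀ P Q, p P → p Q → p (P + Q))
    (hterm : ∀ g β, weight (fun _ => (1 : ℤ)) β ≤ d → HasWeight u g (k - weight v β) →
      p (fn g * delPow β)) : p P := by
  refine DiffOp.sum_induction P h0 hadd fun β => ?_
  by_cases h : weight (fun _ => (1 : ℤ)) β ≤ d
  · exact hterm _ _ h (mem_weightFil.mp hP.2 β)
  · rw [symb_eq_zero_of_mem hP.1 (not_le.mp h), fn_zero, zero_mul]
    exact h0

end Mul

end DelPow

end

section

/-! ### Filtered maps between free modules -/

theorem free_eq_sum {r : ℕ} (y : Fin r → DiffOp ι) :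
    y = ∑ l, y l • (Pi.single l 1 : Fin r → DiffOp ι) := by
  ext1 j
  rw [Finset.sum_apply, Finset.sum_eq_single j]
  · simp
  · intro b _ hb
    rw [Pi.smul_apply, Pi.single_eq_of_ne (Ne.symm hb), smul_zero]
  · intro h; exact absurd (Finset.mem_univ _) h

theorem map_free_eq_sum {r : ℕ} {N : Type} [AddCommGroup N] [Module (DiffOp ι) N]
    (ψ : (Fin r → DiffOp ι) →ₗ[DiffOp ι] N) (y : Fin r → DiffOp ι) :
    ψ y = ∑ l, y l • ψ (Pi.single l 1) := by
  conv_lhs => rw [free_eq_sum y, map_sum]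
  simp only [map_smul]

section Filtered

variable [Fintype ι] {u v : ι → ℤ}

theorem mem_freeFil {r : ℕ} {n m : Fin r → ℤ} {d k : ℤ} {y : Fin r → DiffOp ι} :
    y ∈ freeFil u v n m d k ↔ ∀ l, y l ∈ biFil u v (d - n l) (k - m l) := by
  simp [freeFil, AddSubgroup.mem_pi]

theorem smul_mem_freeFil (huv : ∀ i, 0 ≤ u i + v i) {r : ℕ} {n m : Fin r → ℤ} {d k e l : ℤ}
    {P : DiffOp ι} (hP : P ∈ biFil u v d k) {y : Fin r → DiffOp ι}
    (hy : y ∈ freeFil u v n m e l) : P • y ∈ freeFil u v n m (d + e) (k + l) := by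
  rw [mem_freeFil] at hy ⊢
  intro j
  have := biFil_mul huv hP (hy j)
  rwa [← add_sub_assoc, ← add_sub_assoc] at this

theorem single_mem_freeFil {r : ℕ} {n m : Fin r → ℤ} (l : Fin r) {d k : ℤ} {P : DiffOp ι}
    (hP : P ∈ biFil u v (d - n l) (k - m l)) : Pi.single l P ∈ freeFil u v n m d k := by
  rw [mem_freeFil]
  intro j
  by_cases h : j = l
  · subst h; rwa [Pi.single_eq_same]
  · rw [Pi.single_eq_of_ne h]; exact zero_mem _

theorem basis_mem_freeFil {r : ℕ} (n m : Fin r → ℤ) (l : Fin r) :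
    Pi.single l 1 ∈ freeFil u v n m (n l) (m l) := by
  refine single_mem_freeFil l ?_
  rw [sub_self, sub_self]
  exact one_mem_biFil

/-- A linear map compatible with bifiltrations. -/
def IsFil {M N : Type} [AddCommGroup M] [Module (DiffOp ι) M] [AddCommGroup N]
    [Module (DiffOp ι) N] (F : ℤ → ℤ → AddSubgroup M) (G : ℤ → ℤ → AddSubgroup N)
    (ψ : M →ₗ[DiffOp ι] N) : Prop :=
  ∀ d k, ∀ y ∈ F d k, ψ y ∈ G d k

/-- A map out of a free module is filtered once it is so on the basis vectors. -/
theorem isFil_of_basis {r : ℕ} (n m : Fin r → ℤ) {N : Type} [AddCommGroup N]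
    [Module (DiffOp ι) N] {G : ℤ → ℤ → AddSubgroup N}
    (hG : ∀ d k e l (P : DiffOp ι) (y : N), P ∈ biFil u v d k → y ∈ G e l →
      P • y ∈ G (d + e) (k + l))
    (ψ : (Fin r → DiffOp ι) →ₗ[DiffOp ι] N) (h : ∀ l, ψ (Pi.single l 1) ∈ G (n l) (m l)) :
    IsFil (freeFil u v n m) G ψ := by
  intro d k y hy
  rw [mem_freeFil] at hy
  rw [map_free_eq_sum]
  refine sum_mem fun l _ => ?_
  have := hG _ _ _ _ _ _ (hy l) (h l)
  rwa [sub_add_cancel, sub_add_cancel] at this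

/-- Bifiltered free modules are projective for strict surjections. -/
theorem exists_lift (huv : ∀ i, 0 ≤ u i + v i) {r s : ℕ} {n m : Fin r → ℤ} {n' m' : Fin s → ℤ}
    {N : Type} [AddCommGroup N] [Module (DiffOp ι) N]
    (α : (Fin s → DiffOp ι) →ₗ[DiffOp ι] N) (ψ : (Fin r → DiffOp ι) →ₗ[DiffOp ι] N)
    (h : ∀ d k, ∀ y ∈ freeFil u v n m d k, ∃ z ∈ freeFil u v n' m' d k, α z = ψ y) :
    ∃ χ : (Fin r → DiffOp ι) →ₗ[DiffOp ι] (Fin s → DiffOp ι),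
      IsFil (freeFil u v n m) (freeFil u v n' m') χ ∧ ∀ y, α (χ y) = ψ y := by
  choose z hz hαz using fun l => h _ _ _ (basis_mem_freeFil n m l)
  have hbasis : ∀ l, Fintype.linearCombination (DiffOp ι) z (Pi.single l 1) = z l := fun l => by
    rw [Fintype.linearCombination_apply_single, one_smul]
  refine ⟨Fintype.linearCombination (DiffOp ι) z, isFil_of_basis n m ?_ _ fun l => ?_, fun y => ?_⟩
  · exact fun _ _ _ _ _ _ hP hy => smul_mem_freeFil huv hP hy
  · rw [hbasis]; exact hz l
  · rw [map_free_eq_sum ψ, Fintype.linearCombination_apply, map_sum]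
    exact Finset.sum_congr rfl fun l _ => by rw [map_smul, hαz]

/-- An additive map sends `𝔪 M` to `𝔪 N`, up to a shift `t` of the second filtration index, if it
respects the filtrations and sends the products of homogeneous elements that span `𝔪 M` to
`𝔪 N`. -/
theorem map_mem_maxIdealMul [Fintype κ] {u' v' : κ → ℤ} {M N : Type} [AddCommGroup M]
    [Module (DiffOp ι) M] [AddCommGroup N] [Module (DiffOp κ) N] {F : ℤ → ℤ → AddSubgroup M}
    {G : ℤ → ℤ → AddSubgroup N} (ψ : M →+ N) (t : ℤ)
    (hψ : ∀ d k, ∀ y ∈ F d k, ψ y ∈ G d (k + t))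
    (hmul : ∀ (d₁ d₂ d₃ k₁ k₂ k₃ : ℤ) (P Q : DiffOp ι) (y : M), P ∈ biFil u v d₁ k₁ →
      Q ∈ maxIdealGens u v d₂ k₂ → y ∈ F d₃ k₃ →
      ψ (P • Q • y) ∈ maxIdealMul u' v' G (d₁ + d₂ + d₃) (k₁ + k₂ + (k₃ + t)))
    {d k : ℤ} {y : M} (hy : y ∈ maxIdealMul u v F d k) :
    ψ y ∈ maxIdealMul u' v' G d (k + t) := by
  suffices h : maxIdealMul u v F d k ≤ (maxIdealMul u' v' G d (k + t)).comap ψ from h hy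
  refine sup_le (fun y hy => ?_) ((AddSubgroup.closure_le _).mpr ?_)
  · have := hψ _ _ _ hy
    rw [sub_add_eq_add_sub] at this
    exact AddSubgroup.mem_sup_left this
  · rintro _ ⟨d₁, d₂, d₃, k₁, k₂, k₃, P, Q, y, rfl, rfl, hP, hQ, hy, rfl⟩
    have := hmul _ _ _ _ _ _ _ _ _ hP hQ hy
    rwa [← add_assoc] at this

theorem smul_smul_mem_maxIdealMul {M : Type} [AddCommGroup M] [Module (DiffOp ι) M]
    {F : ℤ → ℤ → AddSubgroup M} {d₁ d₂ d₃ k₁ k₂ k₃ : ℤ} {P Q : DiffOp ι} {y : M}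
    (hP : P ∈ biFil u v d₁ k₁) (hQ : Q ∈ maxIdealGens u v d₂ k₂) (hy : y ∈ F d₃ k₃) :
    P • Q • y ∈ maxIdealMul u v F (d₁ + d₂ + d₃) (k₁ + k₂ + k₃) :=
  AddSubgroup.mem_sup_right (AddSubgroup.subset_closure
    ⟨d₁, d₂, d₃, k₁, k₂, k₃, P, Q, y, rfl, rfl, hP, hQ, hy, rfl⟩)

/-- Linear maps that respect the filtrations up to a shift respect the submodules generated by
`𝔪`. -/
theorem linearMap_mem_maxIdealMul {M N : Type} [AddCommGroup M] [Module (DiffOp ι) M]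
    [AddCommGroup N] [Module (DiffOp ι) N] {F : ℤ → ℤ → AddSubgroup M}
    {G : ℤ → ℤ → AddSubgroup N} (ψ : M →ₗ[DiffOp ι] N) (t : ℤ)
    (hψ : ∀ d k, ∀ y ∈ F d k, ψ y ∈ G d (k + t)) {d k : ℤ} {y : M}
    (hy : y ∈ maxIdealMul u v F d k) : ψ y ∈ maxIdealMul u v G d (k + t) := by
  refine map_mem_maxIdealMul ψ.toAddMonoidHom t hψ ?_ hy
  intro _ _ _ _ _ _ P Q y hP hQ hy
  change ψ (P • Q • y) ∈ maxIdealMul u v G _ _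
  rw [map_smul, map_smul]
  exact smul_smul_mem_maxIdealMul hP hQ (hψ _ _ _ hy)

theorem IsFil.map_maxIdealMul {M N : Type} [AddCommGroup M] [Module (DiffOp ι) M]
    [AddCommGroup N] [Module (DiffOp ι) N] {F : ℤ → ℤ → AddSubgroup M}
    {G : ℤ → ℤ → AddSubgroup N} {ψ : M →ₗ[DiffOp ι] N} (hψ : IsFil F G ψ) {d k : ℤ} {y : M}
    (hy : y ∈ maxIdealMul u v F d k) : ψ y ∈ maxIdealMul u v G d k := by
  have := linearMap_mem_maxIdealMul ψ 0 (fun d k y hy => by rw [add_zero]; exact hψ d k y hy) hy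
  rwa [add_zero] at this

/-- `𝔪 M` is stable under the action of the bigraded ring. -/
theorem smul_mem_maxIdealMul (huv : ∀ i, 0 ≤ u i + v i) {M : Type} [AddCommGroup M]
    [Module (DiffOp ι) M] {F : ℤ → ℤ → AddSubgroup M}
    (hF : ∀ d k e l (P : DiffOp ι) (y : M), P ∈ biFil u v d k → y ∈ F e l →
      P • y ∈ F (d + e) (k + l)) {a b d k : ℤ} {P : DiffOp ι} (hP : P ∈ biFil u v a b) {y : M}
    (hy : y ∈ maxIdealMul u v F d k) : P • y ∈ maxIdealMul u v F (a + d) (b + k) := by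
  suffices h : maxIdealMul u v F d k ≤
      (maxIdealMul u v F (a + d) (b + k)).comap (DistribSMul.toAddMonoidHom M P) from h hy
  refine sup_le (fun y hy => ?_) ((AddSubgroup.closure_le _).mpr ?_)
  · have := hF _ _ _ _ _ _ hP hy
    rw [← add_sub_assoc] at this
    exact AddSubgroup.mem_sup_left this
  · rintro _ ⟨d₁, d₂, d₃, k₁, k₂, k₃, Q, G, y, rfl, rfl, hQ, hG, hy, rfl⟩
    change P • Q • G • y ∈ maxIdealMul u v F _ _
    rw [← mul_smul P]
    have := smul_smul_mem_maxIdealMul (biFil_mul huv hP hQ) hG hy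
    rwa [add_assoc, add_assoc a, ← add_assoc d₁, add_assoc (b + k₁), add_assoc b,
      ← add_assoc k₁] at this

/-! ### Constant terms -/

/-- The constant term `g_0(0)` of `∑ g_β ∂^β`. -/
def opConst (P : DiffOp ι) : ℂ := Conv.const (symb P 0)

theorem opConst_add (P Q : DiffOp ι) : opConst (P + Q) = opConst P + opConst Q := by
  simp [opConst]

theorem opConst_zero : opConst (0 : DiffOp ι) = 0 := by simp [opConst]

theorem opConst_neg (P : DiffOp ι) : opConst (-P) = -opConst P := by simp [opConst]

theorem opConst_sum {σ : Type} (s : Finset σ) (P : σ → DiffOp ι) :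
    opConst (∑ i ∈ s, P i) = ∑ i ∈ s, opConst (P i) :=
  map_sum (⟨⟨opConst, opConst_zero⟩, opConst_add⟩ : DiffOp ι →+ ℂ) P s

theorem opConst_fn (g : Conv ι) : opConst (fn g) = Conv.const g := by
  rw [opConst, symb_fn, Finsupp.single_eq_same]

theorem opConst_one : opConst (1 : DiffOp ι) = 1 := by
  rw [← fn_one, opConst_fn, map_one]

/-- The constant term of a product of operators of opposite bidegrees vanishes unless both bidegrees
are `(0,0)`: operators of negative order are zero, functions of negative weight have no constant
term. -/
theorem opConst_mul {a b : ℤ} {P Q : DiffOp ι} (hP : P ∈ biFil u v a b)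
    (hQ : Q ∈ biFil u v (-a) (-b)) :
    opConst (P * Q) = if a = 0 ∧ b = 0 then opConst P * opConst Q else 0 := by
  rcases lt_trichotomy a 0 with h | rfl | h
  · rw [biFil_eq_zero h hP, zero_mul, opConst_zero, if_neg (by omega)]
  · obtain ⟨p, rfl, hp⟩ := exists_fn_of_mem_biFil hP
    obtain ⟨q, rfl, hq⟩ := exists_fn_of_mem_biFil hQ
    rw [← fn_mul, opConst_fn, opConst_fn, opConst_fn, map_mul]
    rcases lt_trichotomy b 0 with hb | rfl | hb
    · rw [hp.const_eq_zero hb, zero_mul, ite_self]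
    · rw [if_pos ⟨rfl, rfl⟩]
    · rw [hq.const_eq_zero (by omega), mul_zero, ite_self]
  · rw [biFil_eq_zero (by omega) hQ, mul_zero, opConst_zero, if_neg (by omega)]

/-- `gr^V(R(𝒟^r)) / 𝔪` has the basis vectors as a basis: an element of `𝔪` has no constant term in
the components of its own bidegree. -/
theorem opConst_eq_zero_of_mem_maxIdealMul {r : ℕ} {n m : Fin r → ℤ} (l : Fin r)
    {y : Fin r → DiffOp ι} (hy : y ∈ maxIdealMul u v (freeFil u v n m) (n l) (m l)) :
    opConst (y l) = 0 := by
  suffices h : maxIdealMul u v (freeFil u v n m) (n l) (m l) ≤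
      (⟨⟨fun y => opConst (y l), opConst_zero⟩, fun _ _ => opConst_add _ _⟩ :
        (Fin r → DiffOp ι) →+ ℂ).ker from h hy
  refine sup_le (fun y hy => ?_) ((AddSubgroup.closure_le _).mpr ?_)
  · have := mem_freeFil.mp hy l
    rw [sub_self, sub_right_comm, sub_self, zero_sub] at this
    obtain ⟨g, hg, hw⟩ := exists_fn_of_mem_biFil this
    change opConst (y l) = 0
    rw [hg, opConst_fn, hw.const_eq_zero (by omega)]
  · rintro _ ⟨d₁, d₂, d₃, k₁, k₂, k₃, P, Q, y, hd, hk, hP, hQ, hy, rfl⟩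
    have hyl := mem_freeFil.mp hy l
    change opConst (P * (Q * y l)) = 0
    rcases lt_or_ge d₁ 0 with h1 | h1
    · rw [biFil_eq_zero h1 hP, zero_mul, opConst_zero]
    rcases lt_or_ge (d₃ - n l) 0 with h3 | h3
    · rw [biFil_eq_zero h3 hyl, mul_zero, mul_zero, opConst_zero]
    rcases hQ with ⟨h2, i, -, rfl⟩ | ⟨h2, -⟩
    · obtain rfl : d₁ = 0 := by omega
      have h3' : d₃ - n l = 0 := by omega
      rw [h3'] at hyl
      obtain ⟨p, rfl, -⟩ := exists_fn_of_mem_biFil hP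
      obtain ⟨q, hq, -⟩ := exists_fn_of_mem_biFil hyl
      rw [hq, ← fn_mul, ← fn_mul, opConst_fn, map_mul, map_mul, Conv.const_coord, zero_mul,
        mul_zero]
    · omega

/-- Diagonal entries of the product of the constant-term matrices of two filtered maps whose
composite is the identity modulo `𝔪`. -/
theorem sum_opConst_eq_one {r s : ℕ} {n m : Fin r → ℤ} {n' m' : Fin s → ℤ}
    {φ : (Fin r → DiffOp ι) →ₗ[DiffOp ι] (Fin s → DiffOp ι)}
    {ψ : (Fin s → DiffOp ι) →ₗ[DiffOp ι] (Fin r → DiffOp ι)}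
    (hφ : IsFil (freeFil u v n m) (freeFil u v n' m') φ)
    (hψ : IsFil (freeFil u v n' m') (freeFil u v n m) ψ)
    (h : ∀ d k, ∀ y ∈ freeFil u v n m d k, ψ (φ y) - y ∈ maxIdealMul u v (freeFil u v n m) d k)
    (l : Fin r) :
    ∑ j with n' j = n l ∧ m' j = m l,
      opConst (φ (Pi.single l 1) j) * opConst (ψ (Pi.single j 1) l) = 1 := by
  have h1 := opConst_eq_zero_of_mem_maxIdealMul l (h _ _ _ (basis_mem_freeFil n m l))
  rw [Pi.sub_apply, Pi.single_eq_same, sub_eq_add_neg, opConst_add, opConst_neg, opConst_one,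
    ← sub_eq_add_neg, sub_eq_zero, map_free_eq_sum ψ, Finset.sum_apply, opConst_sum] at h1
  rw [← h1, Finset.sum_filter]
  refine Finset.sum_congr rfl fun j _ => ?_
  have ha := mem_freeFil.mp (hφ _ _ _ (basis_mem_freeFil n m l)) j
  have hb := mem_freeFil.mp (hψ _ _ _ (basis_mem_freeFil n' m' j)) l
  rw [← neg_sub (n l), ← neg_sub (m l)] at hb
  rw [Pi.smul_apply, smul_eq_mul, opConst_mul ha hb]
  exact if_congr (by omega) rfl rfl

end Filtered

/-! ### Uniqueness of minimal resolutions -/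

section Unique

variable [Fintype ι] {u v : ι → ℤ} {M : Type} [AddCommGroup M] [Module (DiffOp ι) M]
  {F : ℤ → ℤ → AddSubgroup M}

namespace BifilteredFreeResolution

/-- The bifiltration of the `i`-th module of a resolution. -/
abbrev fil (R : BifilteredFreeResolution u v F) (i : ℕ) :
    ℤ → ℤ → AddSubgroup (Fin (R.rank i) → DiffOp ι) := freeFil u v (R.n i) (R.m i)

variable (R R' : BifilteredFreeResolution u v F)

theorem exists_lift_zero {d k : ℤ} {y : Fin (R.rank 0) → DiffOp ι} (hy : y ∈ R.fil 0 d k)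
    (h : R.ε y = 0) : ∃ z ∈ R.fil 1 d k, R.φ 0 z = y := by
  have : y ∈ R.φ 0 '' (freeFil u v (R.n 1) (R.m 1) d k : Set _) := by
    rw [R.fil_exact_zero]; exact ⟨hy, h⟩
  exact this

theorem exists_lift_succ {i : ℕ} {d k : ℤ} {y : Fin (R.rank (i + 1)) → DiffOp ι}
    (hy : y ∈ R.fil (i + 1) d k) (h : R.φ i y = 0) :
    ∃ z ∈ R.fil (i + 2) d k, R.φ (i + 1) z = y := by
  have : y ∈ R.φ (i + 1) '' (freeFil u v (R.n (i + 2)) (R.m (i + 2)) d k : Set _) := by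
    rw [R.fil_exact_succ]; exact ⟨hy, h⟩
  exact this

theorem isFil_φ (i : ℕ) : IsFil (R.fil (i + 1)) (R.fil i) (R.φ i) := by
  intro d k y hy
  cases i with
  | zero =>
    have : R.φ 0 y ∈ R.φ 0 '' (freeFil u v (R.n 1) (R.m 1) d k : Set _) := ⟨y, hy, rfl⟩
    rw [R.fil_exact_zero] at this
    exact this.1
  | succ i =>
    have : R.φ (i + 1) y ∈ R.φ (i + 1) '' (freeFil u v (R.n (i + 2)) (R.m (i + 2)) d k : Set _) :=
      ⟨y, hy, rfl⟩
    rw [R.fil_exact_succ] at this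
    exact this.1

theorem ε_mem {d k : ℤ} {y : Fin (R.rank 0) → DiffOp ι} (hy : y ∈ R.fil 0 d k) :
    R.ε y ∈ F d k := by
  have : R.ε y ∈ R.ε '' (freeFil u v (R.n 0) (R.m 0) d k : Set _) := ⟨y, hy, rfl⟩
  rwa [R.fil_ε] at this

theorem exists_lift_ε {d k : ℤ} {x : M} (hx : x ∈ F d k) : ∃ y ∈ R.fil 0 d k, R.ε y = x := by
  have : x ∈ R.ε '' (freeFil u v (R.n 0) (R.m 0) d k : Set _) := by rwa [R.fil_ε]
  exact this

theorem ε_φ (y : Fin (R.rank 1) → DiffOp ι) : R.ε (R.φ 0 y) = 0 := R.exact_zero.apply_apply_eq_zero y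

theorem φ_φ (i : ℕ) (y : Fin (R.rank (i + 2)) → DiffOp ι) : R.φ i (R.φ (i + 1) y) = 0 :=
  (R.exact_succ i).apply_apply_eq_zero y

/-- A filtered map `L_i → L'_i` that can be continued by one step to a filtered morphism of
complexes. -/
def Continues (i : ℕ) (α : (Fin (R.rank i) → DiffOp ι) →ₗ[DiffOp ι] (Fin (R'.rank i) → DiffOp ι)) :
    Prop :=
  IsFil (R.fil i) (R'.fil i) α ∧
    ∀ d k, ∀ y ∈ R.fil (i + 1) d k, ∃ z ∈ R'.fil (i + 1) d k, R'.φ i z = α (R.φ i y)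

theorem exists_continues_zero (huv : ∀ i, 0 ≤ u i + v i) :
    ∃ α, Continues R R' 0 α ∧ ∀ y, R'.ε (α y) = R.ε y := by
  obtain ⟨α, hα, h⟩ := exists_lift (u := u) (v := v) (n := R.n 0) (m := R.m 0) (n' := R'.n 0)
    (m' := R'.m 0) huv R'.ε R.ε (fun d k y hy => R'.exists_lift_ε (R.ε_mem hy))
  refine ⟨α, ⟨hα, fun d k y hy => ?_⟩, h⟩
  exact R'.exists_lift_zero (hα _ _ _ (R.isFil_φ 0 _ _ _ hy)) (by rw [h, R.ε_φ])

theorem Continues.exists_succ (huv : ∀ i, 0 ≤ u i + v i) {i : ℕ}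
    {α : (Fin (R.rank i) → DiffOp ι) →ₗ[DiffOp ι] (Fin (R'.rank i) → DiffOp ι)}
    (hα : Continues R R' i α) :
    ∃ β, Continues R R' (i + 1) β ∧ ∀ y, R'.φ i (β y) = α (R.φ i y) := by
  obtain ⟨β, hβ, h⟩ := exists_lift (u := u) (v := v) (n := R.n (i + 1)) (m := R.m (i + 1))
    (n' := R'.n (i + 1)) (m' := R'.m (i + 1)) huv (R'.φ i) (α ∘ₗ R.φ i) hα.2
  refine ⟨β, ⟨hβ, fun d k y hy => ?_⟩, h⟩
  exact R'.exists_lift_succ (hβ _ _ _ (R.isFil_φ (i + 1) _ _ _ hy))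
    (by rw [h, LinearMap.comp_apply, R.φ_φ, map_zero])

end BifilteredFreeResolution

namespace MinimalBifilteredFreeResolution

open BifilteredFreeResolution

variable (R R' : MinimalBifilteredFreeResolution u v F)

/-- The endomorphism `α` of `L_i` has a filtered homotopy to the identity, up to `𝔪 L_i`. -/
def Homotopic (i : ℕ) (α : (Fin (R.rank i) → DiffOp ι) →ₗ[DiffOp ι] (Fin (R.rank i) → DiffOp ι)) :
    Prop :=
  ∃ h : (Fin (R.rank i) → DiffOp ι) →ₗ[DiffOp ι] (Fin (R.rank (i + 1)) → DiffOp ι),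
    IsFil (R.fil i) (R.fil (i + 1)) h ∧
    (∀ y, R.φ i (h (R.φ i y)) = α (R.φ i y) - R.φ i y) ∧
    ∀ d k, ∀ y ∈ R.fil i d k, α y - y - R.φ i (h y) ∈ maxIdealMul u v (R.fil i) d k

theorem homotopic_zero (huv : ∀ i, 0 ≤ u i + v i)
    {α : (Fin (R.rank 0) → DiffOp ι) →ₗ[DiffOp ι] (Fin (R.rank 0) → DiffOp ι)}
    (hα : IsFil (R.fil 0) (R.fil 0) α) (hε : ∀ y, R.ε (α y) = R.ε y) : R.Homotopic 0 α := by
  obtain ⟨h, hh, hφ⟩ := exists_lift (u := u) (v := v) (n := R.n 0) (m := R.m 0) (n' := R.n 1)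
    (m' := R.m 1) huv (R.φ 0) (α - LinearMap.id)
    (fun d k y hy => R.exists_lift_zero (sub_mem (hα _ _ _ hy) hy)
      (by rw [LinearMap.sub_apply, LinearMap.id_apply, map_sub, hε, sub_self]))
  refine ⟨h, hh, fun y => hφ _, fun d k y hy => ?_⟩
  rw [hφ, LinearMap.sub_apply, LinearMap.id_apply, sub_self]
  exact zero_mem _

theorem Homotopic.succ (huv : ∀ i, 0 ≤ u i + v i) {i : ℕ}
    {α : (Fin (R.rank i) → DiffOp ι) →ₗ[DiffOp ι] (Fin (R.rank i) → DiffOp ι)}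
    (hα : R.Homotopic i α)
    {β : (Fin (R.rank (i + 1)) → DiffOp ι) →ₗ[DiffOp ι] (Fin (R.rank (i + 1)) → DiffOp ι)}
    (hβ : IsFil (R.fil (i + 1)) (R.fil (i + 1)) β) (h : ∀ y, R.φ i (β y) = α (R.φ i y)) :
    R.Homotopic (i + 1) β := by
  obtain ⟨s, hs, hφs, -⟩ := hα
  obtain ⟨t, ht, hφt⟩ := exists_lift (u := u) (v := v) (n := R.n (i + 1)) (m := R.m (i + 1))
    (n' := R.n (i + 2)) (m' := R.m (i + 2)) huv (R.φ (i + 1)) (β - LinearMap.id - s ∘ₗ R.φ i)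
    (fun d k y hy => R.exists_lift_succ
      (sub_mem (sub_mem (hβ _ _ _ hy) hy) (hs _ _ _ (R.isFil_φ i _ _ _ hy)))
      (by
        simp only [LinearMap.sub_apply, LinearMap.id_apply, LinearMap.comp_apply, map_sub]
        rw [h, hφs, sub_self]))
  refine ⟨t, ht, fun y => ?_, fun d k y hy => ?_⟩
  · rw [hφt]
    simp only [LinearMap.sub_apply, LinearMap.id_apply, LinearMap.comp_apply]
    rw [R.φ_φ, map_zero, sub_zero]
  · rw [hφt]
    simp only [LinearMap.sub_apply, LinearMap.id_apply, LinearMap.comp_apply, sub_sub_cancel]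
    exact hs.map_maxIdealMul (R.minimal _ _ _ _ hy)

theorem Homotopic.sub_mem {i : ℕ}
    {α : (Fin (R.rank i) → DiffOp ι) →ₗ[DiffOp ι] (Fin (R.rank i) → DiffOp ι)}
    (hα : R.Homotopic i α) {d k : ℤ} {y : Fin (R.rank i) → DiffOp ι} (hy : y ∈ R.fil i d k) :
    α y - y ∈ maxIdealMul u v (R.fil i) d k := by
  obtain ⟨s, hs, -, h⟩ := hα
  have := add_mem (h _ _ _ hy) (R.minimal _ _ _ _ (hs _ _ _ hy))
  rwa [sub_add_cancel] at this

/-- Two minimal resolutions are compared by filtered maps that are mutually inverse up to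
homotopy. -/
theorem exists_comparison (huv : ∀ i, 0 ≤ u i + v i) (i : ℕ) :
    ∃ α β, Continues R.toBifilteredFreeResolution R'.toBifilteredFreeResolution i α ∧
      Continues R'.toBifilteredFreeResolution R.toBifilteredFreeResolution i β ∧
      R.Homotopic i (β ∘ₗ α) ∧ R'.Homotopic i (α ∘ₗ β) := by
  induction i with
  | zero =>
    obtain ⟨α, hα, h⟩ := exists_continues_zero R.toBifilteredFreeResolution
      R'.toBifilteredFreeResolution huv
    obtain ⟨β, hβ, h'⟩ := exists_continues_zero R'.toBifilteredFreeResolution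
      R.toBifilteredFreeResolution huv
    refine ⟨α, β, hα, hβ, R.homotopic_zero huv ?_ fun y => ?_, R'.homotopic_zero huv ?_ fun y => ?_⟩
    · exact fun d k y hy => hβ.1 _ _ _ (hα.1 _ _ _ hy)
    · rw [LinearMap.comp_apply, h', h]
    · exact fun d k y hy => hα.1 _ _ _ (hβ.1 _ _ _ hy)
    · rw [LinearMap.comp_apply, h, h']
  | succ i ih =>
    obtain ⟨α, β, hα, hβ, hs, ht⟩ := ih
    obtain ⟨α', hα', h⟩ := Continues.exists_succ _ _ huv hα
    obtain ⟨β', hβ', h'⟩ := Continues.exists_succ _ _ huv hβ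
    refine ⟨α', β', hα', hβ', hs.succ R huv ?_ fun y => ?_, ht.succ R' huv ?_ fun y => ?_⟩
    · exact fun d k y hy => hβ'.1 _ _ _ (hα'.1 _ _ _ hy)
    · rw [LinearMap.comp_apply, h', h, LinearMap.comp_apply]
    · exact fun d k y hy => hα'.1 _ _ _ (hβ'.1 _ _ _ hy)
    · rw [LinearMap.comp_apply, h, h', LinearMap.comp_apply]

/-- Two minimal resolutions have, in each step, the same number of basis vectors of each bidegree:
modulo `𝔪` the comparison maps are mutually inverse matrices of complex numbers. -/
theorem card_shift_eq (huv : ∀ i, 0 ≤ u i + v i) (i : ℕ) (d k : ℤ) :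
    (Finset.univ.filter fun l => R.n i l = d ∧ R.m i l = k).card =
      (Finset.univ.filter fun l => R'.n i l = d ∧ R'.m i l = k).card := by
  obtain ⟨α, β, hα, hβ, hs, ht⟩ := exists_comparison R R' huv i
  have h1 := sum_opConst_eq_one hα.1 hβ.1 fun d k y hy => hs.sub_mem R hy
  have h2 := sum_opConst_eq_one hβ.1 hα.1 fun d k y hy => ht.sub_mem R' hy
  have key : ((Finset.univ.filter fun l => R.n i l = d ∧ R.m i l = k).card : ℂ) =
      ((Finset.univ.filter fun l => R'.n i l = d ∧ R'.m i l = k).card : ℂ) := by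
    -- both sides are the trace of the product of the constant-term matrices
    calc ((Finset.univ.filter fun l => R.n i l = d ∧ R.m i l = k).card : ℂ)
        = ∑ l with R.n i l = d ∧ R.m i l = k, ∑ j with R'.n i j = d ∧ R'.m i j = k,
            opConst (α (Pi.single l 1) j) * opConst (β (Pi.single j 1) l) := by
          rw [Finset.card_eq_sum_ones, Nat.cast_sum]
          refine Finset.sum_congr rfl fun l hl => ?_
          have hl' := (Finset.mem_filter.mp hl).2
          have := h1 l
          rw [hl'.1, hl'.2] at this
          rw [this, Nat.cast_one]
      _ = ∑ j with R'.n i j = d ∧ R'.m i j = k, ∑ l with R.n i l = d ∧ R.m i l = k,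
            opConst (β (Pi.single j 1) l) * opConst (α (Pi.single l 1) j) := by
          rw [Finset.sum_comm]
          simp only [mul_comm]
      _ = _ := by
          rw [Finset.card_eq_sum_ones, Nat.cast_sum]
          refine Finset.sum_congr rfl fun l hl => ?_
          have hl' := (Finset.mem_filter.mp hl).2
          have := h2 l
          rw [hl'.1, hl'.2] at this
          rw [this, Nat.cast_one]
  exact_mod_cast key

theorem count_shifts (i : ℕ) (d k : ℤ) : (R.shifts (Int.ofNat i)).count (d, k) =
    (Finset.univ.filter fun l => R.n i l = d ∧ R.m i l = k).card := by
  change Multiset.count (d, k)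
    (Multiset.map (fun l : Fin (R.rank i) => (R.n i l, R.m i l)) Finset.univ.val) = _
  rw [Multiset.count_map, Finset.card_def, Finset.filter_val]
  congr 1
  exact Multiset.filter_congr fun l _ => by rw [Prod.mk.injEq, eq_comm, @eq_comm _ k]

/-- The shifts of a minimal bifiltered free resolution do not depend on the resolution. -/
theorem shifts_eq (huv : ∀ i, 0 ≤ u i + v i) (i : ℤ) : R.shifts i = R'.shifts i := by
  cases i with
  | ofNat i =>
    refine Multiset.ext.mpr fun ⟨d, k⟩ => ?_
    have h := card_shift_eq R R' huv i d k
    rwa [← count_shifts, ← count_shifts] at h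
  | negSucc i => rfl

theorem card_shifts (i : ℤ) : Multiset.card (R.shifts i) = R.betti i := by
  cases i with
  | ofNat i => simp [shifts, betti]
  | negSucc i => rfl

end MinimalBifilteredFreeResolution

end Unique

end

section

/-! ### Adding one variable -/

/-- The power series with coefficients `α ↦ a_{α + e_i}` for `α ∈ A`, and `0` for `α ∉ A`; for
`A = univ` it is the quotient by `z_i` of the sum of the terms of `a` that are divisible by `z_i`. -/
def shiftOn (i : ι) (A : Set (ι →₀ ℕ)) (a : Conv ι) : Conv ι :=
  ⟨fun α => by classical exact if α ∈ A then a.coeff (α + single i 1) else 0, by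
    classical
    obtain ⟨a, ha⟩ := a
    obtain ⟨r, hr, ha⟩ := (ha : IsConvergent a)
    refine ⟨r, hr, ?_⟩
    have hinj : Function.Injective fun α : ι →₀ ℕ => α + single i 1 :=
      fun _ _ h => add_right_cancel h
    refine Summable.of_nonneg_of_le (fun α => by positivity) (fun α => ?_)
      ((ha.comp_injective hinj).mul_left r⁻¹)
    simp only [Function.comp, map_add, Finsupp.degree_single, pow_succ]
    change ‖if α ∈ A then MvPowerSeries.coeff (α + single i 1) a else 0‖ * r ^ α.degree ≤ _
    have h2 : r⁻¹ * (‖MvPowerSeries.coeff (α + single i 1) a‖ * (r ^ α.degree * r)) =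
        ‖MvPowerSeries.coeff (α + single i 1) a‖ * r ^ α.degree := by
      field_simp
    rw [h2]
    refine mul_le_mul_of_nonneg_right ?_ (by positivity)
    split_ifs
    · exact le_rfl
    · rw [norm_zero]; exact norm_nonneg _⟩

theorem coeff_shiftOn (i : ι) (A : Set (ι →₀ ℕ)) [DecidablePred (· ∈ A)] (a : Conv ι)
    (α : ι →₀ ℕ) :
    (shiftOn i A a).coeff α = if α ∈ A then a.coeff (α + single i 1) else 0 := by
  refine Eq.trans (show _ = @ite ℂ (α ∈ A) (Classical.propDecidable _)
    (a.coeff (α + single i 1)) 0 from rfl) ?_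
  congr

/-- The inclusion `ℂ{z_i : i ∈ ι} → ℂ{z_k : k ∈ κ}` as an algebra homomorphism. -/
def inclHom (e : ι ↪ κ) : Conv ι →ₐ[ℂ] Conv κ :=
  AlgHom.ofLinearMap
    { toFun := incl e
      map_add' := fun a b => Subtype.ext (map_add (MvPowerSeries.rename (R := ℂ) e) a.1 b.1)
      map_smul' := fun r a => Subtype.ext (map_smul (MvPowerSeries.rename (R := ℂ) e) r a.1) }
    (Subtype.ext (map_one (MvPowerSeries.rename (R := ℂ) e)))
    fun a b => Subtype.ext (map_mul (MvPowerSeries.rename (R := ℂ) e) a.1 b.1)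

theorem inclHom_apply (e : ι ↪ κ) (a : Conv ι) : inclHom e a = incl e a := rfl

theorem incl_coord (e : ι ↪ κ) (i : ι) : incl e (coord i) = coord (e i) :=
  Subtype.ext (MvPowerSeries.rename_X (f := e) i)

/-- The restriction of a multi-exponent to a subset of the variables. -/
def restr (e : ι ↪ κ) (x : κ →₀ ℕ) : ι →₀ ℕ := x.comapDomain e e.injective.injOn

@[simp] theorem restr_apply (e : ι ↪ κ) (x : κ →₀ ℕ) (i : ι) : restr e x i = x (e i) := rfl

theorem restr_mapDomain (e : ι ↪ κ) (α : ι →₀ ℕ) : restr e (α.mapDomain e) = α := by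
  ext i
  rw [restr_apply, Finsupp.mapDomain_apply e.injective]

theorem coeff_incl_mapDomain (e : ι ↪ κ) (a : Conv ι) (α : ι →₀ ℕ) :
    (incl e a).coeff (α.mapDomain e) = a.coeff α := by
  rw [← Finsupp.embDomain_eq_mapDomain]
  exact MvPowerSeries.coeff_embDomain_rename e a.1 α

theorem incl_eq_zero {e : ι ↪ κ} {a : Conv ι} (ha : incl e a = 0) : a = 0 := by
  ext α
  rw [← coeff_incl_mapDomain e a α, ha, Conv.coeff_zero, Conv.coeff_zero]

/-- `e` exhibits `κ` as `ι` together with one further element `s`. -/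
structure AddsOne (e : ι ↪ κ) (s : κ) : Prop where
  ne : ∀ i, e i ≠ s
  cover : ∀ k, k = s ∨ ∃ i, e i = k

/-- The weights of the variables `κ` extend those of `ι`, the new variable `s` having weight `-1`
and `∂_s` weight `1`. -/
structure AddsOne.Weights (e : ι ↪ κ) (s : κ) (u v : ι → ℤ) (u' v' : κ → ℤ) : Prop where
  u_eq : ∀ i, u' (e i) = u i
  v_eq : ∀ i, v' (e i) = v i
  u_s : u' s = -1
  v_s : v' s = 1

namespace AddsOne

variable {e : ι ↪ κ} {s : κ}

theorem mapDomain_apply_self (h : AddsOne e s) (α : ι →₀ ℕ) : α.mapDomain e s = 0 :=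
  Finsupp.mapDomain_of_notMem_range _ _ fun ⟨i, hi⟩ => h.ne i hi

theorem exponent_eq (h : AddsOne e s) (x : κ →₀ ℕ) :
    (restr e x).mapDomain e + single s (x s) = x := by
  ext k
  rw [Finsupp.add_apply]
  rcases h.cover k with rfl | ⟨i, rfl⟩
  · rw [h.mapDomain_apply_self, zero_add, Finsupp.single_eq_same]
  · rw [Finsupp.mapDomain_apply e.injective, Finsupp.single_eq_of_ne (h.ne i), add_zero,
      restr_apply]

theorem restr_add_single (h : AddsOne e s) (x : κ →₀ ℕ) (m : ℕ) :
    restr e (x + single s m) = restr e x := by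
  ext i
  rw [restr_apply, restr_apply, Finsupp.add_apply, Finsupp.single_eq_of_ne (h.ne i), add_zero]

theorem coeff_incl (h : AddsOne e s) (a : Conv ι) (x : κ →₀ ℕ) :
    (incl e a).coeff x = if x s = 0 then a.coeff (restr e x) else 0 := by
  split_ifs with hx
  · conv_lhs => rw [← h.exponent_eq x, hx, Finsupp.single_zero, add_zero]
    exact coeff_incl_mapDomain e a _
  · refine MvPowerSeries.coeff_rename_eq_zero _ _ ?_
    rintro ⟨y, rfl⟩
    exact hx (h.mapDomain_apply_self y)

theorem pderiv_incl (h : AddsOne e s) (i : ι) (a : Conv ι) :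
    pderivEnd (e i) (incl e a) = incl e (pderivEnd i a) := by
  ext x
  rw [Conv.coeff_pderiv, h.coeff_incl, h.coeff_incl, Finsupp.add_apply,
    Finsupp.single_eq_of_ne (h.ne i).symm, add_zero]
  split_ifs with hx
  · have : restr e (x + single (e i) 1) = restr e x + single i 1 := by
      ext j
      rw [restr_apply, Finsupp.add_apply, Finsupp.add_apply, restr_apply,
        Finsupp.single_apply_left e.injective]
    rw [this, Conv.coeff_pderiv, restr_apply]
  · rw [zero_mul]

theorem pderiv_self_incl (h : AddsOne e s) (a : Conv ι) : pderivEnd s (incl e a) = 0 := by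
  ext x
  rw [Conv.coeff_pderiv, h.coeff_incl, if_neg (by simp), zero_mul, Conv.coeff_zero]

theorem weight_eq (h : AddsOne e s) {u : ι → ℤ} {u' : κ → ℤ} (hu : ∀ i, u' (e i) = u i)
    (x : κ →₀ ℕ) :
    weight u' x = weight u (restr e x) + x s * u' s := by
  conv_lhs => rw [← h.exponent_eq x]
  rw [map_add, Finsupp.weight_single, nsmul_eq_mul]
  congr 1
  rw [Finsupp.weight_apply, Finsupp.weight_apply]
  refine (Finsupp.sum_mapDomain_index (h := fun i (c : ℕ) => c • u' i) (fun _ => zero_smul _ _)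
    (fun _ _ _ => add_smul _ _ _)).trans ?_
  simp only [hu]

theorem hasWeight_incl (h : AddsOne e s) {u : ι → ℤ} {u' : κ → ℤ} (hu : ∀ i, u' (e i) = u i)
    {g : Conv ι} {a : ℤ}
    (hg : HasWeight u g a) : HasWeight u' (incl e g) a := by
  intro x hx
  rw [h.coeff_incl] at hx
  split_ifs at hx with hxs
  · rw [h.weight_eq hu, hxs]
    have := hg _ hx
    simpa using this
  · exact absurd rfl hx

end AddsOne

/-- Setting the variables outside `ι` to zero. -/
def setZero (e : ι ↪ κ) (a : Conv κ) : Conv ι :=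
  ⟨fun α => a.coeff (α.mapDomain e), by
    obtain ⟨a, ha⟩ := a
    obtain ⟨r, hr, ha⟩ := (ha : IsConvergent a)
    refine ⟨r, hr, (ha.comp_injective (Finsupp.mapDomain_injective e.injective)).congr fun α => ?_⟩
    simp only [Function.comp, Finsupp.degree_mapDomain]
    rfl⟩

theorem coeff_setZero (e : ι ↪ κ) (a : Conv κ) (α : ι →₀ ℕ) :
    (setZero e a).coeff α = a.coeff (α.mapDomain e) := rfl

/-- `g = g|_{s = 0} + s g₁`. -/
theorem AddsOne.eq_incl_add {e : ι ↪ κ} {s : κ} (h : AddsOne e s) (g : Conv κ) :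
    g = incl e (setZero e g) + coord s * shiftOn s Set.univ g := by
  classical
  ext x
  rw [Conv.coeff_add, h.coeff_incl, Conv.coeff_coord_mul, coeff_shiftOn,
    if_pos (Set.mem_univ _)]
  by_cases hx : x s = 0
  · have := h.exponent_eq x
    rw [hx, Finsupp.single_zero, add_zero] at this
    rw [if_pos hx, if_neg (by rw [Finsupp.single_le_iff]; omega), add_zero, coeff_setZero, this]
  · have hle : single s 1 ≤ x := by rw [Finsupp.single_le_iff]; omega
    rw [if_neg hx, if_pos hle, zero_add, tsub_add_cancel_of_le hle]

variable [Fintype κ]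

namespace AddsOne

variable {e : ι ↪ κ} {s : κ}

theorem delPow_exponent (h : AddsOne e s) (x : κ →₀ ℕ) :
    delPow x = del s ^ x s * delPow ((restr e x).mapDomain e) := by
  have hpow : ∀ m : ℕ, delPow (single s m) = del s ^ m := fun m => by
    induction m with
    | zero => simp
    | succ m ih => rw [add_comm, Finsupp.single_add, delPow_single_add, ih, add_comm, pow_succ']
  conv_lhs => rw [← h.exponent_eq x]
  rw [add_comm, delPow_add, hpow]

variable {u v : ι → ℤ} {u' v' : κ → ℤ}

theorem Weights.coord_mem (W : Weights e s u v u' v') : fn (coord s) ∈ biFil u' v' 0 (-1) :=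
  fn_mem_biFil (HasWeight.coord s W.u_s.le)

theorem Weights.del_pow_mem (W : Weights e s u v u' v') (huv : ∀ i, 0 ≤ u' i + v' i) (m : ℕ) :
    del s ^ m ∈ biFil u' v' m m := by
  induction m with
  | zero => exact one_mem_biFil
  | succ m ih =>
    have := biFil_mul huv ih (del_mem_biFil (u := u') (v := v') s)
    rw [W.v_s] at this
    rw [pow_succ]
    exact_mod_cast this

end AddsOne

variable [Fintype ι]

/-- The map `∑ g_β ∂^β ↦ ∑ g_β ∂^β` from operators in the variables `ι` to operators in the
variables `κ ⊇ ι`. -/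
def opInclLin (e : ι ↪ κ) : DiffOp ι →ₗ[ℂ] DiffOp κ :=
  (Finsupp.lsum ℂ fun β : ι →₀ ℕ => (LinearMap.mulRight ℂ (delPow (β.mapDomain e))).comp
    (fnHom.comp (inclHom e)).toLinearMap).comp symb

theorem opInclLin_term (e : ι ↪ κ) (g : Conv ι) (β : ι →₀ ℕ) :
    opInclLin e (fn g * delPow β) = fn (incl e g) * delPow (β.mapDomain e) := by
  rw [opInclLin, LinearMap.comp_apply, symb_term, Finsupp.lsum_single]
  rfl

theorem opInclLin_one (e : ι ↪ κ) : opInclLin e (1 : DiffOp ι) = 1 := by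
  have := opInclLin_term e 1 0
  rwa [fn_one, delPow_zero, one_mul, Finsupp.mapDomain_zero, delPow_zero, mul_one,
    ← inclHom_apply, map_one (inclHom e), fn_one] at this

namespace AddsOne

variable {e : ι ↪ κ} {s : κ}

theorem opInclLin_mul (h : AddsOne e s) (P Q : DiffOp ι) :
    opInclLin e (P * Q) = opInclLin e P * opInclLin e Q := by
  have hone := opInclLin_one e
  have hfn : ∀ (a : Conv ι) Q, opInclLin e (fn a * Q) = fn (incl e a) * opInclLin e Q := by
    intro a Q
    refine DiffOp.sum_induction (p := fun Q => opInclLin e (fn a * Q) =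
      fn (incl e a) * opInclLin e Q) Q (by simp)
      (fun _ _ h1 h2 => by simp only [mul_add, map_add, h1, h2]) fun β => ?_
    rw [← mul_assoc, ← fn_mul, opInclLin_term, opInclLin_term, ← mul_assoc, ← fn_mul,
      ← inclHom_apply, map_mul]
    rfl
  have hdel : ∀ (i : ι) Q, opInclLin e (del i * Q) = del (e i) * opInclLin e Q := by
    intro i Q
    refine DiffOp.sum_induction (p := fun Q => opInclLin e (del i * Q) =
      del (e i) * opInclLin e Q) Q (by simp)
      (fun _ _ h1 h2 => by simp only [mul_add, map_add, h1, h2]) fun β => ?_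
    rw [← mul_assoc, del_mul_fn, add_mul, mul_assoc, ← delPow_single_add, map_add, opInclLin_term,
      opInclLin_term, opInclLin_term, ← mul_assoc, del_mul_fn, add_mul, mul_assoc,
      Finsupp.mapDomain_add, Finsupp.mapDomain_single, delPow_single_add, h.pderiv_incl]
  revert Q
  refine DiffOp.induction (p := fun P => ∀ Q, opInclLin e (P * Q) =
    opInclLin e P * opInclLin e Q) P ?_ ?_ ?_ ?_
  · intro a Q
    have := hfn a 1
    rw [mul_one, hone, mul_one] at this
    rw [hfn, this]
  · intro i Q
    have := hdel i 1
    rw [mul_one, hone, mul_one] at this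
    rw [hdel, this]
  · intro P₁ P₂ h1 h2 Q
    rw [add_mul, map_add, map_add, h1, h2, add_mul]
  · intro P₁ P₂ h1 h2 Q
    rw [mul_assoc, h1, h2, h1, mul_assoc]

/-- The inclusion of the ring of operators in the variables `ι` into that in the variables `κ`. -/
def opIncl (h : AddsOne e s) : DiffOp ι →+* DiffOp κ where
  toFun := opInclLin e
  map_one' := opInclLin_one e
  map_mul' := h.opInclLin_mul
  map_zero' := map_zero _
  map_add' := map_add _

theorem opIncl_term (h : AddsOne e s) (g : Conv ι) (β : ι →₀ ℕ) :
    h.opIncl (fn g * delPow β) = fn (incl e g) * delPow (β.mapDomain e) := opInclLin_term e g β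

theorem opIncl_fn (h : AddsOne e s) (g : Conv ι) : h.opIncl (fn g) = fn (incl e g) := by
  have := h.opIncl_term g 0
  rwa [delPow_zero, mul_one, Finsupp.mapDomain_zero, delPow_zero, mul_one] at this

theorem opIncl_del (h : AddsOne e s) (i : ι) : h.opIncl (del i) = del (e i) := by
  have := h.opIncl_term 1 (single i 1)
  rwa [fn_one, one_mul, delPow_single, Finsupp.mapDomain_single, delPow_single, ← inclHom_apply,
    map_one (inclHom e), fn_one, one_mul] at this

theorem opIncl_commute_coord (h : AddsOne e s) (P : DiffOp ι) :
    Commute (h.opIncl P) (fn (coord s)) := by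
  classical
  refine DiffOp.induction (p := fun P => Commute (h.opIncl P) (fn (coord s))) P ?_ ?_ ?_ ?_
  · intro a
    rw [opIncl_fn]
    exact fn_commute _ _
  · intro i
    rw [opIncl_del, Commute, SemiconjBy, del_mul_coord, if_neg (h.ne i), add_zero]
  · intro P Q hP hQ
    rw [map_add]
    exact hP.add_left hQ
  · intro P Q hP hQ
    rw [map_mul]
    exact hP.mul_left hQ

theorem opIncl_commute_del (h : AddsOne e s) (P : DiffOp ι) : Commute (h.opIncl P) (del s) := by
  refine DiffOp.induction (p := fun P => Commute (h.opIncl P) (del s)) P ?_ ?_ ?_ ?_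
  · intro a
    rw [opIncl_fn, Commute, SemiconjBy, del_mul_fn, h.pderiv_self_incl, fn_zero, add_zero]
  · intro i
    rw [opIncl_del]
    exact del_commute _ _
  · intro P Q hP hQ
    rw [map_add]
    exact hP.add_left hQ
  · intro P Q hP hQ
    rw [map_mul]
    exact hP.mul_left hQ

/-! ### The decomposition `𝒟' = 𝒟' s ⊕ ⨁_m ∂_s^m 𝒟` -/

section Poly

variable {N N' : Type} [AddCommGroup N] [Module (DiffOp ι) N] [AddCommGroup N']
  [Module (DiffOp κ) N']

/-- The map `∑ c_m T^m ↦ ∑ ∂_s^m J(c_m)` attached to a map `J` from a `𝒟`-module to a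
`𝒟'`-module. -/
def poly (h : AddsOne e s) (J : N →ₛₗ[h.opIncl] N') : (ℕ →₀ N) →+ N' :=
  Finsupp.liftAddHom fun m => (DistribSMul.toAddMonoidHom N' (del s ^ m)).comp J.toAddMonoidHom

theorem poly_single (h : AddsOne e s) (J : N →ₛₗ[h.opIncl] N') (m : ℕ) (y : N) :
    h.poly J (single m y) = del s ^ m • J y := by
  rw [poly, Finsupp.liftAddHom_apply_single]
  rfl

/-- Polynomials in `∂_s` are natural in the module. -/
theorem poly_mapRange (h : AddsOne e s) {N₂ N₂' : Type} [AddCommGroup N₂] [Module (DiffOp ι) N₂]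
    [AddCommGroup N₂'] [Module (DiffOp κ) N₂'] (J : N →ₛₗ[h.opIncl] N') (J₂ : N₂ →ₛₗ[h.opIncl] N₂')
    (ψ : N →+ N₂) (ψ' : N' →+ N₂') (hψ : ∀ y, ψ' (J y) = J₂ (ψ y))
    (hdel : ∀ (m : ℕ) y, ψ' (del s ^ m • y) = del s ^ m • ψ' y) (c : ℕ →₀ N) :
    ψ' (h.poly J c) = h.poly J₂ (Finsupp.mapRange.addMonoidHom ψ c) := by
  induction c using Finsupp.induction_linear with
  | zero => simp
  | add c c' hc hc' => rw [map_add, map_add, map_add, map_add, hc, hc']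
  | single m y =>
    rw [poly_single, hdel, hψ, Finsupp.mapRange.addMonoidHom_apply, Finsupp.mapRange_single,
      poly_single]

/-- The inclusion `𝒟 → 𝒟'` as a semilinear map. -/
def inclSL (h : AddsOne e s) : DiffOp ι →ₛₗ[h.opIncl] DiffOp κ where
  toFun := h.opIncl
  map_add' := map_add _
  map_smul' P Q := map_mul _ P Q

theorem inclSL_apply (h : AddsOne e s) (P : DiffOp ι) : h.inclSL P = h.opIncl P := rfl

/-- The term `g ∂^β` with `g` free of `s`. -/
theorem incl_term_eq (h : AddsOne e s) (g : Conv ι) (x : κ →₀ ℕ) :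
    fn (incl e g) * delPow x = del s ^ x s * h.opIncl (fn g * delPow (restr e x)) := by
  have hc : Commute (fn (incl e g)) (del s ^ x s) := by
    rw [← h.opIncl_fn]
    exact (h.opIncl_commute_del _).pow_right _
  rw [h.delPow_exponent x, ← mul_assoc, hc.eq, mul_assoc, opIncl_term]

/-- The coefficients of the normal form of `∑ ∂_s^m c_m` are those of the `c_m`. -/
theorem symb_poly (h : AddsOne e s) (c : ℕ →₀ DiffOp ι) (x : κ →₀ ℕ) :
    symb (h.poly h.inclSL c) x = incl e (symb (c (x s)) (restr e x)) := by
  classical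
  rw [← inclHom_apply]
  induction c using Finsupp.induction_linear with
  | zero => simp
  | add c c' hc hc' => simp only [map_add, Finsupp.add_apply, hc, hc']
  | single m P =>
    rw [poly_single, inclSL_apply, smul_eq_mul]
    refine DiffOp.sum_induction (p := fun P => symb (del s ^ m * h.opIncl P) x =
      inclHom e (symb ((single m P : ℕ →₀ DiffOp ι) (x s)) (restr e x))) P (by simp) ?_ fun β => ?_
    · intro P Q hP hQ
      simp only [mul_add, map_add, Finsupp.add_apply, Finsupp.single_add, hP, hQ]
    · have h1 := h.incl_term_eq (symb P β) (β.mapDomain e + single s m)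
      rw [h.restr_add_single, restr_mapDomain, Finsupp.add_apply, h.mapDomain_apply_self,
        zero_add, Finsupp.single_eq_same] at h1
      rw [← h1, symb_term, Finsupp.single_apply, Finsupp.single_apply]
      by_cases hm : m = x s
      · rw [if_pos hm, symb_term, Finsupp.single_apply]
        by_cases hβ : β = restr e x
        · rw [if_pos hβ, if_pos, inclHom_apply]
          rw [hβ, hm, h.exponent_eq]
        · rw [if_neg hβ, if_neg, map_zero]
          intro h2
          apply hβ
          rw [← h2, h.restr_add_single, restr_mapDomain]
      · rw [if_neg hm, if_neg]
        · simp
        · intro h2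
          apply hm
          rw [← h2, Finsupp.add_apply, h.mapDomain_apply_self, zero_add, Finsupp.single_eq_same]

/-- The sum `𝒟' s + ∑_m ∂_s^m 𝒟` is direct, and right multiplication by `s` is injective. -/
theorem decomp_unique (h : AddsOne e s) {Q : DiffOp κ} {c : ℕ →₀ DiffOp ι}
    (hQ : Q * fn (coord s) + h.poly h.inclSL c = 0) : Q = 0 ∧ c = 0 := by
  have key : ∀ x, coord s * symb Q x + ((x s + 1 : ℕ) : ℂ) • symb Q (x + single s 1) +
      incl e (symb (c (x s)) (restr e x)) = 0 := fun x => by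
    rw [← symb_mul_coord, ← h.symb_poly, ← Finsupp.add_apply, ← map_add, hQ, map_zero,
      Finsupp.zero_apply]
  -- descending induction on the exponent of `∂_s`, which is bounded on the support of `symb Q`
  have hsymb : ∀ t : ℕ, ∀ x : κ →₀ ℕ,
      (symb Q).support.sup (fun x => x s) + 1 ≤ x s + t → symb Q x = 0 := by
    intro t
    induction t with
    | zero =>
      intro x hx
      by_contra h0
      have := Finset.le_sup (f := fun x : κ →₀ ℕ => x s) (Finsupp.mem_support_iff.mpr h0)
      omega
    | succ t ih =>
      intro x hx
      have h1 := key x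
      rw [ih (x + single s 1) (by rw [Finsupp.add_apply, Finsupp.single_eq_same]; omega),
        smul_zero, add_zero] at h1
      ext α
      have h2 := congrArg (Conv.coeff (α + single s 1)) h1
      rw [Conv.coeff_add, Conv.coeff_add_single_coord_mul, h.coeff_incl, if_neg (by simp),
        add_zero] at h2
      exact h2
  have hQ0 : Q = 0 := symb_injective (Finsupp.ext fun x => by
    rw [map_zero]
    exact hsymb _ x (Nat.le_add_left _ _))
  refine ⟨hQ0, Finsupp.ext fun m => symb_injective (Finsupp.ext fun γ => ?_)⟩
  have h1 := key (γ.mapDomain e + single s m)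
  rw [hQ0, map_zero, Finsupp.zero_apply, Finsupp.zero_apply, mul_zero, smul_zero, add_zero,
    zero_add, h.restr_add_single, restr_mapDomain, Finsupp.add_apply, h.mapDomain_apply_self,
    zero_add, Finsupp.single_eq_same] at h1
  rw [incl_eq_zero h1, Finsupp.zero_apply, map_zero, Finsupp.zero_apply]

end Poly

section Weights

variable {u v : ι → ℤ} {u' v' : κ → ℤ}

theorem opIncl_mem (h : AddsOne e s) (W : Weights e s u v u' v') {d k : ℤ} {P : DiffOp ι}
    (hP : P ∈ biFil u v d k) :
    h.opIncl P ∈ biFil u' v' d k := by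
  refine biFil_induction (p := fun P => h.opIncl P ∈ biFil u' v' d k) hP
    (by rw [map_zero]; exact zero_mem _)
    (fun _ _ h1 h2 => by rw [map_add]; exact add_mem h1 h2) fun g β hβ hg => ?_
  rw [opIncl_term]
  refine term_mem_biFil ?_ ((h.hasWeight_incl W.u_eq hg).mono ?_)
  · rw [h.weight_eq (u := fun _ => 1) (fun _ => rfl), restr_mapDomain, h.mapDomain_apply_self]
    simpa using hβ
  · rw [h.weight_eq W.v_eq, restr_mapDomain, h.mapDomain_apply_self]
    simp

/-- `P = Q s + ∑ ∂_s^m c_m` with all terms in the expected steps of the bifiltration. -/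
theorem exists_decomp (h : AddsOne e s) (W : Weights e s u v u' v') {d k : ℤ} {P : DiffOp κ}
    (hP : P ∈ biFil u' v' d k) :
    ∃ Q ∈ biFil u' v' d (k + 1), ∃ c : ℕ →₀ DiffOp ι,
      (∀ m : ℕ, c m ∈ biFil u v (d - m) (k - m)) ∧
      P = Q * fn (coord s) + h.poly h.inclSL c := by
  classical
  have hadd : ∀ P P' : DiffOp κ,
      (∃ Q ∈ biFil u' v' d (k + 1), ∃ c : ℕ →₀ DiffOp ι,
        (∀ m : ℕ, c m ∈ biFil u v (d - m) (k - m)) ∧ P = Q * fn (coord s) + h.poly h.inclSL c) →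
      (∃ Q ∈ biFil u' v' d (k + 1), ∃ c : ℕ →₀ DiffOp ι,
        (∀ m : ℕ, c m ∈ biFil u v (d - m) (k - m)) ∧ P' = Q * fn (coord s) + h.poly h.inclSL c) →
      ∃ Q ∈ biFil u' v' d (k + 1), ∃ c : ℕ →₀ DiffOp ι,
        (∀ m : ℕ, c m ∈ biFil u v (d - m) (k - m)) ∧
        P + P' = Q * fn (coord s) + h.poly h.inclSL c := by
    rintro _ _ ⟨Q, hQ, c, hc, rfl⟩ ⟨Q', hQ', c', hc', rfl⟩
    exact ⟨Q + Q', add_mem hQ hQ', c + c', fun m => add_mem (hc m) (hc' m), by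
      rw [add_mul, map_add]; abel⟩
  refine biFil_induction (p := fun P => ∃ Q ∈ biFil u' v' d (k + 1), ∃ c : ℕ →₀ DiffOp ι,
      (∀ m : ℕ, c m ∈ biFil u v (d - m) (k - m)) ∧ P = Q * fn (coord s) + h.poly h.inclSL c) hP
    ⟨0, zero_mem _, 0, fun m => zero_mem _, by simp⟩ hadd ?_
  -- a single term `g ∂^x`, by induction on the exponent of `∂_s`
  suffices H : ∀ (b : ℕ) (g : Conv κ) (x : κ →₀ ℕ), x s = b → weight (fun _ => (1 : ℤ)) x ≤ d →
      HasWeight u' g (k - weight v' x) →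
      ∃ Q ∈ biFil u' v' d (k + 1), ∃ c : ℕ →₀ DiffOp ι,
        (∀ m : ℕ, c m ∈ biFil u v (d - m) (k - m)) ∧
        fn g * delPow x = Q * fn (coord s) + h.poly h.inclSL c from
    fun g x => H _ g x rfl
  intro b
  induction b with
  | zero | succ b ih =>
    intro g x hb hd hg
    have hx1 := h.weight_eq (u := fun _ => 1) (u' := fun _ => 1) (fun _ => rfl) x
    have hxv := h.weight_eq W.v_eq x
    rw [W.v_s] at hxv
    set g₁ := shiftOn s Set.univ g with hg₁
    have hw₁ : HasWeight u' g₁ (k + 1 - weight v' x) := by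
      intro α hα
      rw [coeff_shiftOn, if_pos (Set.mem_univ _)] at hα
      have := hg _ hα
      rw [map_add, Finsupp.weight_single, one_smul, W.u_s] at this
      omega
    have h0 : fn (incl e (setZero e g)) * delPow x =
        h.poly h.inclSL (single (x s) (fn (setZero e g) * delPow (restr e x))) := by
      rw [poly_single, h.incl_term_eq]
      rfl
    have hw₀ : fn (setZero e g) * delPow (restr e x) ∈ biFil u v (d - x s) (k - x s) := by
      refine term_mem_biFil (by omega) fun α hα => ?_
      have := hg _ hα
      rw [h.weight_eq W.u_eq, restr_mapDomain, h.mapDomain_apply_self] at this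
      push_cast at this
      omega
    have hsplit : fn g * delPow x = fn (incl e (setZero e g)) * delPow x +
        (fn g₁ * delPow x * fn (coord s) - (x s : ℂ) • (fn g₁ * delPow (x - single s 1))) := by
      conv_lhs => rw [h.eq_incl_add g, fn_add, add_mul, mul_comm (coord s), fn_mul, mul_assoc]
      rw [mul_assoc, delPow_mul_coord, mul_add, mul_smul_comm, add_sub_cancel_right]
    have hrest : ∃ Q ∈ biFil u' v' d (k + 1), ∃ c : ℕ →₀ DiffOp ι,
        (∀ m : ℕ, c m ∈ biFil u v (d - m) (k - m)) ∧
        -((x s : ℂ) • (fn g₁ * delPow (x - single s 1))) =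
          Q * fn (coord s) + h.poly h.inclSL c := by
      -- for `x s = 0` the term vanishes, otherwise the exponent of `∂_s` has dropped
      first
      | (refine ⟨0, zero_mem _, 0, fun m => zero_mem _, ?_⟩
         rw [hb]; simp; done)
      | (have hle : single s 1 ≤ x := by rw [Finsupp.single_le_iff]; omega
         have hxe : weight (fun _ => (1 : ℤ)) (x - single s 1) + 1 = weight (fun _ => (1 : ℤ)) x := by
           conv_rhs => rw [← tsub_add_cancel_of_le hle]
           rw [map_add, Finsupp.weight_single, one_smul]
         have hxe' : weight v' (x - single s 1) + 1 = weight v' x := by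
           conv_rhs => rw [← tsub_add_cancel_of_le hle]
           rw [map_add, Finsupp.weight_single, one_smul, W.v_s]
         have := ih (-((x s : ℂ) • g₁)) (x - single s 1) (by
           rw [Finsupp.tsub_apply, Finsupp.single_eq_same, hb]; rfl) (by omega) (by
           rw [← neg_smul]
           exact (hw₁.mono (by omega)).smul _)
         rwa [fn_neg, fn_smul, neg_mul, smul_mul_assoc] at this)
    have h1 : ∃ Q ∈ biFil u' v' d (k + 1), ∃ c : ℕ →₀ DiffOp ι,
        (∀ m : ℕ, c m ∈ biFil u v (d - m) (k - m)) ∧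
        fn (incl e (setZero e g)) * delPow x + fn g₁ * delPow x * fn (coord s) =
          Q * fn (coord s) + h.poly h.inclSL c := by
      refine ⟨fn g₁ * delPow x, term_mem_biFil hd hw₁, _, fun m => ?_, by rw [h0, add_comm]⟩
      rw [Finsupp.single_apply]
      split_ifs with hm
      · rw [← hm]; exact hw₀
      · exact zero_mem _
    have h2 := hadd _ _ h1 hrest
    rwa [add_assoc, ← sub_eq_add_neg, ← hsplit] at h2

end Weights

end AddsOne

end

section

/-! ### Exactness from strict exactness -/

section Exhaustive

variable [Fintype ι] {u v : ι → ℤ}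

/-- The bifiltration of `𝒟` is exhaustive when the weights of the variables are nonpositive. -/
theorem exists_mem_biFil (hu : ∀ i, u i ≤ 0) (P : DiffOp ι) : ∃ d : ℤ, ∀ e, d ≤ e →
    P ∈ biFil u v e e := by
  refine DiffOp.sum_induction (p := fun P => ∃ d : ℤ, ∀ e, d ≤ e → P ∈ biFil u v e e) P
    ⟨0, fun _ _ => zero_mem _⟩ ?_ fun β => ?_
  · rintro P Q ⟨d, hP⟩ ⟨e, hQ⟩
    exact ⟨max d e, fun a ha => add_mem (hP a (le_of_max_le_left ha)) (hQ a (le_of_max_le_right ha))⟩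
  · exact ⟨max (weight (fun _ => (1 : ℤ)) β) (weight v β), fun e he =>
      term_mem_biFil (le_of_max_le_left he) (hasWeight_of_nonpos hu _
        (sub_nonneg.mpr (le_of_max_le_right he)))⟩

theorem exists_mem_freeFil (hu : ∀ i, u i ≤ 0) {r : ℕ} (n m : Fin r → ℤ) (y : Fin r → DiffOp ι) :
    ∃ d, y ∈ freeFil u v n m d d := by
  choose a ha using fun l => exists_mem_biFil (v := v) hu (y l)
  obtain ⟨d, hd⟩ := (Set.finite_range fun l => a l + max (n l) (m l)).bddAbove
  refine ⟨d, mem_freeFil.mpr fun l => ?_⟩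
  have h1 : a l + max (n l) (m l) ≤ d := hd ⟨l, rfl⟩
  have h2 := le_max_left (n l) (m l)
  have h3 := le_max_right (n l) (m l)
  exact biFil_mono (by omega) (by omega) (ha l (a l) le_rfl)

/-- Exactness on all `F_{d,k}` implies exactness, the bifiltrations being exhaustive. -/
theorem exact_of_strict (hu : ∀ i, u i ≤ 0) {r s : ℕ} {n m : Fin r → ℤ} {n' m' : Fin s → ℤ}
    {N : Type} [AddCommGroup N] [Module (DiffOp ι) N]
    {α : (Fin s → DiffOp ι) →ₗ[DiffOp ι] (Fin r → DiffOp ι)}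
    {β : (Fin r → DiffOp ι) →ₗ[DiffOp ι] N}
    (h : ∀ d k, α '' (freeFil u v n' m' d k : Set _) = {y | y ∈ freeFil u v n m d k ∧ β y = 0}) :
    Function.Exact α β := by
  intro y
  constructor
  · intro hy
    obtain ⟨d, hd⟩ := exists_mem_freeFil (v := v) hu n m y
    have : y ∈ α '' (freeFil u v n' m' d d : Set _) := by rw [h]; exact ⟨hd, hy⟩
    obtain ⟨z, -, hz⟩ := this
    exact ⟨z, hz⟩
  · rintro ⟨z, rfl⟩
    obtain ⟨d, hd⟩ := exists_mem_freeFil (v := v) hu n' m' z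
    have : α z ∈ α '' (freeFil u v n' m' d d : Set _) := ⟨z, hd, rfl⟩
    rw [h] at this
    exact this.2

end Exhaustive

/-! ### Base change of free modules and right multiplication by `s` -/

namespace AddsOne

variable {e : ι ↪ κ} {s : κ}

/-- Right multiplication by `s` on `𝒟'^r`. -/
def mulS (s : κ) (r : ℕ) : (Fin r → DiffOp κ) →ₗ[DiffOp κ] (Fin r → DiffOp κ) where
  toFun y l := y l * fn (coord s)
  map_add' y z := funext fun l => add_mul (y l) (z l) _
  map_smul' P y := funext fun l => mul_assoc P (y l) _

theorem mulS_apply {r : ℕ} (y : Fin r → DiffOp κ) (l : Fin r) :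
    mulS s r y l = y l * fn (coord s) := rfl

variable [Fintype κ] {u v : ι → ℤ} {u' v' : κ → ℤ}

theorem mulS_mem (huv : ∀ i, 0 ≤ u' i + v' i) (W : Weights e s u v u' v') {r : ℕ}
    {n m : Fin r → ℤ} {d k : ℤ}
    {q : Fin r → DiffOp κ} (hq : q ∈ freeFil u' v' n m d (k + 1)) :
    mulS s r q ∈ freeFil u' v' n m d k := by
  rw [mem_freeFil] at hq ⊢
  intro l
  have := biFil_mul huv (hq l) W.coord_mem
  rwa [add_zero, show k + 1 - m l + -1 = k - m l by omega] at this

theorem mulS_mem_maxIdealMul (W : Weights e s u v u' v') {r : ℕ} {n m : Fin r → ℤ} {d k : ℤ}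
    {q : Fin r → DiffOp κ} (hq : q ∈ freeFil u' v' n m d (k + 1)) :
    mulS s r q ∈ maxIdealMul u' v' (freeFil u' v' n m) d k := by
  rw [mem_freeFil] at hq
  rw [map_free_eq_sum]
  refine sum_mem fun l _ => ?_
  have h1 : mulS s r (Pi.single l 1) = fn (coord s) • Pi.single l 1 := by
    ext1 j
    rw [mulS_apply, Pi.smul_apply, smul_eq_mul]
    by_cases hj : j = l
    · subst hj; rw [Pi.single_eq_same, one_mul, mul_one]
    · rw [Pi.single_eq_of_ne hj, zero_mul, mul_zero]
  rw [h1]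
  have := smul_smul_mem_maxIdealMul (u := u') (v := v') (F := freeFil u' v' n m) (hq l)
    (Or.inl ⟨rfl, s, W.u_s, rfl⟩) (basis_mem_freeFil n m l)
  rwa [add_zero, sub_add_cancel, show k + 1 - m l + -1 + m l = k by omega] at this

variable [Fintype ι]

/-- The inclusion `𝒟^r → 𝒟'^r`. -/
def freeIncl (h : AddsOne e s) (r : ℕ) : (Fin r → DiffOp ι) →ₛₗ[h.opIncl] (Fin r → DiffOp κ) where
  toFun y l := h.opIncl (y l)
  map_add' y z := funext fun l => map_add h.opIncl (y l) (z l)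
  map_smul' P y := funext fun l => map_mul h.opIncl P (y l)

theorem freeIncl_apply (h : AddsOne e s) {r : ℕ} (y : Fin r → DiffOp ι) (l : Fin r) :
    h.freeIncl r y l = h.opIncl (y l) := rfl

section BaseChange

variable {N N' : Type} [AddCommGroup N] [Module (DiffOp ι) N] [AddCommGroup N']
  [Module (DiffOp κ) N']

/-- The `𝒟'`-linear extension of a `𝒟`-linear map defined on `𝒟^r`. -/
def baseChange (h : AddsOne e s) (J : N →ₛₗ[h.opIncl] N') {r : ℕ}
    (ψ : (Fin r → DiffOp ι) →ₗ[DiffOp ι] N) : (Fin r → DiffOp κ) →ₗ[DiffOp κ] N' :=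
  Fintype.linearCombination (DiffOp κ) fun l => J (ψ (Pi.single l 1))

theorem baseChange_single (h : AddsOne e s) (J : N →ₛₗ[h.opIncl] N') {r : ℕ}
    (ψ : (Fin r → DiffOp ι) →ₗ[DiffOp ι] N) (l : Fin r) :
    h.baseChange J ψ (Pi.single l 1) = J (ψ (Pi.single l 1)) := by
  rw [baseChange, Fintype.linearCombination_apply_single, one_smul]

theorem baseChange_freeIncl (h : AddsOne e s) (J : N →ₛₗ[h.opIncl] N') {r : ℕ}
    (ψ : (Fin r → DiffOp ι) →ₗ[DiffOp ι] N) (y : Fin r → DiffOp ι) :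
    h.baseChange J ψ (h.freeIncl r y) = J (ψ y) := by
  rw [map_free_eq_sum ψ, map_sum, baseChange, Fintype.linearCombination_apply]
  exact Finset.sum_congr rfl fun l _ => by rw [LinearMap.map_smulₛₗ, freeIncl_apply]

theorem baseChange_poly (h : AddsOne e s) (J : N →ₛₗ[h.opIncl] N') {r : ℕ}
    (ψ : (Fin r → DiffOp ι) →ₗ[DiffOp ι] N) (c : ℕ →₀ (Fin r → DiffOp ι)) :
    h.baseChange J ψ (h.poly (h.freeIncl r) c) =
      h.poly J (Finsupp.mapRange.addMonoidHom ψ.toAddMonoidHom c) :=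
  h.poly_mapRange (h.freeIncl r) J ψ.toAddMonoidHom (h.baseChange J ψ).toAddMonoidHom
    (fun y => h.baseChange_freeIncl J ψ y) (fun _ _ => map_smul (h.baseChange J ψ) _ _) c

/-- The base change of a matrix over `𝒟` commutes with right multiplication by `s`. -/
theorem baseChange_mulS (h : AddsOne e s) {r t : ℕ}
    (ψ : (Fin r → DiffOp ι) →ₗ[DiffOp ι] (Fin t → DiffOp ι)) (y : Fin r → DiffOp κ) :
    h.baseChange (h.freeIncl t) ψ (mulS s r y) = mulS s t (h.baseChange (h.freeIncl t) ψ y) := by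
  ext1 j
  rw [mulS_apply, baseChange, Fintype.linearCombination_apply, Fintype.linearCombination_apply,
    Finset.sum_apply, Finset.sum_apply, Finset.sum_mul]
  refine Finset.sum_congr rfl fun l _ => ?_
  rw [Pi.smul_apply, Pi.smul_apply, smul_eq_mul, smul_eq_mul, mulS_apply, mul_assoc, mul_assoc,
    freeIncl_apply, (h.opIncl_commute_coord _).eq]

theorem baseChange_baseChange (h : AddsOne e s) (J : N →ₛₗ[h.opIncl] N') {r t : ℕ}
    (ψ : (Fin r → DiffOp ι) →ₗ[DiffOp ι] (Fin t → DiffOp ι))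
    (ρ : (Fin t → DiffOp ι) →ₗ[DiffOp ι] N) (hρ : ∀ y, ρ (ψ y) = 0) (y : Fin r → DiffOp κ) :
    h.baseChange J ρ (h.baseChange (h.freeIncl t) ψ y) = 0 := by
  rw [map_free_eq_sum (h.baseChange (h.freeIncl t) ψ), map_sum]
  refine Finset.sum_eq_zero fun l _ => ?_
  rw [map_smul, baseChange_single, baseChange_freeIncl, hρ, map_zero, smul_zero]

end BaseChange

/-! ### The decomposition of free modules -/

theorem poly_apply (h : AddsOne e s) {r : ℕ} (c : ℕ →₀ (Fin r → DiffOp ι)) (l : Fin r) :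
    h.poly (h.freeIncl r) c l =
      h.poly h.inclSL (Finsupp.mapRange.addMonoidHom (Pi.evalAddMonoidHom _ l) c) :=
  h.poly_mapRange (h.freeIncl r) h.inclSL (Pi.evalAddMonoidHom _ l) (Pi.evalAddMonoidHom _ l)
    (fun _ => rfl) (fun _ _ => rfl) c

theorem free_decomp_unique (h : AddsOne e s) {r : ℕ} {q : Fin r → DiffOp κ}
    {c : ℕ →₀ (Fin r → DiffOp ι)} (hq : mulS s r q + h.poly (h.freeIncl r) c = 0) :
    q = 0 ∧ c = 0 := by
  have key := fun l => h.decomp_unique (Q := q l) (c := Finsupp.mapRange.addMonoidHom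
    (Pi.evalAddMonoidHom (fun _ : Fin r => DiffOp ι) l) c) (by
      rw [← h.poly_apply, ← mulS_apply, ← Pi.add_apply, hq, Pi.zero_apply])
  refine ⟨funext fun l => (key l).1, Finsupp.ext fun m => funext fun l => ?_⟩
  exact DFunLike.congr_fun (key l).2 m

section Weights

theorem freeIncl_mem (h : AddsOne e s) (W : Weights e s u v u' v') {r : ℕ}
    {n m : Fin r → ℤ} {d k : ℤ} {y : Fin r → DiffOp ι} (hy : y ∈ freeFil u v n m d k) :
    h.freeIncl r y ∈ freeFil u' v' n m d k := by
  rw [mem_freeFil] at hy ⊢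
  exact fun l => h.opIncl_mem W (hy l)

theorem poly_mem (h : AddsOne e s) (huv : ∀ i, 0 ≤ u' i + v' i) (W : Weights e s u v u' v')
    {N N' : Type} [AddCommGroup N] [Module (DiffOp ι) N] [AddCommGroup N'] [Module (DiffOp κ) N']
    {F : ℤ → ℤ → AddSubgroup N} {F' : ℤ → ℤ → AddSubgroup N'} {J : N →ₛₗ[h.opIncl] N'}
    (hJ : ∀ d k, ∀ y ∈ F d k, J y ∈ F' d k)
    (hF : ∀ d k e l (P : DiffOp κ) (y : N'), P ∈ biFil u' v' d k → y ∈ F' e l →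
      P • y ∈ F' (d + e) (k + l)) {d k : ℤ} {c : ℕ →₀ N}
    (hc : ∀ a : ℕ, c a ∈ F (d - a) (k - a)) : h.poly J c ∈ F' d k := by
  rw [← Finsupp.sum_single c, Finsupp.sum, map_sum]
  refine sum_mem fun a _ => ?_
  rw [poly_single]
  have := hF _ _ _ _ _ _ (W.del_pow_mem huv a) (hJ _ _ _ (hc a))
  rwa [add_sub_cancel, add_sub_cancel] at this

/-- `y = q s + ∑ ∂_s^a c_a` with all terms in the expected steps of the bifiltration. -/
theorem exists_free_decomp (h : AddsOne e s) (W : Weights e s u v u' v') {r : ℕ}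
    {n m : Fin r → ℤ} {d k : ℤ} {y : Fin r → DiffOp κ} (hy : y ∈ freeFil u' v' n m d k) :
    ∃ q ∈ freeFil u' v' n m d (k + 1), ∃ c : ℕ →₀ (Fin r → DiffOp ι),
      (∀ a : ℕ, c a ∈ freeFil u v n m (d - a) (k - a)) ∧
      y = mulS s r q + h.poly (h.freeIncl r) c := by
  rw [mem_freeFil] at hy
  choose q hq c hc hy using fun l => h.exists_decomp W (hy l)
  obtain ⟨C, hC⟩ : ∃ C : ℕ →₀ (Fin r → DiffOp ι), ∀ l,
      Finsupp.mapRange.addMonoidHom (Pi.evalAddMonoidHom (fun _ => DiffOp ι) l) C = c l := by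
    refine ⟨∑ l, Finsupp.mapRange.addMonoidHom (AddMonoidHom.single (fun _ => DiffOp ι) l) (c l),
      fun l => ?_⟩
    ext1 a
    simp [Finsupp.finsetSum_apply, Pi.single_apply]
  refine ⟨q, mem_freeFil.mpr fun l => ?_, C, fun a => mem_freeFil.mpr fun l => ?_,
    funext fun l => ?_⟩
  · have := hq l
    rwa [sub_add_eq_add_sub] at this
  · have := hc l a
    rw [← hC l, sub_right_comm, sub_right_comm k] at this
    exact this
  · rw [Pi.add_apply, mulS_apply, poly_apply, hC]
    exact hy l

theorem baseChange_mem (h : AddsOne e s)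
    {N N' : Type} [AddCommGroup N] [Module (DiffOp ι) N] [AddCommGroup N'] [Module (DiffOp κ) N']
    {F : ℤ → ℤ → AddSubgroup N} {F' : ℤ → ℤ → AddSubgroup N'} {J : N →ₛₗ[h.opIncl] N'}
    (hJ : ∀ d k, ∀ y ∈ F d k, J y ∈ F' d k)
    (hF : ∀ d k e l (P : DiffOp κ) (y : N'), P ∈ biFil u' v' d k → y ∈ F' e l →
      P • y ∈ F' (d + e) (k + l)) {r : ℕ} {n m : Fin r → ℤ}
    {ψ : (Fin r → DiffOp ι) →ₗ[DiffOp ι] N} (hψ : IsFil (freeFil u v n m) F ψ) :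
    IsFil (freeFil u' v' n m) F' (h.baseChange J ψ) :=
  isFil_of_basis n m hF _ fun l => by
    rw [baseChange_single]
    exact hJ _ _ _ (hψ _ _ _ (basis_mem_freeFil n m l))

/-- Lifting the coefficients of a polynomial in `∂_s` one by one. -/
theorem exists_poly_lift (h : AddsOne e s) (huv : ∀ i, 0 ≤ u' i + v' i) (W : Weights e s u v u' v')
    {t : ℕ} {n m : Fin t → ℤ} {N N' : Type} [AddCommGroup N] [Module (DiffOp ι) N]
    [AddCommGroup N'] [Module (DiffOp κ) N'] (J : N →ₛₗ[h.opIncl] N')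
    (ψ : (Fin t → DiffOp ι) →ₗ[DiffOp ι] N) {d k : ℤ} {c : ℕ →₀ N}
    (hc : ∀ a : ℕ, ∃ z ∈ freeFil u v n m (d - a) (k - a), ψ z = c a) :
    ∃ z ∈ freeFil u' v' n m d k, h.baseChange J ψ z = h.poly J c := by
  choose z hz hψ using hc
  let b : ℕ →₀ (Fin t → DiffOp ι) := ∑ a ∈ c.support, single a (z a)
  have hb : ∀ a, b a = if a ∈ c.support then z a else 0 := fun a => by
    classical
    simp only [b, Finsupp.finsetSum_apply, Finsupp.single_apply]
    rw [Finset.sum_ite_eq' c.support a z]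
  refine ⟨h.poly (h.freeIncl t) b, h.poly_mem huv W (F := freeFil u v n m)
    (fun _ _ _ hy => h.freeIncl_mem W hy) (fun _ _ _ _ _ _ hP hy => smul_mem_freeFil huv hP hy)
    fun a => ?_, ?_⟩
  · rw [hb]
    split_ifs
    · exact hz a
    · exact zero_mem _
  · rw [baseChange_poly]
    congr 1
    ext1 a
    change ψ (b a) = c a
    rw [hb]
    split_ifs with ha
    · exact hψ a
    · rw [map_zero, Finsupp.notMem_support_iff.mp ha]

/-- The inclusion `𝒟^r → 𝒟'^r` sends `𝔪 𝒟^r` to `𝔪 𝒟'^r`. -/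
theorem freeIncl_mem_maxIdealMul (h : AddsOne e s) (W : Weights e s u v u' v') {r : ℕ}
    {n m : Fin r → ℤ} {d k : ℤ} {y : Fin r → DiffOp ι}
    (hy : y ∈ maxIdealMul u v (freeFil u v n m) d k) :
    h.freeIncl r y ∈ maxIdealMul u' v' (freeFil u' v' n m) d k := by
  have := map_mem_maxIdealMul (u := u) (v := v) (u' := u') (v' := v') (F := freeFil u v n m)
    (G := freeFil u' v' n m) (h.freeIncl r).toAddMonoidHom 0
    (fun d k y hy => by rw [add_zero]; exact h.freeIncl_mem W hy) ?_ hy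
  · rwa [add_zero] at this
  · intro d₁ d₂ d₃ k₁ k₂ k₃ P Q y hP hQ hy
    rw [add_zero]
    change h.freeIncl r (P • Q • y) ∈ maxIdealMul u' v' (freeFil u' v' n m) _ _
    rw [LinearMap.map_smulₛₗ, LinearMap.map_smulₛₗ]
    refine smul_smul_mem_maxIdealMul (h.opIncl_mem W hP) ?_ (h.freeIncl_mem W hy)
    rcases hQ with ⟨hd, i, hi, rfl⟩ | ⟨hd, hQ⟩
    · exact Or.inl ⟨hd, e i, by rw [W.u_eq, hi], by rw [opIncl_fn, incl_coord]⟩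
    · exact Or.inr ⟨hd, h.opIncl_mem W hQ⟩

theorem baseChange_mem_maxIdealMul (h : AddsOne e s) (huv : ∀ i, 0 ≤ u' i + v' i)
    (W : Weights e s u v u' v') {r t : ℕ} {n m : Fin r → ℤ} {n₁ m₁ : Fin t → ℤ}
    {ψ : (Fin t → DiffOp ι) →ₗ[DiffOp ι] (Fin r → DiffOp ι)}
    (hψ : ∀ d k, ∀ y ∈ freeFil u v n₁ m₁ d k, ψ y ∈ maxIdealMul u v (freeFil u v n m) d k)
    {d k : ℤ} {y : Fin t → DiffOp κ} (hy : y ∈ freeFil u' v' n₁ m₁ d k) :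
    h.baseChange (h.freeIncl r) ψ y ∈ maxIdealMul u' v' (freeFil u' v' n m) d k := by
  rw [mem_freeFil] at hy
  rw [map_free_eq_sum]
  refine sum_mem fun l _ => ?_
  rw [baseChange_single]
  have := smul_mem_maxIdealMul (u := u') (v := v') (F := freeFil u' v' n m) huv
    (fun _ _ _ _ _ _ hP hy => smul_mem_freeFil huv hP hy) (hy l)
    (h.freeIncl_mem_maxIdealMul W (hψ _ _ _ (basis_mem_freeFil n₁ m₁ l)))
  rwa [sub_add_cancel, sub_add_cancel] at this

end Weights

end AddsOne

end

section

/-! ### The quotient `𝒟' / (𝒟' I + 𝒟' s)` -/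

section Quotient

variable [Fintype ι]

/-- The bifiltration of `𝒟 / I` induced by that of `𝒟`. -/
def quotFil (u v : ι → ℤ) (I : Submodule (DiffOp ι) (DiffOp ι)) (d k : ℤ) :
    AddSubgroup (DiffOp ι ⧸ I) :=
  (biFil u v d k).map I.mkQ.toAddMonoidHom

theorem mem_quotFil {u v : ι → ℤ} {I : Submodule (DiffOp ι) (DiffOp ι)} {d k : ℤ}
    {x : DiffOp ι ⧸ I} : x ∈ quotFil u v I d k ↔ ∃ P ∈ biFil u v d k, I.mkQ P = x := Iff.rfl

theorem smul_mem_quotFil {u v : ι → ℤ} (huv : ∀ i, 0 ≤ u i + v i)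
    {I : Submodule (DiffOp ι) (DiffOp ι)} {d k e l : ℤ} {P : DiffOp ι} {y : DiffOp ι ⧸ I}
    (hP : P ∈ biFil u v d k) (hy : y ∈ quotFil u v I e l) :
    P • y ∈ quotFil u v I (d + e) (k + l) := by
  obtain ⟨Q, hQ, rfl⟩ := mem_quotFil.mp hy
  exact mem_quotFil.mpr ⟨P * Q, biFil_mul huv hP hQ, map_smul I.mkQ P Q⟩

end Quotient

variable [Fintype ι] [Fintype κ]

namespace AddsOne

variable {e : ι ↪ κ} {s : κ} {u v : ι → ℤ} {u' v' : κ → ℤ}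

/-- The left ideal `𝒟' I + 𝒟' s` of `𝒟'`. -/
def extIdeal (h : AddsOne e s) (I : Submodule (DiffOp ι) (DiffOp ι)) :
    Submodule (DiffOp κ) (DiffOp κ) :=
  Submodule.span (DiffOp κ) (h.opIncl '' I ∪ {fn (coord s)})

theorem opIncl_mem_extIdeal (h : AddsOne e s) {I : Submodule (DiffOp ι) (DiffOp ι)} {P : DiffOp ι}
    (hP : P ∈ I) : h.opIncl P ∈ h.extIdeal I :=
  Submodule.subset_span (Or.inl ⟨P, hP, rfl⟩)

theorem mul_coord_mem_extIdeal (h : AddsOne e s) (I : Submodule (DiffOp ι) (DiffOp ι))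
    (P : DiffOp κ) : P * fn (coord s) ∈ h.extIdeal I :=
  Submodule.smul_mem _ P (Submodule.subset_span (Or.inr rfl))

/-- The map `𝒟 / I → 𝒟' / (𝒟' I + 𝒟' s)`. -/
def quotIncl (h : AddsOne e s) (I : Submodule (DiffOp ι) (DiffOp ι)) :
    (DiffOp ι ⧸ I) →ₛₗ[h.opIncl] (DiffOp κ ⧸ h.extIdeal I) :=
  Submodule.mapQ I (h.extIdeal I) h.inclSL fun _ hP => h.opIncl_mem_extIdeal hP

theorem quotIncl_mk (h : AddsOne e s) (I : Submodule (DiffOp ι) (DiffOp ι)) (P : DiffOp ι) :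
    h.quotIncl I (I.mkQ P) = (h.extIdeal I).mkQ (h.opIncl P) := rfl

theorem mkQ_poly (h : AddsOne e s) (I : Submodule (DiffOp ι) (DiffOp ι)) (c : ℕ →₀ DiffOp ι) :
    (h.extIdeal I).mkQ (h.poly h.inclSL c) =
      h.poly (h.quotIncl I) (Finsupp.mapRange.addMonoidHom I.mkQ.toAddMonoidHom c) :=
  h.poly_mapRange h.inclSL (h.quotIncl I) I.mkQ.toAddMonoidHom (h.extIdeal I).mkQ.toAddMonoidHom
    (fun _ => rfl) (fun _ _ => rfl) c

/-- The elements of `𝒟' I + 𝒟' s` are those whose `∂_s`-coefficients lie in `I`. -/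
theorem exists_of_mem_extIdeal (h : AddsOne e s) (hu : ∀ i, u' i ≤ 0)
    (W : Weights e s u v u' v') {I : Submodule (DiffOp ι) (DiffOp ι)} {P : DiffOp κ}
    (hP : P ∈ h.extIdeal I) :
    ∃ (Q : DiffOp κ) (c : ℕ →₀ DiffOp ι), (∀ m, c m ∈ I) ∧
      P = Q * fn (coord s) + h.poly h.inclSL c := by
  classical
  have hadd : ∀ P P' : DiffOp κ,
      (∃ (Q : DiffOp κ) (c : ℕ →₀ DiffOp ι), (∀ m, c m ∈ I) ∧
        P = Q * fn (coord s) + h.poly h.inclSL c) →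
      (∃ (Q : DiffOp κ) (c : ℕ →₀ DiffOp ι), (∀ m, c m ∈ I) ∧
        P' = Q * fn (coord s) + h.poly h.inclSL c) →
      ∃ (Q : DiffOp κ) (c : ℕ →₀ DiffOp ι), (∀ m, c m ∈ I) ∧
        P + P' = Q * fn (coord s) + h.poly h.inclSL c := by
    rintro _ _ ⟨Q, c, hc, rfl⟩ ⟨Q', c', hc', rfl⟩
    exact ⟨Q + Q', c + c', fun m => add_mem (hc m) (hc' m), by rw [add_mul, map_add]; abel⟩
  have hmul : ∀ (R : DiffOp κ) (a : DiffOp ι), a ∈ I →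
      ∃ (Q : DiffOp κ) (c : ℕ →₀ DiffOp ι), (∀ m, c m ∈ I) ∧
        R * h.opIncl a = Q * fn (coord s) + h.poly h.inclSL c := by
    intro R a ha
    obtain ⟨d, hd⟩ := exists_mem_biFil (v := v') hu R
    obtain ⟨Q, -, c, -, hR⟩ := h.exists_decomp W (hd d le_rfl)
    refine ⟨Q * h.opIncl a, Finsupp.mapRange.addMonoidHom (AddMonoidHom.mulRight a) c,
      fun m => I.smul_mem (c m) ha, ?_⟩
    have h1 := h.poly_mapRange h.inclSL h.inclSL (AddMonoidHom.mulRight a)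
      (AddMonoidHom.mulRight (h.opIncl a)) (fun y => (map_mul h.opIncl y a).symm)
      (fun _ _ => mul_assoc _ _ _) c
    rw [← h1, hR, add_mul, mul_assoc, ← (h.opIncl_commute_coord a).eq, ← mul_assoc]
    rfl
  induction hP using Submodule.span_induction with
  | mem P hP =>
    rcases hP with ⟨a, ha, rfl⟩ | rfl
    · have := hmul 1 a ha
      rwa [one_mul] at this
    · exact ⟨1, 0, fun _ => zero_mem _, by rw [one_mul, map_zero, add_zero]⟩
  | zero => exact ⟨0, 0, fun _ => zero_mem _, by rw [zero_mul, map_zero, add_zero]⟩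
  | add P P' _ _ hP hP' => exact hadd _ _ hP hP'
  | smul R P _ hP =>
    obtain ⟨Q, c, hc, rfl⟩ := hP
    rw [smul_eq_mul, mul_add, ← mul_assoc]
    refine hadd _ _ ⟨R * Q, 0, fun _ => zero_mem _, by rw [map_zero, add_zero]⟩ ?_
    rw [← Finsupp.sum_single c, Finsupp.sum, map_sum, Finset.mul_sum]
    refine Finset.sum_induction _ (fun P => ∃ (Q : DiffOp κ) (c : ℕ →₀ DiffOp ι), (∀ m, c m ∈ I) ∧
        P = Q * fn (coord s) + h.poly h.inclSL c) hadd
      ⟨0, 0, fun _ => zero_mem _, by rw [zero_mul, map_zero, add_zero]⟩ fun m _ => ?_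
    rw [poly_single, smul_eq_mul, ← mul_assoc]
    exact hmul _ _ (hc m)

/-- The submodules `∂_s^m (𝒟 / I)` of `𝒟' / (𝒟' I + 𝒟' s)` form a direct sum of copies of `𝒟 / I`. -/
theorem poly_quotIncl_eq_zero (h : AddsOne e s) (hu : ∀ i, u' i ≤ 0)
    (W : Weights e s u v u' v') {I : Submodule (DiffOp ι) (DiffOp ι)} {c : ℕ →₀ (DiffOp ι ⧸ I)}
    (hc : h.poly (h.quotIncl I) c = 0) : c = 0 := by
  obtain ⟨b, rfl⟩ : ∃ b, Finsupp.mapRange.addMonoidHom I.mkQ.toAddMonoidHom b = c :=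
    Finsupp.mapRange_surjective _ (map_zero _) I.mkQ_surjective c
  rw [← mkQ_poly, Submodule.mkQ_apply, Submodule.Quotient.mk_eq_zero] at hc
  obtain ⟨Q, a, ha, hQ⟩ := h.exists_of_mem_extIdeal hu W hc
  have := (h.decomp_unique (Q := Q) (c := a - b) (by
    rw [map_sub, ← add_sub_assoc, ← hQ, sub_self])).2
  rw [sub_eq_zero] at this
  subst this
  ext1 m
  change I.mkQ (a m) = 0
  rw [Submodule.mkQ_apply, Submodule.Quotient.mk_eq_zero]
  exact ha m

theorem coord_smul_quotIncl (h : AddsOne e s) (I : Submodule (DiffOp ι) (DiffOp ι))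
    (x : DiffOp ι ⧸ I) : fn (coord s) • h.quotIncl I x = 0 := by
  obtain ⟨P, rfl⟩ := I.mkQ_surjective x
  rw [quotIncl_mk, ← map_smul, smul_eq_mul, ← (h.opIncl_commute_coord P).eq, Submodule.mkQ_apply,
    Submodule.Quotient.mk_eq_zero]
  exact h.mul_coord_mem_extIdeal I _

theorem baseChange_quotIncl_mulS (h : AddsOne e s) (I : Submodule (DiffOp ι) (DiffOp ι)) {r : ℕ}
    (ρ : (Fin r → DiffOp ι) →ₗ[DiffOp ι] (DiffOp ι ⧸ I)) (y : Fin r → DiffOp κ) :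
    h.baseChange (h.quotIncl I) ρ (mulS s r y) = 0 := by
  rw [baseChange, Fintype.linearCombination_apply]
  refine Finset.sum_eq_zero fun l _ => ?_
  rw [mulS_apply, mul_smul, coord_smul_quotIncl, smul_zero]

theorem quotIncl_mem (h : AddsOne e s) (W : Weights e s u v u' v')
    {I : Submodule (DiffOp ι) (DiffOp ι)} {d k : ℤ} {x : DiffOp ι ⧸ I}
    (hx : x ∈ quotFil u v I d k) : h.quotIncl I x ∈ quotFil u' v' (h.extIdeal I) d k := by
  obtain ⟨P, hP, rfl⟩ := mem_quotFil.mp hx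
  exact mem_quotFil.mpr ⟨_, h.opIncl_mem W hP, rfl⟩

end AddsOne

/-! ### The mapping cone of right multiplication by `s` -/

section Append

/-- The first components of a vector. -/
def fstL (κ : Type) (a b : ℕ) : (Fin (a + b) → DiffOp κ) →ₗ[DiffOp κ] (Fin a → DiffOp κ) :=
  LinearMap.funLeft _ _ (Fin.castAdd b)

/-- The last components of a vector. -/
def sndL (κ : Type) (a b : ℕ) : (Fin (a + b) → DiffOp κ) →ₗ[DiffOp κ] (Fin b → DiffOp κ) :=
  LinearMap.funLeft _ _ (Fin.natAdd a)

/-- A pair of linear maps as a linear map to the vectors with first and last components. -/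
def pairL {κ : Type} {N : Type} [AddCommGroup N] [Module (DiffOp κ) N] {a b : ℕ}
    (α : N →ₗ[DiffOp κ] (Fin a → DiffOp κ)) (β : N →ₗ[DiffOp κ] (Fin b → DiffOp κ)) :
    N →ₗ[DiffOp κ] (Fin (a + b) → DiffOp κ) :=
  LinearMap.pi (Fin.addCases (fun l => LinearMap.proj l ∘ₗ α) fun l => LinearMap.proj l ∘ₗ β)

variable {κ : Type} {a b : ℕ}

theorem ext_fst_snd {x y : Fin (a + b) → DiffOp κ} (h1 : fstL κ a b x = fstL κ a b y)
    (h2 : sndL κ a b x = sndL κ a b y) : x = y :=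
  funext fun l => Fin.addCases (motive := fun l => x l = y l) (fun i => congrFun h1 i)
    (fun i => congrFun h2 i) l

variable {N : Type} [AddCommGroup N] [Module (DiffOp κ) N]

@[simp] theorem fst_pair (α : N →ₗ[DiffOp κ] (Fin a → DiffOp κ))
    (β : N →ₗ[DiffOp κ] (Fin b → DiffOp κ)) (y : N) : fstL κ a b (pairL α β y) = α y := by
  ext1 l
  simp [fstL, pairL, LinearMap.funLeft_apply]

@[simp] theorem snd_pair (α : N →ₗ[DiffOp κ] (Fin a → DiffOp κ))
    (β : N →ₗ[DiffOp κ] (Fin b → DiffOp κ)) (y : N) : sndL κ a b (pairL α β y) = β y := by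
  ext1 l
  simp [sndL, pairL, LinearMap.funLeft_apply]

/-- The map `(a, b) ↦ ψ(a) + b s`. -/
def coneEnd (s : κ) (ψ : (Fin a → DiffOp κ) →ₗ[DiffOp κ] (Fin b → DiffOp κ)) :
    (Fin (a + b) → DiffOp κ) →ₗ[DiffOp κ] (Fin b → DiffOp κ) :=
  ψ ∘ₗ fstL κ a b + AddsOne.mulS s b ∘ₗ sndL κ a b

/-- The differential `(a, b) ↦ (ψ(a) + b s, -ρ(b))` of the mapping cone. -/
def coneMap (s : κ) {c : ℕ} (ψ : (Fin a → DiffOp κ) →ₗ[DiffOp κ] (Fin b → DiffOp κ))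
    (ρ : (Fin b → DiffOp κ) →ₗ[DiffOp κ] (Fin c → DiffOp κ)) :
    (Fin (a + b) → DiffOp κ) →ₗ[DiffOp κ] (Fin (b + c) → DiffOp κ) :=
  pairL (coneEnd s ψ) (-(ρ ∘ₗ sndL κ a b))

theorem coneEnd_apply {s : κ} (ψ : (Fin a → DiffOp κ) →ₗ[DiffOp κ] (Fin b → DiffOp κ))
    (y : Fin (a + b) → DiffOp κ) :
    coneEnd s ψ y = ψ (fstL κ a b y) + AddsOne.mulS s b (sndL κ a b y) := rfl

theorem fst_coneMap {s : κ} {c : ℕ} (ψ : (Fin a → DiffOp κ) →ₗ[DiffOp κ] (Fin b → DiffOp κ))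
    (ρ : (Fin b → DiffOp κ) →ₗ[DiffOp κ] (Fin c → DiffOp κ)) (y : Fin (a + b) → DiffOp κ) :
    fstL κ b c (coneMap s ψ ρ y) = coneEnd s ψ y := fst_pair _ _ _

theorem snd_coneMap {s : κ} {c : ℕ} (ψ : (Fin a → DiffOp κ) →ₗ[DiffOp κ] (Fin b → DiffOp κ))
    (ρ : (Fin b → DiffOp κ) →ₗ[DiffOp κ] (Fin c → DiffOp κ)) (y : Fin (a + b) → DiffOp κ) :
    sndL κ b c (coneMap s ψ ρ y) = -ρ (sndL κ a b y) := snd_pair _ _ _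

variable [Fintype κ] {u v : κ → ℤ}

theorem mem_freeFil_append {n₁ m₁ : Fin a → ℤ} {n₂ m₂ : Fin b → ℤ} {d k : ℤ}
    {y : Fin (a + b) → DiffOp κ} :
    y ∈ freeFil u v (Fin.append n₁ n₂) (Fin.append m₁ fun l => m₂ l - 1) d k ↔
      fstL κ a b y ∈ freeFil u v n₁ m₁ d k ∧ sndL κ a b y ∈ freeFil u v n₂ m₂ d (k + 1) := by
  rw [mem_freeFil, mem_freeFil, mem_freeFil]
  constructor
  · refine fun h => ⟨fun l => ?_, fun l => ?_⟩
    · have := h (Fin.castAdd b l)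
      rwa [Fin.append_left, Fin.append_left] at this
    · have := h (Fin.natAdd a l)
      rw [Fin.append_right, Fin.append_right, ← sub_add, sub_add_eq_add_sub] at this
      exact this
  · rintro ⟨h1, h2⟩ l
    refine Fin.addCases (fun l => ?_) (fun l => ?_) l
    · rw [Fin.append_left, Fin.append_left]
      exact h1 l
    · rw [Fin.append_right, Fin.append_right, ← sub_add, sub_add_eq_add_sub]
      exact h2 l

theorem map_univ_fin_add {X : Type} (F : Fin (a + b) → X) :
    (Finset.univ : Finset (Fin (a + b))).val.map F =
      (Finset.univ : Finset (Fin a)).val.map (fun l => F (Fin.castAdd b l)) +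
      (Finset.univ : Finset (Fin b)).val.map fun l => F (Fin.natAdd a l) := by
  rw [Fin.univ_val_map, Fin.univ_val_map, Fin.univ_val_map, List.ofFn_add]
  rfl

end Append

namespace AddsOne

variable {e : ι ↪ κ} {s : κ} {u v : ι → ℤ} {u' v' : κ → ℤ}

/-- Two successive maps of the cone compose to zero. -/
theorem coneEnd_coneMap (h : AddsOne e s) {a b c : ℕ}
    (ψ : (Fin a → DiffOp ι) →ₗ[DiffOp ι] (Fin b → DiffOp ι))
    (ρ : (Fin b → DiffOp ι) →ₗ[DiffOp ι] (Fin c → DiffOp ι)) (hρ : ∀ y, ρ (ψ y) = 0)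
    (y : Fin (a + b) → DiffOp κ) :
    coneEnd s (h.baseChange (h.freeIncl c) ρ)
      (coneMap s (h.baseChange (h.freeIncl b) ψ) (h.baseChange (h.freeIncl c) ρ) y) = 0 := by
  rw [coneEnd_apply, fst_coneMap, snd_coneMap, coneEnd_apply, map_add,
    h.baseChange_baseChange (h.freeIncl c) ψ ρ hρ, zero_add, baseChange_mulS, map_neg,
    add_neg_cancel]

/-- Strict exactness of the cone: modulo `s` only polynomials in `∂_s` over the given exact
sequence remain. -/
theorem exists_coneMap_eq (h : AddsOne e s) (huv : ∀ i, 0 ≤ u' i + v' i)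
    (W : Weights e s u v u' v') {a b c : ℕ} {n₂ m₂ : Fin a → ℤ} {n₁ m₁ : Fin b → ℤ}
    (ψ : (Fin a → DiffOp ι) →ₗ[DiffOp ι] (Fin b → DiffOp ι))
    (ρ : (Fin b → DiffOp ι) →ₗ[DiffOp ι] (Fin c → DiffOp ι))
    (hex : ∀ d k, ∀ y ∈ freeFil u v n₁ m₁ d k, ρ y = 0 → ∃ z ∈ freeFil u v n₂ m₂ d k, ψ z = y)
    {d k : ℤ} {y : Fin (b + c) → DiffOp κ} (hy : fstL κ b c y ∈ freeFil u' v' n₁ m₁ d k)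
    (h0 : coneEnd s (h.baseChange (h.freeIncl c) ρ) y = 0) :
    ∃ x, (fstL κ a b x ∈ freeFil u' v' n₂ m₂ d k ∧ sndL κ a b x ∈ freeFil u' v' n₁ m₁ d (k + 1)) ∧
      coneMap s (h.baseChange (h.freeIncl b) ψ) (h.baseChange (h.freeIncl c) ρ) x = y := by
  obtain ⟨q, hq, p, hp, hyq⟩ := h.exists_free_decomp W hy
  rw [coneEnd_apply, hyq, map_add, baseChange_mulS, baseChange_poly, add_right_comm,
    ← map_add] at h0
  obtain ⟨h1, h2⟩ := h.free_decomp_unique h0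
  obtain ⟨z, hz, hzp⟩ := h.exists_poly_lift huv W (h.freeIncl b) ψ (n := n₂) (m := m₂)
    (fun t => hex _ _ _ (hp t) (DFunLike.congr_fun h2 t))
  refine ⟨Fin.append z q, ⟨?_, ?_⟩, ext_fst_snd ?_ ?_⟩
  · convert hz
    ext1 l
    simp [fstL, LinearMap.funLeft_apply]
  · convert hq
    ext1 l
    simp [sndL, LinearMap.funLeft_apply]
  · rw [fst_coneMap, coneEnd_apply, hyq, ← hzp, add_comm]
    congr 2
    · ext1 l
      simp [sndL, LinearMap.funLeft_apply]
    · ext1 l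
      simp [fstL, LinearMap.funLeft_apply]
  · rw [snd_coneMap, ← neg_eq_of_add_eq_zero_right h1]
    congr 2
    ext1 l
    simp [sndL, LinearMap.funLeft_apply]

/-! ### The resolution of `𝒟' / (𝒟' I + 𝒟' s)` -/

section Resolution

variable {I : Submodule (DiffOp ι) (DiffOp ι)}
  (R : MinimalBifilteredFreeResolution u v (quotFil u v I))

/-- The ranks of the mapping cone. -/
abbrev coneRank : ℕ → ℕ
  | 0 => R.rank 0
  | i + 1 => R.rank (i + 1) + R.rank i

/-- The shifts of the mapping cone for the order filtration. -/
def coneN : ∀ i, Fin (coneRank R i) → ℤ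
  | 0 => R.n 0
  | i + 1 => Fin.append (R.n (i + 1)) (R.n i)

/-- The shifts of the mapping cone for the `V`-filtration. -/
def coneM : ∀ i, Fin (coneRank R i) → ℤ
  | 0 => R.m 0
  | i + 1 => Fin.append (R.m (i + 1)) fun l => R.m i l - 1

/-- The differentials of the resolution `R`, extended to `𝒟'`. -/
def extφ (h : AddsOne e s) (i : ℕ) :
    (Fin (R.rank (i + 1)) → DiffOp κ) →ₗ[DiffOp κ] (Fin (R.rank i) → DiffOp κ) :=
  h.baseChange (h.freeIncl (R.rank i)) (R.φ i)

/-- The differentials of the mapping cone. -/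
def coneφ (h : AddsOne e s) : ∀ i, (Fin (coneRank R (i + 1)) → DiffOp κ) →ₗ[DiffOp κ]
    (Fin (coneRank R i) → DiffOp κ)
  | 0 => coneEnd s (extφ R h 0)
  | i + 1 => coneMap s (extφ R h (i + 1)) (extφ R h i)

/-- The augmentation of the mapping cone. -/
def coneε (h : AddsOne e s) :
    (Fin (coneRank R 0) → DiffOp κ) →ₗ[DiffOp κ] (DiffOp κ ⧸ h.extIdeal I) :=
  h.baseChange (h.quotIncl I) R.ε

theorem mem_freeFil_cone {i : ℕ} {d k : ℤ} {y : Fin (coneRank R (i + 1)) → DiffOp κ} :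
    y ∈ freeFil u' v' (coneN R (i + 1)) (coneM R (i + 1)) d k ↔
      fstL κ _ _ y ∈ freeFil u' v' (R.n (i + 1)) (R.m (i + 1)) d k ∧
      sndL κ _ _ y ∈ freeFil u' v' (R.n i) (R.m i) d (k + 1) :=
  mem_freeFil_append

theorem isFil_extφ (h : AddsOne e s) (huv : ∀ i, 0 ≤ u' i + v' i) (W : Weights e s u v u' v')
    (i : ℕ) : IsFil (freeFil u' v' (R.n (i + 1)) (R.m (i + 1))) (freeFil u' v' (R.n i) (R.m i))
      (extφ R h i) :=
  h.baseChange_mem (F := freeFil u v (R.n i) (R.m i)) (fun _ _ _ hy => h.freeIncl_mem W hy)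
    (fun _ _ _ _ _ _ hP hy => smul_mem_freeFil huv hP hy) (R.isFil_φ i)

theorem coneEnd_mem (h : AddsOne e s) (huv : ∀ i, 0 ≤ u' i + v' i) (W : Weights e s u v u' v')
    {i : ℕ} {d k : ℤ} {y : Fin (R.rank (i + 1) + R.rank i) → DiffOp κ}
    (hy : fstL κ _ _ y ∈ freeFil u' v' (R.n (i + 1)) (R.m (i + 1)) d k ∧
      sndL κ _ _ y ∈ freeFil u' v' (R.n i) (R.m i) d (k + 1)) :
    coneEnd s (extφ R h i) y ∈ freeFil u' v' (R.n i) (R.m i) d k :=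
  add_mem (isFil_extφ R h huv W i _ _ _ hy.1) (mulS_mem huv W hy.2)

theorem coneφ_mem (h : AddsOne e s) (huv : ∀ i, 0 ≤ u' i + v' i) (W : Weights e s u v u' v')
    (i : ℕ) : IsFil (freeFil u' v' (coneN R (i + 1)) (coneM R (i + 1)))
      (freeFil u' v' (coneN R i) (coneM R i)) (coneφ R h i) := by
  intro d k y hy
  rw [mem_freeFil_cone] at hy
  cases i with
  | zero => exact coneEnd_mem R h huv W hy
  | succ i =>
    rw [mem_freeFil_cone]
    refine ⟨?_, ?_⟩
    · change fstL κ _ _ (coneMap s (extφ R h (i + 1)) (extφ R h i) y) ∈ _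
      rw [fst_coneMap]
      exact coneEnd_mem R h huv W hy
    · change sndL κ _ _ (coneMap s (extφ R h (i + 1)) (extφ R h i) y) ∈ _
      rw [snd_coneMap]
      exact neg_mem (isFil_extφ R h huv W i _ _ _ hy.2)

theorem coneEnd_coneφ (h : AddsOne e s) (i : ℕ) (y : Fin (coneRank R (i + 2)) → DiffOp κ) :
    coneEnd s (extφ R h i) (coneφ R h (i + 1) y) = 0 :=
  h.coneEnd_coneMap (R.φ (i + 1)) (R.φ i) (R.φ_φ i) y

theorem coneφ_coneφ (h : AddsOne e s) (i : ℕ) (y : Fin (coneRank R (i + 2)) → DiffOp κ) :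
    coneφ R h i (coneφ R h (i + 1) y) = 0 := by
  cases i with
  | zero => exact coneEnd_coneφ R h 0 y
  | succ i =>
    refine ext_fst_snd ?_ ?_
    · rw [map_zero]
      refine (fst_coneMap _ _ _).trans ?_
      exact coneEnd_coneφ R h (i + 1) y
    · rw [map_zero]
      refine (snd_coneMap _ _ _).trans ?_
      rw [show sndL κ _ _ (coneφ R h (i + 1 + 1) y) = -extφ R h (i + 1) (sndL κ _ _ y) from
        snd_coneMap _ _ _, map_neg, neg_neg]
      exact h.baseChange_baseChange (h.freeIncl _) (R.φ (i + 1)) (R.φ i) (R.φ_φ i) _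

theorem coneEnd_of_coneφ (h : AddsOne e s) {i : ℕ} {y : Fin (coneRank R (i + 1)) → DiffOp κ}
    (hy : coneφ R h i y = 0) : coneEnd s (extφ R h i) y = 0 := by
  cases i with
  | zero => exact hy
  | succ i =>
    have := congrArg (fstL κ _ _) hy
    rw [map_zero] at this
    exact (fst_coneMap _ _ _).symm.trans this

theorem coneφ_strict (h : AddsOne e s) (huv : ∀ i, 0 ≤ u' i + v' i) (W : Weights e s u v u' v')
    (i : ℕ) (d k : ℤ) :
    coneφ R h (i + 1) '' (freeFil u' v' (coneN R (i + 2)) (coneM R (i + 2)) d k : Set _) =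
      {y | y ∈ freeFil u' v' (coneN R (i + 1)) (coneM R (i + 1)) d k ∧ coneφ R h i y = 0} := by
  ext y
  constructor
  · rintro ⟨x, hx, rfl⟩
    exact ⟨coneφ_mem R h huv W (i + 1) _ _ _ hx, coneφ_coneφ R h i x⟩
  · rintro ⟨hy, h0⟩
    obtain ⟨x, hx, hxy⟩ := h.exists_coneMap_eq huv W (R.φ (i + 1)) (R.φ i)
      (fun _ _ _ hy h0 => R.exists_lift_succ hy h0) ((mem_freeFil_cone R).mp hy).1
      (coneEnd_of_coneφ R h h0)
    exact ⟨x, (mem_freeFil_cone R).mpr hx, hxy⟩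

theorem coneε_coneφ (h : AddsOne e s) (y : Fin (coneRank R 1) → DiffOp κ) :
    coneε R h (coneφ R h 0 y) = 0 := by
  change coneε R h (extφ R h 0 (fstL κ _ _ y) + mulS s _ (sndL κ _ _ y)) = 0
  rw [map_add]
  refine (congrArg₂ (· + ·) (h.baseChange_baseChange (h.quotIncl I) (R.φ 0) R.ε R.ε_φ _)
    (h.baseChange_quotIncl_mulS I R.ε _)).trans (add_zero _)

theorem coneφ_zero_strict (h : AddsOne e s) (huv : ∀ i, 0 ≤ u' i + v' i) (hu : ∀ i, u' i ≤ 0)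
    (W : Weights e s u v u' v') (d k : ℤ) :
    coneφ R h 0 '' (freeFil u' v' (coneN R 1) (coneM R 1) d k : Set _) =
      {y | y ∈ freeFil u' v' (coneN R 0) (coneM R 0) d k ∧ coneε R h y = 0} := by
  ext y
  constructor
  · rintro ⟨x, hx, rfl⟩
    exact ⟨coneφ_mem R h huv W 0 _ _ _ hx, coneε_coneφ R h x⟩
  · rintro ⟨hy, h0⟩
    obtain ⟨q, hq, c, hc, rfl⟩ := h.exists_free_decomp W hy
    rw [map_add, show coneε R h (mulS s _ q) = 0 from h.baseChange_quotIncl_mulS I R.ε q, zero_add,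
      show coneε R h (h.poly (h.freeIncl _) c) = _ from h.baseChange_poly (h.quotIncl I) R.ε c] at h0
    have h1 := h.poly_quotIncl_eq_zero hu W h0
    obtain ⟨z, hz, hzc⟩ := h.exists_poly_lift huv W (h.freeIncl _) (R.φ 0) (n := R.n 1)
      (m := R.m 1) (fun t => R.exists_lift_zero (hc t) (DFunLike.congr_fun h1 t))
    have hf : fstL κ _ _ (Fin.append z q) = z := by
      ext1 l
      simp [fstL, LinearMap.funLeft_apply]
    have hs : sndL κ _ _ (Fin.append z q) = q := by
      ext1 l
      simp [sndL, LinearMap.funLeft_apply]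
    refine ⟨Fin.append z q, (mem_freeFil_cone R).mpr ⟨?_, ?_⟩, ?_⟩
    · exact hf.symm ▸ hz
    · exact hs.symm ▸ hq
    · change extφ R h 0 (fstL κ _ _ (Fin.append z q)) + mulS s _ (sndL κ _ _ (Fin.append z q)) = _
      rw [hf, hs, add_comm, ← hzc]
      rfl

theorem coneε_strict (h : AddsOne e s) (huv : ∀ i, 0 ≤ u' i + v' i)
    (W : Weights e s u v u' v') (d k : ℤ) :
    coneε R h '' (freeFil u' v' (coneN R 0) (coneM R 0) d k : Set _) =
      quotFil u' v' (h.extIdeal I) d k := by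
  ext x
  constructor
  · rintro ⟨y, hy, rfl⟩
    exact h.baseChange_mem (F := quotFil u v I) (fun _ _ _ hy => h.quotIncl_mem W hy)
      (fun _ _ _ _ _ _ hP hy => smul_mem_quotFil huv hP hy) (fun _ _ _ hy => R.ε_mem hy) _ _ _ hy
  · intro hx
    obtain ⟨P, hP, rfl⟩ := mem_quotFil.mp hx
    obtain ⟨Q, -, c, hc, rfl⟩ := h.exists_decomp W hP
    have h0 : (h.extIdeal I).mkQ (Q * fn (coord s)) = 0 := by
      rw [Submodule.mkQ_apply, Submodule.Quotient.mk_eq_zero]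
      exact h.mul_coord_mem_extIdeal I Q
    obtain ⟨z, hz, hzc⟩ := h.exists_poly_lift huv W (h.quotIncl I) R.ε (n := R.n 0) (m := R.m 0)
      (c := Finsupp.mapRange.addMonoidHom I.mkQ.toAddMonoidHom c) (d := d) (k := k)
      (fun t => R.exists_lift_ε (mem_quotFil.mpr ⟨c t, hc t, rfl⟩))
    refine ⟨z, hz, ?_⟩
    rw [map_add, h0, zero_add, mkQ_poly, ← hzc]
    rfl

theorem coneEnd_mem_maxIdealMul (h : AddsOne e s) (huv : ∀ i, 0 ≤ u' i + v' i)
    (W : Weights e s u v u' v') {i : ℕ} {d k : ℤ}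
    {y : Fin (R.rank (i + 1) + R.rank i) → DiffOp κ}
    (hy : fstL κ _ _ y ∈ freeFil u' v' (R.n (i + 1)) (R.m (i + 1)) d k ∧
      sndL κ _ _ y ∈ freeFil u' v' (R.n i) (R.m i) d (k + 1)) :
    coneEnd s (extφ R h i) y ∈ maxIdealMul u' v' (freeFil u' v' (R.n i) (R.m i)) d k :=
  add_mem (h.baseChange_mem_maxIdealMul huv W (R.minimal i) hy.1) (mulS_mem_maxIdealMul W hy.2)

theorem coneφ_minimal (h : AddsOne e s) (huv : ∀ i, 0 ≤ u' i + v' i)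
    (W : Weights e s u v u' v') (i : ℕ) (d k : ℤ) (y : Fin (coneRank R (i + 1)) → DiffOp κ)
    (hy : y ∈ freeFil u' v' (coneN R (i + 1)) (coneM R (i + 1)) d k) :
    coneφ R h i y ∈ maxIdealMul u' v' (freeFil u' v' (coneN R i) (coneM R i)) d k := by
  rw [mem_freeFil_cone] at hy
  cases i with
  | zero => exact coneEnd_mem_maxIdealMul R h huv W hy
  | succ i =>
    -- the two components, embedded in the direct sum
    have h1 := linearMap_mem_maxIdealMul (G := freeFil u' v' (coneN R (i + 1)) (coneM R (i + 1)))
      (F := freeFil u' v' (R.n (i + 1)) (R.m (i + 1)))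
      (pairL (LinearMap.id : _ →ₗ[DiffOp κ] (Fin (R.rank (i + 1)) → DiffOp κ))
        (0 : (Fin (R.rank (i + 1)) → DiffOp κ) →ₗ[DiffOp κ] (Fin (R.rank i) → DiffOp κ))) 0
      (fun d k y hy => by
        rw [mem_freeFil_cone, fst_pair, snd_pair, add_zero]
        exact ⟨hy, zero_mem _⟩)
      (coneEnd_mem_maxIdealMul R h huv W hy)
    have h2 := linearMap_mem_maxIdealMul (G := freeFil u' v' (coneN R (i + 1)) (coneM R (i + 1)))
      (F := freeFil u' v' (R.n i) (R.m i))
      (pairL (0 : (Fin (R.rank i) → DiffOp κ) →ₗ[DiffOp κ] (Fin (R.rank (i + 1)) → DiffOp κ))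
        (LinearMap.id : _ →ₗ[DiffOp κ] (Fin (R.rank i) → DiffOp κ))) (-1)
      (fun d k y hy => by
        rw [mem_freeFil_cone, fst_pair, snd_pair, neg_add_cancel_right]
        exact ⟨zero_mem _, hy⟩)
      (neg_mem (h.baseChange_mem_maxIdealMul huv W (R.minimal i) hy.2))
    rw [add_zero] at h1
    rw [add_neg_cancel_right] at h2
    have h3 := add_mem h1 h2
    refine (congrArg (· ∈ maxIdealMul u' v' (freeFil u' v' (coneN R (i + 1))
      (coneM R (i + 1))) d k) (ext_fst_snd ?_ ?_)).mpr h3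
    · rw [map_add, fst_pair, fst_pair]
      exact (fst_coneMap _ _ _).trans (add_zero _).symm
    · rw [map_add, snd_pair, snd_pair]
      exact (snd_coneMap _ _ _).trans (zero_add _).symm

/-- The mapping cone of right multiplication by `s` on the extension to `𝒟'` of a minimal
bifiltered free resolution of `𝒟 / I` is one of `𝒟' / (𝒟' I + 𝒟' s)`. -/
def cone (h : AddsOne e s) (huv : ∀ i, 0 ≤ u' i + v' i) (hu : ∀ i, u' i ≤ 0)
    (W : Weights e s u v u' v') :
    MinimalBifilteredFreeResolution u' v' (quotFil u' v' (h.extIdeal I)) where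
  rank := coneRank R
  n := coneN R
  m := coneM R
  φ := coneφ R h
  ε := coneε R h
  ε_surjective := fun x => by
    obtain ⟨P, rfl⟩ := (h.extIdeal I).mkQ_surjective x
    obtain ⟨d, hd⟩ := exists_mem_biFil (v := v') hu P
    have hx : (h.extIdeal I).mkQ P ∈ (quotFil u' v' (h.extIdeal I) d d : Set _) :=
      mem_quotFil.mpr ⟨P, hd d le_rfl, rfl⟩
    rw [← coneε_strict R h huv W] at hx
    obtain ⟨y, -, hy⟩ := hx
    exact ⟨y, hy⟩
  exact_zero := exact_of_strict hu (coneφ_zero_strict R h huv hu W)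
  exact_succ := fun i => exact_of_strict hu (coneφ_strict R h huv W i)
  fil_ε := coneε_strict R h huv W
  fil_exact_zero := coneφ_zero_strict R h huv hu W
  fil_exact_succ := coneφ_strict R h huv W
  minimal := coneφ_minimal R h huv W

theorem shifts_cone (h : AddsOne e s) (huv : ∀ i, 0 ≤ u' i + v' i) (hu : ∀ i, u' i ≤ 0)
    (W : Weights e s u v u' v') (i : ℤ) : (cone R h huv hu W).shifts i =
      R.shifts i + (R.shifts (i - 1)).map fun x => (x.1, x.2 - 1) := by
  cases i with
  | ofNat i =>
    cases i with
    | zero => exact (add_zero _).symm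
    | succ i =>
      have h1 : (Int.ofNat (i + 1) - 1) = Int.ofNat i := by
        simp only [Int.ofNat_eq_natCast]
        push_cast
        ring
      rw [h1]
      change (Finset.univ : Finset (Fin (R.rank (i + 1) + R.rank i))).val.map
        (fun l => (Fin.append (R.n (i + 1)) (R.n i) l,
          Fin.append (R.m (i + 1)) (fun l => R.m i l - 1) l)) = _
      rw [map_univ_fin_add]
      simp only [Fin.append_left, Fin.append_right]
      congr 1
      exact (Multiset.map_map (fun x : ℤ × ℤ => (x.1, x.2 - 1))
        (fun l : Fin (R.rank i) => (R.n i l, R.m i l)) Finset.univ.val).symm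
  | negSucc i => rfl

end Resolution

end AddsOne

end

section

/-! ### Substitution in convergent power series -/

/-- The weighted `ℓ¹`-norm `∑ |a_α| r^|α|`. -/
def polyNorm (r : ℝ≥0) (a : MvPowerSeries ι ℂ) : ℝ≥0∞ :=
  ∑' α : ι →₀ ℕ, ((‖MvPowerSeries.coeff α a‖₊ * r ^ α.degree : ℝ≥0) : ℝ≥0∞)

theorem isConvergent_iff {a : MvPowerSeries ι ℂ} :
    IsConvergent a ↔ ∃ r : ℝ≥0, 0 < r ∧ polyNorm r a ≠ ⊤ := by
  constructor
  · rintro ⟨r, hr, h⟩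
    refine ⟨⟨r, hr.le⟩, hr, ENNReal.tsum_coe_ne_top_iff_summable.mpr ?_⟩
    rw [← NNReal.summable_coe]
    exact h
  · rintro ⟨r, hr, h⟩
    refine ⟨r, hr, ?_⟩
    have := ENNReal.tsum_coe_ne_top_iff_summable.mp h
    rw [← NNReal.summable_coe] at this
    exact this

theorem polyNorm_one (r : ℝ≥0) : polyNorm r (1 : MvPowerSeries ι ℂ) ≤ 1 := by
  classical
  rw [polyNorm, tsum_eq_single 0]
  · simp
  · intro α hα
    rw [MvPowerSeries.coeff_one, if_neg hα]
    simp

theorem polyNorm_mul (r : ℝ≥0) (a b : MvPowerSeries ι ℂ) :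
    polyNorm r (a * b) ≤ polyNorm r a * polyNorm r b := by
  classical
  have h1 : polyNorm r a * polyNorm r b =
      ∑' γ : ι →₀ ℕ, ∑ x ∈ Finset.HasAntidiagonal.antidiagonal γ,
        ((‖MvPowerSeries.coeff x.1 a‖₊ * r ^ x.1.degree : ℝ≥0) : ℝ≥0∞) *
          ((‖MvPowerSeries.coeff x.2 b‖₊ * r ^ x.2.degree : ℝ≥0) : ℝ≥0∞) := by
    rw [polyNorm, polyNorm, ← ENNReal.tsum_mul_right]
    simp only [← ENNReal.tsum_mul_left]
    rw [← ENNReal.tsum_prod, ← (Finset.HasAntidiagonal.sigmaAntidiagonalEquivProd (A := ι →₀ ℕ)).tsum_eq,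
      ENNReal.tsum_sigma']
    refine tsum_congr fun γ => ?_
    rw [tsum_fintype]
    exact Finset.sum_coe_sort (Finset.HasAntidiagonal.antidiagonal γ)
      (fun x => ((‖MvPowerSeries.coeff x.1 a‖₊ * r ^ x.1.degree : ℝ≥0) : ℝ≥0∞) *
          ((‖MvPowerSeries.coeff x.2 b‖₊ * r ^ x.2.degree : ℝ≥0) : ℝ≥0∞))
  rw [h1]
  refine ENNReal.tsum_le_tsum fun γ => ?_
  rw [MvPowerSeries.coeff_mul]
  norm_cast
  calc ‖∑ x ∈ Finset.HasAntidiagonal.antidiagonal γ, MvPowerSeries.coeff x.1 a *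
        MvPowerSeries.coeff x.2 b‖₊ * r ^ γ.degree
      ≤ (∑ x ∈ Finset.HasAntidiagonal.antidiagonal γ, ‖MvPowerSeries.coeff x.1 a *
        MvPowerSeries.coeff x.2 b‖₊) * r ^ γ.degree := by gcongr; exact nnnorm_sum_le _ _
    _ = _ := by
      rw [Finset.sum_mul]
      refine Finset.sum_congr rfl fun x hx => ?_
      rw [← Finset.HasAntidiagonal.mem_antidiagonal.mp hx, map_add, pow_add, nnnorm_mul]
      ring

theorem polyNorm_pow (r : ℝ≥0) (a : MvPowerSeries ι ℂ) (k : ℕ) :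
    polyNorm r (a ^ k) ≤ polyNorm r a ^ k := by
  induction k with
  | zero => rw [pow_zero, pow_zero]; exact polyNorm_one r
  | succ k ih =>
    rw [pow_succ, pow_succ]
    exact (polyNorm_mul r _ _).trans (mul_le_mul_left ih _)

theorem polyNorm_prod_pow {r ρ : ℝ≥0} {w : ι → MvPowerSeries κ ℂ}
    (hw : ∀ i, polyNorm r (w i) ≤ ρ) (α : ι →₀ ℕ) :
    polyNorm r (α.prod fun i k => w i ^ k) ≤ (ρ : ℝ≥0∞) ^ α.degree := by
  classical
  rw [Finsupp.prod, Finsupp.degree_apply]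
  induction α.support using Finset.induction_on with
  | empty => simpa using polyNorm_one r
  | insert i s hi ih =>
    rw [Finset.prod_insert hi, Finset.sum_insert hi, pow_add]
    refine (polyNorm_mul r _ _).trans (mul_le_mul' ?_ ih)
    exact (polyNorm_pow r _ _).trans (pow_le_pow_left' (hw i) _)

/-- A convergent power series without constant term is small on small polydiscs. -/
theorem eventually_polyNorm_le {a : MvPowerSeries ι ℂ} (ha : IsConvergent a)
    (h0 : MvPowerSeries.coeff 0 a = 0) {ρ : ℝ≥0} (hρ : 0 < ρ) :
    ∀ᶠ r : ℝ≥0 in 𝓝[>] 0, polyNorm r a ≤ ρ := by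
  obtain ⟨R, hR, hfin⟩ := isConvergent_iff.mp ha
  lift polyNorm R a to ℝ≥0 using hfin with N hN
  have hpos : 0 < min R (R * ρ / (N + 1)) := by positivity
  filter_upwards [Ioc_mem_nhdsGT hpos] with r hr
  have hrR : r ≤ R := hr.2.trans (min_le_left _ _)
  have h1 : polyNorm r a ≤ ((r / R : ℝ≥0) : ℝ≥0∞) * polyNorm R a := by
    rw [polyNorm, polyNorm, ← ENNReal.tsum_mul_left]
    refine ENNReal.tsum_le_tsum fun α => ?_
    norm_cast
    by_cases hα : α = 0
    · rw [hα, h0]; simp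
    · obtain ⟨k, hk⟩ : ∃ k, α.degree = k + 1 :=
        Nat.exists_eq_succ_of_ne_zero fun h => hα ((Finsupp.degree_eq_zero_iff α).mp h)
      rw [hk, pow_succ, pow_succ]
      calc ‖MvPowerSeries.coeff α a‖₊ * (r ^ k * r) ≤ ‖MvPowerSeries.coeff α a‖₊ * (R ^ k * r) := by
            gcongr
        _ = r / R * (‖MvPowerSeries.coeff α a‖₊ * (R ^ k * R)) := by field_simp
  refine h1.trans ?_
  rw [← hN]
  norm_cast
  have h2 : r ≤ R * ρ / (N + 1) := hr.2.trans (min_le_right _ _)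
  calc r / R * N ≤ (R * ρ / (N + 1)) / R * N := by gcongr
    _ = ρ * (N / (N + 1)) := by field_simp
    _ ≤ ρ * 1 := by
      gcongr
      rw [div_le_one (by positivity)]
      exact le_self_add
    _ = ρ := mul_one _

theorem Conv.hasSubst [Finite ι] {w : ι → Conv κ} (hw : ∀ i, Conv.const (w i) = 0) :
    MvPowerSeries.HasSubst fun i => (w i).1 :=
  MvPowerSeries.hasSubst_of_constantCoeff_zero hw

/-- Choose the polydisc so small that the values of all `w_i` lie in a polydisc on which `a`
converges. -/
theorem isConvergent_subst [Finite ι] {w : ι → Conv κ} (hw : ∀ i, Conv.const (w i) = 0)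
    {a : MvPowerSeries ι ℂ} (ha : IsConvergent a) :
    IsConvergent (MvPowerSeries.subst (fun i => (w i).1) a) := by
  obtain ⟨ρ, hρ, hfin⟩ := isConvergent_iff.mp ha
  have hev : ∀ᶠ r : ℝ≥0 in 𝓝[>] 0, ∀ i, polyNorm r (w i).1 ≤ ρ :=
    Filter.eventually_all.mpr fun i => eventually_polyNorm_le (w i).2
      ((Conv.const_apply (w i)).symm.trans (hw i)) hρ
  obtain ⟨r, hr, hr0⟩ := (hev.and self_mem_nhdsWithin).exists
  refine isConvergent_iff.mpr ⟨r, hr0, ne_top_of_le_ne_top hfin ?_⟩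
  calc polyNorm r (MvPowerSeries.subst (fun i => (w i).1) a)
      ≤ ∑' γ : κ →₀ ℕ, ∑' α : ι →₀ ℕ, (‖MvPowerSeries.coeff α a‖₊ : ℝ≥0∞) *
        ((‖MvPowerSeries.coeff γ (α.prod fun i k => (w i).1 ^ k)‖₊ * r ^ γ.degree : ℝ≥0) :
          ℝ≥0∞) := by
        refine ENNReal.tsum_le_tsum fun γ => ?_
        rw [MvPowerSeries.coeff_subst (Conv.hasSubst hw)]
        have hf := MvPowerSeries.coeff_subst_finite (Conv.hasSubst hw) a γ
        rw [finsum_eq_sum _ hf]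
        refine le_trans ?_ (ENNReal.sum_le_tsum hf.toFinset)
        norm_cast
        simp only [← mul_assoc]
        rw [← Finset.sum_mul]
        gcongr
        refine (nnnorm_sum_le _ _).trans (Finset.sum_le_sum fun α _ => ?_)
        rw [smul_eq_mul, nnnorm_mul]
    _ = ∑' α : ι →₀ ℕ, (‖MvPowerSeries.coeff α a‖₊ : ℝ≥0∞) *
          polyNorm r (α.prod fun i k => (w i).1 ^ k) := by
        rw [ENNReal.tsum_comm]
        simp only [ENNReal.tsum_mul_left]
        rfl
    _ ≤ polyNorm ρ a := by
        refine ENNReal.tsum_le_tsum fun α => ?_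
        rw [ENNReal.coe_mul, ENNReal.coe_pow]
        exact mul_le_mul_right (polyNorm_prod_pow hr α) _

/-- The substitution `a(z) ↦ a(w)` of convergent power series without constant term into convergent
power series. -/
def substHom [Finite ι] (w : ι → Conv κ) (hw : ∀ i, Conv.const (w i) = 0) :
    Conv ι →ₐ[ℂ] Conv κ :=
  AlgHom.ofLinearMap
    { toFun := fun a => ⟨MvPowerSeries.subst (fun i => (w i).1) a.1, isConvergent_subst hw a.2⟩
      map_add' := fun a b => Subtype.ext (MvPowerSeries.subst_add (Conv.hasSubst hw) a.1 b.1)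
      map_smul' := fun r a => Subtype.ext (MvPowerSeries.subst_smul (Conv.hasSubst hw) r a.1) }
    (Subtype.ext ((congrFun (MvPowerSeries.coe_substAlgHom (R := ℂ) (Conv.hasSubst hw)) 1).symm.trans
      (map_one _)))
    fun a b => Subtype.ext (MvPowerSeries.subst_mul (Conv.hasSubst hw) a.1 b.1)

theorem substHom_coord [Finite ι] (w : ι → Conv κ) (hw : ∀ i, Conv.const (w i) = 0) (i : ι) :
    substHom w hw (coord i) = w i :=
  Subtype.ext (MvPowerSeries.subst_X (Conv.hasSubst hw) i)

theorem coeff_substHom [Finite ι] (w : ι → Conv κ) (hw : ∀ i, Conv.const (w i) = 0) (a : Conv ι)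
    (γ : κ →₀ ℕ) : (substHom w hw a).coeff γ =
      ∑ᶠ α : ι →₀ ℕ, a.coeff α * (α.prod fun i k => w i ^ k).coeff γ := by
  refine (MvPowerSeries.coeff_subst (Conv.hasSubst hw) a.1 γ).trans (finsum_congr fun α => ?_)
  rw [smul_eq_mul]
  congr 1
  have : (α.prod fun i k => w i ^ k).1 = α.prod fun i k => (w i).1 ^ k :=
    map_finsuppProd (convSubalgebra κ).val α fun i k => w i ^ k
  rw [← this]
  rfl

theorem HasWeight.prod_pow {u : ι → ℤ} {u' : κ → ℤ} {w : ι → Conv κ}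
    (hw : ∀ i, HasWeight u' (w i) (u i)) (α : ι →₀ ℕ) :
    HasWeight u' (α.prod fun i k => w i ^ k) (weight u α) := by
  classical
  have hpow : ∀ i (k : ℕ), HasWeight u' (w i ^ k) (k • u i) := fun i k => by
    induction k with
    | zero => rw [pow_zero, zero_smul]; exact HasWeight.one le_rfl
    | succ k ih => rw [pow_succ, add_smul, one_smul]; exact ih.mul (hw i)
  rw [Finsupp.prod, Finsupp.weight_apply, Finsupp.sum]
  induction α.support using Finset.induction_on with
  | empty => rw [Finset.prod_empty, Finset.sum_empty]; exact HasWeight.one le_rfl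
  | insert i s hi ih => rw [Finset.prod_insert hi, Finset.sum_insert hi]; exact (hpow i _).mul ih

theorem HasWeight.substHom [Finite ι] {u : ι → ℤ} {u' : κ → ℤ} {w : ι → Conv κ}
    (hw : ∀ i, Conv.const (w i) = 0) (hwt : ∀ i, HasWeight u' (w i) (u i)) {g : Conv ι} {a : ℤ}
    (hg : HasWeight u g a) : HasWeight u' (substHom w hw g) a := by
  intro γ hγ
  rw [coeff_substHom] at hγ
  obtain ⟨α, hα⟩ : ∃ α, g.coeff α * (α.prod fun i k => w i ^ k).coeff γ ≠ 0 := by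
    by_contra! h
    exact hγ (finsum_eq_zero_of_forall_eq_zero h)
  exact (HasWeight.prod_pow hwt α γ (right_ne_zero_of_mul hα)).trans
    (hg α (left_ne_zero_of_mul hα))

/-! ### Derivations and homomorphisms are determined by the coordinates -/

/-- The coordinates generate the maximal ideal: `g = g(0) + ∑ z_i G_i`. -/
theorem Conv.eq_const_add [Fintype ι] (g : Conv ι) : ∃ G : ι → Conv ι,
    g = Conv.const g • 1 + ∑ i, coord i * G i := by
  classical
  -- every nonconstant monomial is assigned to one of the variables that divide it
  have hex : ∀ α : ι →₀ ℕ, α ≠ 0 → ∃ i, α i ≠ 0 := fun α hα => by simpa using Finsupp.ne_iff.mp hα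
  choose pick hpick using hex
  let A : ι → Set (ι →₀ ℕ) := fun i => {α | ∃ h : α + single i 1 ≠ 0, pick _ h = i}
  refine ⟨fun i => shiftOn i (A i) g, ?_⟩
  ext α
  have hsum : (∑ i, coord i * shiftOn i (A i) g).coeff α =
      ∑ i, (coord i * shiftOn i (A i) g).coeff α :=
    map_sum (⟨⟨Conv.coeff α, rfl⟩, fun _ _ => rfl⟩ : Conv ι →+ ℂ) _ _
  rw [Conv.coeff_add, hsum, Conv.coeff_smul, Conv.coeff_one, Conv.const_apply]
  by_cases hα : α = 0
  · subst hα
    rw [if_pos rfl, mul_one, Finset.sum_eq_zero, add_zero]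
    intro i _
    rw [Conv.coeff_coord_mul, if_neg]
    rw [Finsupp.single_le_iff]
    simp
  · rw [if_neg hα, mul_zero, zero_add, Finset.sum_eq_single (pick α hα)]
    · have hle : single (pick α hα) 1 ≤ α := by
        rw [Finsupp.single_le_iff]
        exact Nat.one_le_iff_ne_zero.mpr (hpick α hα)
      have heq := tsub_add_cancel_of_le hle
      rw [Conv.coeff_coord_mul, if_pos hle, coeff_shiftOn, if_pos, heq]
      simp only [A, Set.mem_ofPred_eq, heq]
      exact ⟨hα, trivial⟩
    · intro i _ hi
      rw [Conv.coeff_coord_mul]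
      split_ifs with hle
      · have heq := tsub_add_cancel_of_le hle
        rw [coeff_shiftOn, if_neg]
        simp only [A, Set.mem_ofPred_eq, heq]
        rintro ⟨_, h⟩
        exact hi h.symm
      · rfl
    · exact fun h => absurd (Finset.mem_univ _) h

theorem weight_neg_one (α : ι →₀ ℕ) : weight (fun _ => (-1 : ℤ)) α = -(α.degree : ℤ) := by
  rw [Finsupp.weight_apply, Finsupp.degree_apply, Finsupp.sum]
  simp

theorem hasWeight_neg_one_of_const {g : Conv ι} (hg : Conv.const g = 0) :
    HasWeight (fun _ => -1) g (-1) := by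
  intro α hα
  have hα0 : α ≠ 0 := fun h => hα (by rw [h, ← Conv.const_apply, hg])
  rw [weight_neg_one]
  have := mt (Finsupp.degree_eq_zero_iff α).mp hα0
  omega

/-- A twisted derivation that vanishes on the coordinates vanishes: its values are divisible by
arbitrarily high powers of the maximal ideal. -/
theorem twistedDerivation_eq_zero [Fintype ι] {τ τ' : Conv ι → Conv κ}
    (δ : Conv ι →ₗ[ℂ] Conv κ) (hδ : ∀ a b, δ (a * b) = τ a * δ b + δ a * τ' b)
    (hτ : ∀ i, Conv.const (τ (coord i)) = 0) (hone : δ 1 = 0) (hcoord : ∀ i, δ (coord i) = 0)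
    (g : Conv ι) : δ g = 0 := by
  have key : ∀ (N : ℕ) g, HasWeight (fun _ => -1) (δ g) (-(N : ℤ)) := by
    intro N
    induction N with
    | zero => exact fun g => hasWeight_of_nonpos (fun _ => by norm_num) _ (by simp)
    | succ N ih =>
      intro g
      obtain ⟨G, hG⟩ := Conv.eq_const_add g
      rw [hG, map_add, map_smul, hone, smul_zero, zero_add, map_sum]
      refine HasWeight.sum _ _ fun i _ => ?_
      rw [hδ, hcoord, zero_mul, add_zero]
      exact ((hasWeight_neg_one_of_const (hτ i)).mul (ih _)).mono (by push_cast; omega)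
  ext α
  by_contra h
  have := key (α.degree + 1) g α h
  rw [weight_neg_one] at this
  push_cast at this
  omega

/-- Homomorphisms into `ℂ{z}` that agree on the coordinates are equal. -/
theorem Conv.algHom_ext [Fintype ι] {τ τ' : Conv ι →ₐ[ℂ] Conv κ}
    (hτ : ∀ i, Conv.const (τ (coord i)) = 0) (h : ∀ i, τ (coord i) = τ' (coord i)) : τ = τ' := by
  refine AlgHom.ext fun g => sub_eq_zero.mp ?_
  exact twistedDerivation_eq_zero (τ := τ) (τ' := τ') (τ.toLinearMap - τ'.toLinearMap)
    (fun a b => by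
      simp only [LinearMap.sub_apply, AlgHom.toLinearMap_apply, map_mul]; ring)
    hτ (by simp) (fun i => by simp [h]) g

/-- A derivation is the combination of the `∂_k` with its values on the coordinates as
coefficients. -/
theorem derivation_eq [Fintype ι] (δ : Conv ι →ₗ[ℂ] Conv ι)
    (hδ : ∀ a b, δ (a * b) = a * δ b + δ a * b) (g : Conv ι) :
    δ g = ∑ k, δ (coord k) * pderivEnd k g := by
  classical
  have h1 : δ 1 = 0 := by
    have := hδ 1 1
    rw [mul_one, one_mul, mul_one] at this
    exact left_eq_add.mp this
  let δ' : Conv ι →ₗ[ℂ] Conv ι := δ - ∑ k, (mulEnd (δ (coord k))).comp (pderivEnd k)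
  have hδ' : ∀ a, δ' a = δ a - ∑ k, δ (coord k) * pderivEnd k a := fun a => by
    simp [δ', LinearMap.sum_apply, mulEnd]
  rw [← sub_eq_zero, ← hδ']
  refine twistedDerivation_eq_zero (τ := id) (τ' := id) δ' (fun a b => ?_) (fun i => ?_) ?_
    (fun i => ?_) g
  · simp only [hδ', hδ, pderivEnd_mul, id_eq, mul_add, Finset.sum_add_distrib, mul_sub, sub_mul,
      Finset.mul_sum, Finset.sum_mul]
    have e1 : ∀ k, a * (δ (coord k) * pderivEnd k b) = δ (coord k) * (a * pderivEnd k b) :=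
      fun k => by ring
    have e2 : ∀ k, δ (coord k) * pderivEnd k a * b = δ (coord k) * (pderivEnd k a * b) :=
      fun k => by ring
    simp only [e1, e2]
    ring
  · exact Conv.const_coord i
  · rw [hδ', h1]
    simp
  · rw [hδ']
    simp [pderivEnd_coord]

end

section

/-! ### Coordinate changes -/

section CoordinateChange

/-- Conjugation of linear endomorphisms of `ℂ{z}` by an automorphism `τ` of `ℂ{z}`. -/
def conjEnd (τ : Conv ι ≃ₐ[ℂ] Conv ι) (P : Module.End ℂ (Conv ι)) : Module.End ℂ (Conv ι) :=
  τ.toLinearMap ∘ₗ P ∘ₗ τ.symm.toLinearMap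

theorem conjEnd_mulEnd (τ : Conv ι ≃ₐ[ℂ] Conv ι) (a : Conv ι) :
    conjEnd τ (mulEnd a) = mulEnd (τ a) := by
  refine LinearMap.ext fun b => ?_
  change τ (a * τ.symm b) = τ a * b
  rw [map_mul, τ.apply_symm_apply]

variable [Fintype ι]

/-- The conjugate of `∂_i` is a derivation, hence a combination of the `∂_k`. -/
theorem conjEnd_pderivEnd (τ : Conv ι ≃ₐ[ℂ] Conv ι) (i : ι) :
    conjEnd τ (pderivEnd i) =
      (∑ k, fn (τ (pderivEnd i (τ.symm (coord k)))) * del k : DiffOp ι).1 := by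
  refine LinearMap.ext fun g => ?_
  have h := derivation_eq (conjEnd τ (pderivEnd i)) (fun a b => by
    change τ (pderivEnd i (τ.symm (a * b))) =
      a * τ (pderivEnd i (τ.symm b)) + τ (pderivEnd i (τ.symm a)) * b
    rw [map_mul, pderivEnd_mul, map_add, map_mul, map_mul, τ.apply_symm_apply,
      τ.apply_symm_apply]) g
  rw [h]
  have h2 : ∀ s : Finset ι, (∑ k ∈ s, fn (τ (pderivEnd i (τ.symm (coord k)))) * del k : DiffOp ι).1 g
      = ∑ k ∈ s, τ (pderivEnd i (τ.symm (coord k))) * pderivEnd k g := fun s =>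
    map_sum (⟨⟨fun P : DiffOp ι => P.1 g, rfl⟩, fun _ _ => rfl⟩ : DiffOp ι →+ Conv ι) _ s
  rw [h2]
  rfl

theorem conjEnd_mem (τ : Conv ι ≃ₐ[ℂ] Conv ι) (P : DiffOp ι) :
    conjEnd τ P.1 ∈ diffOpSubalgebra ι := by
  induction P using DiffOp.induction with
  | hfn a =>
    change conjEnd τ (mulEnd a) ∈ _
    rw [conjEnd_mulEnd]
    exact (fn (τ a)).2
  | hdel i =>
    change conjEnd τ (pderivEnd i) ∈ _
    rw [conjEnd_pderivEnd]
    exact Subtype.property _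
  | hadd P Q hP hQ =>
    have : conjEnd τ (P + Q).1 = conjEnd τ P.1 + conjEnd τ Q.1 :=
      LinearMap.ext fun g => map_add τ _ _
    rw [this]
    exact add_mem hP hQ
  | hmul P Q hP hQ =>
    have : conjEnd τ (P * Q).1 = conjEnd τ P.1 * conjEnd τ Q.1 :=
      LinearMap.ext fun g => by
        change τ (P.1 (Q.1 (τ.symm g))) = τ (P.1 (τ.symm (τ (Q.1 (τ.symm g)))))
        rw [τ.symm_apply_apply]
    rw [this]
    exact mul_mem hP hQ

/-- The automorphism `P ↦ τ ∘ P ∘ τ⁻¹` of `𝒟` induced by a coordinate change `τ`. -/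
def opConj (τ : Conv ι ≃ₐ[ℂ] Conv ι) : DiffOp ι ≃+* DiffOp ι where
  toFun P := ⟨conjEnd τ P.1, conjEnd_mem τ P⟩
  invFun P := ⟨conjEnd τ.symm P.1, conjEnd_mem τ.symm P⟩
  left_inv P := DiffOp.ext fun g => by
    change τ.symm (τ (P.1 (τ.symm (τ g)))) = P.1 g
    rw [τ.symm_apply_apply, τ.symm_apply_apply]
  right_inv P := DiffOp.ext fun g => by
    change τ (τ.symm (P.1 (τ (τ.symm g)))) = P.1 g
    rw [τ.apply_symm_apply, τ.apply_symm_apply]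
  map_mul' P Q := DiffOp.ext fun g => by
    change τ (P.1 (Q.1 (τ.symm g))) = τ (P.1 (τ.symm (τ (Q.1 (τ.symm g)))))
    rw [τ.symm_apply_apply]
  map_add' P Q := DiffOp.ext fun g => map_add τ _ _

theorem opConj_fn (τ : Conv ι ≃ₐ[ℂ] Conv ι) (a : Conv ι) : opConj τ (fn a) = fn (τ a) :=
  Subtype.ext (conjEnd_mulEnd τ a)

theorem opConj_del (τ : Conv ι ≃ₐ[ℂ] Conv ι) (i : ι) : opConj τ (del i) =
    ∑ k, fn (τ (pderivEnd i (τ.symm (coord k)))) * del k :=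
  Subtype.ext (conjEnd_pderivEnd τ i)

variable {u v : ι → ℤ}

/-- A coordinate change that preserves the weights `u` induces an automorphism of `𝒟` that preserves
the bifiltration for `(u, -u)`. -/
theorem opConj_mem_biFil (huv : ∀ i, u i + v i = 0) {τ : Conv ι ≃ₐ[ℂ] Conv ι}
    (hτ : ∀ g a, HasWeight u g a → HasWeight u (τ g) a)
    (hτ' : ∀ g a, HasWeight u g a → HasWeight u (τ.symm g) a) {d k : ℤ} {P : DiffOp ι}
    (hP : P ∈ biFil u v d k) : opConj τ P ∈ biFil u v d k := by
  have huv' : ∀ i, 0 ≤ u i + v i := fun i => (huv i).ge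
  have hdel : ∀ i, opConj τ (del i) ∈ biFil u v 1 (v i) := fun i => by
    rw [opConj_del]
    refine sum_mem fun k _ => ?_
    have h1 := biFil_mul huv' (fn_mem_biFil (u := u) (v := v)
      (hτ _ _ ((hτ' _ _ (HasWeight.coord k le_rfl)).pderiv i))) (del_mem_biFil k)
    have hi := huv i
    have hk := huv k
    exact biFil_mono (by omega) (by omega) h1
  have hpow : ∀ β, opConj τ (delPow β) ∈
      biFil u v (weight (fun _ => (1 : ℤ)) β) (weight v β) := fun β => by
    refine exponent_induction (p := fun β => opConj τ (delPow β) ∈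
      biFil u v (weight (fun _ => (1 : ℤ)) β) (weight v β)) β ?_ fun i β ih => ?_
    · rw [delPow_zero, map_one, map_zero, map_zero]
      exact one_mem_biFil
    · rw [delPow_single_add, map_mul, map_add, map_add, Finsupp.weight_single,
        Finsupp.weight_single, one_smul, one_smul]
      exact biFil_mul huv' (hdel i) ih
  refine biFil_induction (p := fun P => opConj τ P ∈ biFil u v d k) hP ?_ (fun P Q h1 h2 => ?_)
    fun g β h1 h2 => ?_
  · rw [map_zero]; exact zero_mem _
  · rw [map_add]; exact add_mem h1 h2
  · rw [map_mul, opConj_fn]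
    exact biFil_mono (by omega) (by omega)
      (biFil_mul huv' (fn_mem_biFil (hτ _ _ h2)) (hpow β))

end CoordinateChange

/-! ### Transport of resolutions along automorphisms of `𝒟` -/

section Transport

variable (Ψ : DiffOp ι ≃+* DiffOp ι)

/-- `Ψ` applied to the components of an element of `𝒟^r`. -/
def vecMap (r : ℕ) : (Fin r → DiffOp ι) ≃+ (Fin r → DiffOp ι) :=
  AddEquiv.piCongrRight fun _ => Ψ.toAddEquiv

theorem vecMap_smul {r : ℕ} (P : DiffOp ι) (y : Fin r → DiffOp ι) :
    vecMap Ψ r (P • y) = Ψ P • vecMap Ψ r y := funext fun _ => map_mul Ψ _ _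

theorem vecMap_symm_smul {r : ℕ} (P : DiffOp ι) (y : Fin r → DiffOp ι) :
    (vecMap Ψ r).symm (P • y) = Ψ.symm P • (vecMap Ψ r).symm y := funext fun _ => map_mul Ψ.symm _ _

variable {Ψ}

/-- The map `Ψ ∘ φ ∘ Ψ⁻¹` of free modules. -/
def conjFree (Ψ : DiffOp ι ≃+* DiffOp ι) {a b : ℕ}
    (φ : (Fin a → DiffOp ι) →ₗ[DiffOp ι] (Fin b → DiffOp ι)) :
    (Fin a → DiffOp ι) →ₗ[DiffOp ι] (Fin b → DiffOp ι) where
  toFun y := vecMap Ψ b (φ ((vecMap Ψ a).symm y))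
  map_add' x y := by rw [map_add, map_add, map_add]
  map_smul' P y := by
    rw [vecMap_symm_smul, map_smul, vecMap_smul, Ψ.apply_symm_apply]; rfl

theorem conjFree_vecMap {a b : ℕ} (φ : (Fin a → DiffOp ι) →ₗ[DiffOp ι] (Fin b → DiffOp ι))
    (y : Fin a → DiffOp ι) : conjFree Ψ φ (vecMap Ψ a y) = vecMap Ψ b (φ y) := by
  change vecMap Ψ b (φ ((vecMap Ψ a).symm (vecMap Ψ a y))) = _
  rw [AddEquiv.symm_apply_apply]

variable {I I' : Submodule (DiffOp ι) (DiffOp ι)}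

/-- The map `𝒟 / I → 𝒟 / I'` induced by `Ψ` if `Ψ(I) = I'`. -/
def quotConj (hI : ∀ P, P ∈ I ↔ Ψ P ∈ I') : DiffOp ι ⧸ I →+ DiffOp ι ⧸ I' :=
  QuotientAddGroup.map I.toAddSubgroup I'.toAddSubgroup Ψ.toAddEquiv.toAddMonoidHom
    fun P hP => (hI P).mp hP

theorem quotConj_mk (hI : ∀ P, P ∈ I ↔ Ψ P ∈ I') (P : DiffOp ι) :
    quotConj hI (I.mkQ P) = I'.mkQ (Ψ P) := rfl

theorem quotConj_smul (hI : ∀ P, P ∈ I ↔ Ψ P ∈ I') (P : DiffOp ι) (x : DiffOp ι ⧸ I) :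
    quotConj hI (P • x) = Ψ P • quotConj hI x := by
  obtain ⟨Q, rfl⟩ := I.mkQ_surjective x
  rw [← map_smul, quotConj_mk, quotConj_mk, ← map_smul, smul_eq_mul, map_mul, smul_eq_mul]

theorem quotConj_eq_zero (hI : ∀ P, P ∈ I ↔ Ψ P ∈ I') (x : DiffOp ι ⧸ I) :
    quotConj hI x = 0 ↔ x = 0 := by
  obtain ⟨Q, rfl⟩ := I.mkQ_surjective x
  rw [quotConj_mk, Submodule.mkQ_apply, Submodule.mkQ_apply, Submodule.Quotient.mk_eq_zero,
    Submodule.Quotient.mk_eq_zero, hI]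

/-- `Ψ ∘ ε ∘ Ψ⁻¹`. -/
def conjAug (hI : ∀ P, P ∈ I ↔ Ψ P ∈ I') {a : ℕ}
    (ε : (Fin a → DiffOp ι) →ₗ[DiffOp ι] DiffOp ι ⧸ I) :
    (Fin a → DiffOp ι) →ₗ[DiffOp ι] DiffOp ι ⧸ I' where
  toFun y := quotConj hI (ε ((vecMap Ψ a).symm y))
  map_add' x y := by rw [map_add, map_add, map_add]
  map_smul' P y := by
    rw [vecMap_symm_smul, map_smul, quotConj_smul, Ψ.apply_symm_apply]; rfl

theorem conjAug_vecMap (hI : ∀ P, P ∈ I ↔ Ψ P ∈ I') {a : ℕ}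
    (ε : (Fin a → DiffOp ι) →ₗ[DiffOp ι] DiffOp ι ⧸ I) (y : Fin a → DiffOp ι) :
    conjAug hI ε (vecMap Ψ a y) = quotConj hI (ε y) := by
  change quotConj hI (ε ((vecMap Ψ a).symm (vecMap Ψ a y))) = _
  rw [AddEquiv.symm_apply_apply]

theorem conjFree_eq_zero {a b : ℕ} (φ : (Fin a → DiffOp ι) →ₗ[DiffOp ι] (Fin b → DiffOp ι))
    (y : Fin a → DiffOp ι) : conjFree Ψ φ (vecMap Ψ a y) = 0 ↔ φ y = 0 := by
  rw [conjFree_vecMap, map_eq_zero_iff _ (vecMap Ψ b).injective]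

theorem conj_exact {a b : ℕ}
    {φ : (Fin a → DiffOp ι) →ₗ[DiffOp ι] (Fin b → DiffOp ι)} {N N' : Type} [AddCommGroup N]
    [AddCommGroup N'] {ψ : (Fin b → DiffOp ι) → N} {ψ' : (Fin b → DiffOp ι) → N'}
    (hψ : ∀ y, ψ' (vecMap Ψ b y) = 0 ↔ ψ y = 0) (h : Function.Exact φ ψ) :
    Function.Exact (conjFree Ψ φ) ψ' := by
  intro y
  obtain ⟨y, rfl⟩ := (vecMap Ψ b).surjective y
  rw [hψ, h y]
  constructor
  · rintro ⟨z, rfl⟩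
    exact ⟨vecMap Ψ a z, conjFree_vecMap φ z⟩
  · rintro ⟨z, hzy⟩
    obtain ⟨z, rfl⟩ := (vecMap Ψ a).surjective z
    rw [conjFree_vecMap] at hzy
    exact ⟨z, (vecMap Ψ b).injective hzy⟩

variable [Fintype ι] {u v : ι → ℤ}

/-- An automorphism of `𝒟` that preserves the bifiltration and the ideal `𝔪`. The last condition
says that the images of the coordinates are homogeneous combinations of the coordinates. -/
structure IsBifilteredAut (u v : ι → ℤ) (Ψ : DiffOp ι ≃+* DiffOp ι) : Prop where
  mem : ∀ {d k : ℤ} {P : DiffOp ι}, P ∈ biFil u v d k → Ψ P ∈ biFil u v d k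
  symm_mem : ∀ {d k : ℤ} {P : DiffOp ι}, P ∈ biFil u v d k → Ψ.symm P ∈ biFil u v d k
  coord : ∀ i, ∃ a : ι → Conv ι, (∀ k, HasWeight u (a k) (u i - u k)) ∧
    Ψ (fn (coord i)) = ∑ k, fn (a k) * fn (AnalyticDMod.coord k)

theorem IsBifilteredAut.vecMap_mem_iff (hΨ : IsBifilteredAut u v Ψ) {r : ℕ} {n m : Fin r → ℤ}
    {d k : ℤ} {y : Fin r → DiffOp ι} :
    vecMap Ψ r y ∈ freeFil u v n m d k ↔ y ∈ freeFil u v n m d k := by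
  rw [mem_freeFil, mem_freeFil]
  refine forall_congr' fun l => ⟨fun h => ?_, fun h => hΨ.mem h⟩
  have := hΨ.symm_mem h
  rwa [show Ψ.symm (vecMap Ψ r y l) = y l from Ψ.symm_apply_apply _] at this

theorem IsBifilteredAut.vecMap_mem_maxIdealMul (hΨ : IsBifilteredAut u v Ψ)
    (huv : ∀ i, 0 ≤ u i + v i) {r : ℕ} {n m : Fin r → ℤ} {d k : ℤ} {y : Fin r → DiffOp ι}
    (hy : y ∈ maxIdealMul u v (freeFil u v n m) d k) :
    vecMap Ψ r y ∈ maxIdealMul u v (freeFil u v n m) d k := by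
  have h := map_mem_maxIdealMul (u' := u) (v' := v) (G := freeFil u v n m)
    (vecMap Ψ r).toAddMonoidHom 0 (fun d k y hy => by
      rw [add_zero]; exact hΨ.vecMap_mem_iff.mpr hy) ?_ hy
  · rwa [add_zero] at h
  intro d₁ d₂ d₃ k₁ k₂ k₃ P Q y hP hQ hy
  have hy' := hΨ.vecMap_mem_iff.mpr hy
  change vecMap Ψ r (P • Q • y) ∈ _
  rw [vecMap_smul, vecMap_smul, add_zero]
  rcases hQ with ⟨rfl, i, rfl, rfl⟩ | ⟨rfl, hQ⟩
  · obtain ⟨a, ha, hΨa⟩ := hΨ.coord i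
    rw [hΨa, Finset.sum_smul, Finset.smul_sum]
    refine sum_mem fun k _ => ?_
    rw [mul_smul, ← mul_smul]
    have := smul_smul_mem_maxIdealMul (biFil_mul huv (hΨ.mem hP) (fn_mem_biFil (ha k)))
      (Or.inl ⟨rfl, k, rfl, rfl⟩ : fn (AnalyticDMod.coord k) ∈ maxIdealGens u v 0 (u k)) hy'
    rwa [show d₁ + 0 + 0 + d₃ = d₁ + 0 + d₃ by ring,
      show k₁ + (u i - u k) + u k + k₃ = k₁ + u i + k₃ by ring] at this
  · exact smul_smul_mem_maxIdealMul (hΨ.mem hP) (Or.inr ⟨rfl, hΨ.mem hQ⟩) hy'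

theorem IsBifilteredAut.quotConj_image (hΨ : IsBifilteredAut u v Ψ)
    (hI : ∀ P, P ∈ I ↔ Ψ P ∈ I') (d k : ℤ) :
    quotConj hI '' (quotFil u v I d k : Set _) = quotFil u v I' d k := by
  ext x
  constructor
  · rintro ⟨-, ⟨P, hP, rfl⟩, rfl⟩
    exact mem_quotFil.mpr ⟨Ψ P, hΨ.mem hP, rfl⟩
  · rintro ⟨P, hP, rfl⟩
    refine ⟨I.mkQ (Ψ.symm P), mem_quotFil.mpr ⟨_, hΨ.symm_mem hP, rfl⟩, ?_⟩
    rw [quotConj_mk, Ψ.apply_symm_apply]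
    rfl

/-- Strict exactness is preserved by conjugation with `Ψ`. -/
theorem IsBifilteredAut.conj_strict (hΨ : IsBifilteredAut u v Ψ) {a b : ℕ}
    {φ : (Fin a → DiffOp ι) →ₗ[DiffOp ι] (Fin b → DiffOp ι)} {n m : Fin a → ℤ} {n' m' : Fin b → ℤ}
    {d k : ℤ} {Z Z' : Set (Fin b → DiffOp ι)} (hZ : ∀ y, vecMap Ψ b y ∈ Z' ↔ y ∈ Z)
    (h : φ '' (freeFil u v n m d k : Set _) = {y | y ∈ freeFil u v n' m' d k ∧ y ∈ Z}) :
    conjFree Ψ φ '' (freeFil u v n m d k : Set _) =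
      {y | y ∈ freeFil u v n' m' d k ∧ y ∈ Z'} := by
  ext y
  obtain ⟨y, rfl⟩ := (vecMap Ψ b).surjective y
  have hy := Set.ext_iff.mp h y
  rw [Set.mem_ofPred_eq] at hy ⊢
  rw [hZ, hΨ.vecMap_mem_iff, ← hy]
  constructor
  · rintro ⟨z, hz, hzy⟩
    obtain ⟨z, rfl⟩ := (vecMap Ψ a).surjective z
    rw [conjFree_vecMap] at hzy
    exact ⟨z, hΨ.vecMap_mem_iff.mp hz, (vecMap Ψ b).injective hzy⟩
  · rintro ⟨z, hz, rfl⟩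
    exact ⟨vecMap Ψ a z, hΨ.vecMap_mem_iff.mpr hz, conjFree_vecMap φ z⟩

/-- Transport of a minimal bifiltered free resolution of `𝒟 / I` along an automorphism `Ψ` of `𝒟`
with `Ψ(I) = I'`. -/
def MinimalBifilteredFreeResolution.conj (hΨ : IsBifilteredAut u v Ψ)
    (huv : ∀ i, 0 ≤ u i + v i) (hI : ∀ P, P ∈ I ↔ Ψ P ∈ I')
    (R : MinimalBifilteredFreeResolution u v (quotFil u v I)) :
    MinimalBifilteredFreeResolution u v (quotFil u v I') where
  rank := R.rank
  n := R.n
  m := R.m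
  φ i := conjFree Ψ (R.φ i)
  ε := conjAug hI R.ε
  ε_surjective x := by
    obtain ⟨P, rfl⟩ := I'.mkQ_surjective x
    obtain ⟨y, hy⟩ := R.ε_surjective (I.mkQ (Ψ.symm P))
    refine ⟨vecMap Ψ _ y, ?_⟩
    rw [conjAug_vecMap, hy, quotConj_mk, Ψ.apply_symm_apply]
  exact_zero := conj_exact (fun y => by rw [conjAug_vecMap, quotConj_eq_zero]) R.exact_zero
  exact_succ i := conj_exact (conjFree_eq_zero _) (R.exact_succ i)
  fil_ε d k := by
    rw [← hΨ.quotConj_image hI, ← R.fil_ε, Set.image_image]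
    ext x
    constructor
    · rintro ⟨y, hy, rfl⟩
      obtain ⟨y, rfl⟩ := (vecMap Ψ _).surjective y
      exact ⟨y, hΨ.vecMap_mem_iff.mp hy, (conjAug_vecMap hI _ y).symm⟩
    · rintro ⟨y, hy, rfl⟩
      exact ⟨vecMap Ψ _ y, hΨ.vecMap_mem_iff.mpr hy, conjAug_vecMap hI _ y⟩
  fil_exact_zero d k := hΨ.conj_strict
    (Z := {y | R.ε y = 0}) (Z' := {y | conjAug hI R.ε y = 0})
    (fun y => by
      rw [Set.mem_ofPred_eq, Set.mem_ofPred_eq, conjAug_vecMap, quotConj_eq_zero])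
    (R.fil_exact_zero d k)
  fil_exact_succ i d k := hΨ.conj_strict
    (Z := {y | R.φ i y = 0}) (Z' := {y | conjFree Ψ (R.φ i) y = 0})
    (fun y => conjFree_eq_zero _ y) (R.fil_exact_succ i d k)
  minimal i d k y hy := by
    obtain ⟨y, rfl⟩ := (vecMap Ψ _).surjective y
    rw [conjFree_vecMap]
    exact hΨ.vecMap_mem_maxIdealMul huv (R.minimal i d k y (hΨ.vecMap_mem_iff.mp hy))

theorem MinimalBifilteredFreeResolution.shifts_conj (hΨ : IsBifilteredAut u v Ψ)
    (huv : ∀ i, 0 ≤ u i + v i) (hI : ∀ P, P ∈ I ↔ Ψ P ∈ I')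
    (R : MinimalBifilteredFreeResolution u v (quotFil u v I)) (i : ℤ) :
    (R.conj hΨ huv hI).shifts i = R.shifts i := by
  cases i <;> rfl

end Transport

end

section

/-! ### Linear changes of the coordinates `t` -/

theorem pderivEnd_incl [Fintype ι] (e : ι ↪ κ) (i : ι) (a : Conv ι) :
    pderivEnd (e i) (incl e a) = incl e (pderivEnd i a) := by
  classical
  refine sub_eq_zero.mp (twistedDerivation_eq_zero (τ := inclHom e) (τ' := inclHom e)
    (pderivEnd (e i) ∘ₗ (inclHom e).toLinearMap - (inclHom e).toLinearMap ∘ₗ pderivEnd i)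
    (fun a b => ?_) (fun j => ?_) ?_ (fun j => ?_) a)
  · simp only [LinearMap.sub_apply, LinearMap.comp_apply, AlgHom.toLinearMap_apply, map_mul,
      pderivEnd_mul, map_add]
    ring
  · rw [inclHom_apply, incl_coord, Conv.const_coord]
  · simp [pderivEnd_one]
  · simp only [LinearMap.sub_apply, LinearMap.comp_apply, AlgHom.toLinearMap_apply, inclHom_apply,
      incl_coord, pderivEnd_coord, e.injective.eq_iff]
    split_ifs
    · rw [← inclHom_apply, map_one, sub_self]
    · rw [← inclHom_apply, map_zero, sub_self]

theorem pderivEnd_incl_of_ne [Fintype ι] (e : ι ↪ κ) {k : κ} (hk : ∀ i, k ≠ e i) (a : Conv ι) :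
    pderivEnd k (incl e a) = 0 := by
  classical
  refine twistedDerivation_eq_zero (τ := inclHom e) (τ' := inclHom e)
    (pderivEnd k ∘ₗ (inclHom e).toLinearMap) (fun a b => ?_) (fun j => ?_) ?_ (fun j => ?_) a
  · simp only [LinearMap.comp_apply, AlgHom.toLinearMap_apply, map_mul, pderivEnd_mul]
  · rw [inclHom_apply, incl_coord, Conv.const_coord]
  · simp [pderivEnd_one]
  · simp only [LinearMap.comp_apply, AlgHom.toLinearMap_apply, inclHom_apply, incl_coord,
      pderivEnd_coord, if_neg (hk j)]

variable {n p : ℕ}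

/-- `a(x) ↦ a(x)` as an algebra homomorphism `ℂ{x} → ℂ{x,t}`. -/
def liftHom (n p : ℕ) : Conv (Fin n) →ₐ[ℂ] Conv (Fin n ⊕ Fin p) :=
  inclHom ⟨Sum.inl, Sum.inl_injective⟩

theorem liftHom_apply (a : Conv (Fin n)) : liftHom n p a = liftX p a := rfl

theorem liftX_coord (i : Fin n) : liftX p (coord i) = coord (Sum.inl i) := incl_coord _ i

theorem pderivEnd_inl_liftX (i : Fin n) (a : Conv (Fin n)) :
    pderivEnd (Sum.inl i) (liftX p a) = liftX p (pderivEnd i a) :=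
  pderivEnd_incl ⟨Sum.inl, Sum.inl_injective⟩ i a

theorem pderivEnd_inr_liftX (j : Fin p) (a : Conv (Fin n)) :
    pderivEnd (Sum.inr j) (liftX p a) = 0 :=
  pderivEnd_incl_of_ne ⟨Sum.inl, Sum.inl_injective⟩ (fun _ => Sum.inr_ne_inl) a

theorem vU_nonpos (i : Fin n ⊕ Fin p) : vU n p i ≤ 0 := by
  cases i with
  | inl i => exact le_rfl
  | inr j => exact neg_one_lt_zero.le

theorem vU_add_vV (i : Fin n ⊕ Fin p) : vU n p i + vV n p i = 0 := by
  cases i <;> rfl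

/-- A square matrix of functions of `x`. -/
abbrev FnMatrix (n p : ℕ) : Type := Matrix (Fin p) (Fin p) (Conv (Fin n))

/-- The images of the coordinates under `x_i ↦ x_i`, `t_j ↦ ∑_k M_{jk}(x) t_k`. -/
def linCoord (M : FnMatrix n p) : Fin n ⊕ Fin p → Conv (Fin n ⊕ Fin p) :=
  Sum.elim (fun i => coord (Sum.inl i)) fun j => ∑ k, liftX p (M j k) * coord (Sum.inr k)

theorem const_linCoord (M : FnMatrix n p) (i : Fin n ⊕ Fin p) : Conv.const (linCoord M i) = 0 := by
  cases i with
  | inl i => exact Conv.const_coord _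
  | inr j =>
    rw [linCoord, Sum.elim_inr, map_sum]
    exact Finset.sum_eq_zero fun k _ => by rw [map_mul, Conv.const_coord, mul_zero]

theorem hasWeight_linCoord (M : FnMatrix n p) (i : Fin n ⊕ Fin p) :
    HasWeight (vU n p) (linCoord M i) (vU n p i) := by
  cases i with
  | inl i => exact HasWeight.coord _ le_rfl
  | inr j =>
    rw [linCoord, Sum.elim_inr]
    refine HasWeight.sum _ _ fun k _ => ?_
    rw [← zero_add (vU n p (Sum.inr j))]
    exact (hasWeight_of_nonpos vU_nonpos _ le_rfl).mul (HasWeight.coord _ le_rfl)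

/-- The endomorphism `x_i ↦ x_i`, `t_j ↦ ∑_k M_{jk}(x) t_k` of `ℂ{x,t}`. -/
def linHom (M : FnMatrix n p) : Conv (Fin n ⊕ Fin p) →ₐ[ℂ] Conv (Fin n ⊕ Fin p) :=
  substHom (linCoord M) (const_linCoord M)

theorem linHom_coord (M : FnMatrix n p) (i : Fin n ⊕ Fin p) :
    linHom M (coord i) = linCoord M i := substHom_coord _ _ i

theorem linHom_liftX (M : FnMatrix n p) (a : Conv (Fin n)) : linHom M (liftX p a) = liftX p a := by
  have h : (linHom M).comp (liftHom n p) = liftHom n p := by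
    have h1 : ∀ i, (linHom M).comp (liftHom n p) (coord i) = coord (Sum.inl i) := fun i => by
      rw [AlgHom.comp_apply, liftHom_apply, liftX_coord, linHom_coord]
      rfl
    refine Conv.algHom_ext (fun i => ?_) fun i => ?_
    · rw [h1, Conv.const_coord]
    · rw [h1, liftHom_apply, liftX_coord]
  exact DFunLike.congr_fun h a

theorem linHom_comp_eq_id {M N : FnMatrix n p} (h : N * M = 1) :
    (linHom M).comp (linHom N) = AlgHom.id ℂ _ := by
  have h1 : ∀ i, (linHom M).comp (linHom N) (coord i) = coord i := fun i => by
    rw [AlgHom.comp_apply, linHom_coord]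
    cases i with
    | inl i => exact linHom_coord M _
    | inr j =>
      rw [linCoord, Sum.elim_inr, map_sum]
      simp only [map_mul, linHom_liftX, linHom_coord, linCoord, Sum.elim_inr, Finset.mul_sum]
      rw [Finset.sum_comm]
      have h2 : ∀ l, ∑ k, liftX p (N j k) * (liftX p (M k l) * coord (Sum.inr l)) =
          liftX p ((N * M) j l) * coord (Sum.inr l) := fun l => by
        rw [Matrix.mul_apply, ← liftHom_apply, map_sum, Finset.sum_mul]
        exact Finset.sum_congr rfl fun k _ => by
          rw [map_mul, liftHom_apply, liftHom_apply, mul_assoc]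
      simp only [h2, h, Matrix.one_apply]
      rw [Finset.sum_eq_single j]
      · rw [if_pos rfl, ← liftHom_apply, map_one, one_mul]
      · intro l _ hl
        rw [if_neg hl.symm, ← liftHom_apply, map_zero, zero_mul]
      · exact fun h => absurd (Finset.mem_univ _) h
  exact Conv.algHom_ext (fun i => by rw [h1, Conv.const_coord]) h1

/-- The coordinate change `x_i ↦ x_i`, `t_j ↦ ∑_k M_{jk}(x) t_k` for an invertible matrix `M` with
inverse `N`. -/
def linEquiv (M N : FnMatrix n p) (h : M * N = 1) (h' : N * M = 1) :
    Conv (Fin n ⊕ Fin p) ≃ₐ[ℂ] Conv (Fin n ⊕ Fin p) :=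
  AlgEquiv.ofAlgHom (linHom M) (linHom N) (linHom_comp_eq_id h') (linHom_comp_eq_id h)

theorem isBifilteredAut_linEquiv {M N : FnMatrix n p} (h : M * N = 1) (h' : N * M = 1) :
    IsBifilteredAut (vU n p) (vV n p) (opConj (linEquiv M N h h')) where
  mem := opConj_mem_biFil vU_add_vV
    (fun _ _ => HasWeight.substHom (const_linCoord M) (hasWeight_linCoord M))
    (fun _ _ => HasWeight.substHom (const_linCoord N) (hasWeight_linCoord N))
  symm_mem := opConj_mem_biFil vU_add_vV
    (fun _ _ => HasWeight.substHom (const_linCoord N) (hasWeight_linCoord N))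
    (fun _ _ => HasWeight.substHom (const_linCoord M) (hasWeight_linCoord M))
  coord i := by
    classical
    have h1 : opConj (linEquiv M N h h') (fn (AnalyticDMod.coord i)) = fn (linCoord M i) :=
      (opConj_fn _ _).trans (congrArg fn (linHom_coord M i))
    rw [h1]
    cases i with
    | inl i =>
      refine ⟨fun k => if k = Sum.inl i then 1 else 0, fun k => ?_, ?_⟩
      · dsimp only
        split_ifs with hk
        · rw [hk, sub_self]; exact HasWeight.one le_rfl
        · exact HasWeight.zero
      · rw [Finset.sum_eq_single (Sum.inl i)]
        · dsimp only
          rw [if_pos rfl, fn_one, one_mul]; rfl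
        · intro k _ hk
          dsimp only
          rw [if_neg hk, fn_zero, zero_mul]
        · exact fun h => absurd (Finset.mem_univ _) h
    | inr j =>
      refine ⟨Sum.elim (fun _ => 0) fun k => liftX p (M j k), fun k => ?_, ?_⟩
      · cases k with
        | inl i => exact HasWeight.zero
        | inr k => exact hasWeight_of_nonpos vU_nonpos _ (sub_self _).ge
      · rw [Fintype.sum_sum_type]
        simp only [Sum.elim_inl, Sum.elim_inr, fn_zero, zero_mul, Finset.sum_const_zero, zero_add,
          ← fn_mul, ← fn_sum]
        rfl

/-- `∂_{t_j} ↦ ∑_k N_{kj} ∂_{t_k}`. -/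
theorem opConj_linEquiv_inr {M N : FnMatrix n p} (h : M * N = 1) (h' : N * M = 1) (j : Fin p) :
    opConj (linEquiv M N h h') (del (Sum.inr j)) =
      ∑ k, fn (liftX p (N k j)) * del (Sum.inr k) := by
  classical
  have h1 : ∀ k, linEquiv M N h h' (pderivEnd (Sum.inr j)
      ((linEquiv M N h h').symm (coord k))) = linHom M (pderivEnd (Sum.inr j) (linCoord N k)) :=
    fun k => congrArg (fun g => linHom M (pderivEnd (Sum.inr j) g)) (linHom_coord N k)
  rw [opConj_del, Fintype.sum_sum_type]
  simp only [h1, linCoord, Sum.elim_inl, Sum.elim_inr, map_sum, pderivEnd_mul, pderivEnd_coord,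
    pderivEnd_inr_liftX, zero_mul, add_zero, reduceCtorEq, if_false, map_zero, fn_zero,
    Finset.sum_const_zero, zero_add]
  refine Finset.sum_congr rfl fun k _ => ?_
  rw [Finset.sum_eq_single j]
  · rw [if_pos rfl, mul_one, linHom_liftX]
  · intro l _ hl
    rw [if_neg fun h => hl (Sum.inr_injective h).symm, mul_zero, map_zero]
  · exact fun h => absurd (Finset.mem_univ _) h

/-- `∂_{x_i} ↦ ∂_{x_i} + ∑_{k,m} (∂_i N · M)_{km} t_m ∂_{t_k}`. -/
theorem opConj_linEquiv_inl {M N : FnMatrix n p} (h : M * N = 1) (h' : N * M = 1) (i : Fin n) :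
    opConj (linEquiv M N h h') (del (Sum.inl i)) = del (Sum.inl i) +
      ∑ k, ∑ m, fn (liftX p (∑ l, pderivEnd i (N k l) * M l m)) * fn (coord (Sum.inr m)) *
        del (Sum.inr k) := by
  classical
  have h1 : ∀ k, linEquiv M N h h' (pderivEnd (Sum.inl i)
      ((linEquiv M N h h').symm (coord k))) = linHom M (pderivEnd (Sum.inl i) (linCoord N k)) :=
    fun k => congrArg (fun g => linHom M (pderivEnd (Sum.inl i) g)) (linHom_coord N k)
  rw [opConj_del, Fintype.sum_sum_type]
  simp only [h1, linCoord, Sum.elim_inl, Sum.elim_inr]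
  congr 1
  · rw [Finset.sum_eq_single i]
    · rw [pderivEnd_coord, if_pos rfl, map_one, fn_one, one_mul]
    · intro l _ hl
      rw [pderivEnd_coord, if_neg fun h => hl (Sum.inl_injective h).symm, map_zero, fn_zero,
        zero_mul]
    · exact fun h => absurd (Finset.mem_univ _) h
  · refine Finset.sum_congr rfl fun k _ => ?_
    rw [← Finset.sum_mul]
    congr 1
    simp only [map_sum, pderivEnd_mul, pderivEnd_coord, reduceCtorEq, if_false, mul_zero, zero_add,
      pderivEnd_inl_liftX, map_mul, linHom_liftX, linHom_coord, linCoord, Sum.elim_inr,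
      Finset.mul_sum]
    simp only [← liftHom_apply, ← fn_mul, ← fn_sum, map_sum, map_mul, Finset.sum_mul]
    rw [Finset.sum_comm]
    simp only [mul_assoc]

/-- `f = M f'` for an invertible matrix `M` with inverse `N` such that `tr(∂_i N · M) = 0`. As
`∂_i det N = det N · tr(∂_i N · N⁻¹)`, the last condition says that the determinant is constant. It
ensures that the coordinate change given by `M` maps the class of `1` in `N_f` to that in `N_{f'}`
without a twist by the determinant. -/
structure IsTransition (M N : FnMatrix n p) (f f' : Fin p → Conv (Fin n)) : Prop where
  mul_eq_one : M * N = 1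
  mul_eq_one' : N * M = 1
  trace : ∀ i, ∑ k, ∑ l, pderivEnd i (N k l) * M l k = 0
  trace' : ∀ i, ∑ k, ∑ l, pderivEnd i (M k l) * N l k = 0
  eq : ∀ j, f j = ∑ k, M j k * f' k
  eq' : ∀ j, f' j = ∑ k, N j k * f k

namespace IsTransition

variable {M N : FnMatrix n p} {f f' : Fin p → Conv (Fin n)}

theorem symm (h : IsTransition M N f f') : IsTransition N M f' f :=
  ⟨h.mul_eq_one', h.mul_eq_one, h.trace', h.trace, h.eq', h.eq⟩

/-- The product rule for `f' = N f`. -/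
theorem sum_mul_pderivEnd (h : IsTransition M N f f') (i : Fin n) (k : Fin p) :
    ∑ j, N k j * pderivEnd i (f j) =
      pderivEnd i (f' k) - ∑ m, (∑ l, pderivEnd i (N k l) * M l m) * f' m := by
  have h1 : ∑ m, (∑ l, pderivEnd i (N k l) * M l m) * f' m = ∑ l, pderivEnd i (N k l) * f l := by
    simp only [Finset.sum_mul]
    rw [Finset.sum_comm]
    refine Finset.sum_congr rfl fun l _ => ?_
    rw [h.eq l, Finset.mul_sum]
    exact Finset.sum_congr rfl fun m _ => mul_assoc _ _ _
  rw [h1, h.eq' k, map_sum, ← Finset.sum_sub_distrib]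
  exact Finset.sum_congr rfl fun l _ => by rw [pderivEnd_mul]; ring

theorem coord_sub_mem (f : Fin p → Conv (Fin n)) (j : Fin p) (P : DiffOp (Fin n ⊕ Fin p)) :
    P * (fn (coord (Sum.inr j)) - fn (liftX p (f j))) ∈ geomIdeal f :=
  Submodule.smul_mem _ P (Submodule.subset_span (Or.inl ⟨j, rfl⟩))

/-- The generators of the ideal of `f` are carried into the ideal of `f'`. For those that involve
`∂_{x_i}` the commutators of the `∂_{t_k}` with the `t_m` contribute the trace of `∂_i N · M`. -/
theorem opConj_mem (h : IsTransition M N f f') {P : DiffOp (Fin n ⊕ Fin p)}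
    (hP : P ∈ geomIdeal f) :
    opConj (linEquiv M N h.mul_eq_one h.mul_eq_one') P ∈ geomIdeal f' := by
  classical
  set Ψ := opConj (linEquiv M N h.mul_eq_one h.mul_eq_one') with hΨ
  have hfn : ∀ a, Ψ (fn (liftX p a)) = fn (liftX p a) := fun a =>
    (opConj_fn _ _).trans (congrArg fn (linHom_liftX M a))
  induction hP using Submodule.span_induction with
  | zero => rw [map_zero]; exact zero_mem _
  | add P Q _ _ hP hQ => rw [map_add]; exact add_mem hP hQ
  | smul P Q _ hQ => rw [smul_eq_mul, map_mul]; exact Submodule.smul_mem _ _ hQ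
  | mem P hP =>
    rcases hP with ⟨j, rfl⟩ | ⟨i, rfl⟩
    · have h1 : Ψ (fn (coord (Sum.inr j)) - fn (liftX p (f j))) =
          ∑ k, fn (liftX p (M j k)) * (fn (coord (Sum.inr k)) - fn (liftX p (f' k))) := by
        have h2 : Ψ (fn (coord (Sum.inr j))) =
            ∑ k, fn (liftX p (M j k)) * fn (coord (Sum.inr k)) := by
          rw [hΨ, opConj_fn]
          simp only [← fn_mul, ← fn_sum]
          exact congrArg fn (linHom_coord M _)
        rw [map_sub, hfn, h2, h.eq j]
        simp only [mul_sub, Finset.sum_sub_distrib, ← liftHom_apply, map_sum, map_mul, fn_sum,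
          fn_mul]
      rw [h1]
      exact sum_mem fun k _ => coord_sub_mem f' k _
    · let A : Fin p → Fin p → Conv (Fin n) := fun k m => ∑ l, pderivEnd i (N k l) * M l m
      have hcomm : ∀ k m, (fn (coord (Sum.inr m)) - fn (liftX p (f' m))) * del (Sum.inr k) =
          del (Sum.inr k) * (fn (coord (Sum.inr m)) - fn (liftX p (f' m))) -
            if k = m then 1 else 0 := fun k m => by
        rw [mul_sub, del_mul_coord, del_mul_fn, pderivEnd_inr_liftX, fn_zero, sub_mul]
        simp only [Sum.inr.injEq]
        abel
      have h1 : Ψ (∑ j, fn (liftX p (pderivEnd i (f j))) * del (Sum.inr j)) =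
          ∑ k, fn (liftX p (pderivEnd i (f' k))) * del (Sum.inr k) -
            ∑ k, ∑ m, fn (liftX p (A k m)) * fn (liftX p (f' m)) * del (Sum.inr k) := by
        rw [map_sum]
        simp only [map_mul, hfn]
        simp only [hΨ, opConj_linEquiv_inr, Finset.mul_sum]
        rw [Finset.sum_comm, ← Finset.sum_sub_distrib]
        refine Finset.sum_congr rfl fun k _ => ?_
        simp only [← mul_assoc, ← fn_mul, ← Finset.sum_mul, ← fn_sum, ← sub_mul, ← fn_sub]
        congr 2
        simp only [← liftHom_apply, ← map_mul, ← map_sum, ← map_sub]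
        congr 1
        rw [← h.sum_mul_pderivEnd i k]
        exact Finset.sum_congr rfl fun j _ => mul_comm _ _
      have htr : ∑ k, ∑ m, fn (liftX p (A k m)) * (if k = m then 1 else 0) =
          (0 : DiffOp (Fin n ⊕ Fin p)) := by
        simp only [mul_ite, mul_one, mul_zero, Finset.sum_ite_eq, Finset.mem_univ, if_true]
        rw [← fn_sum]
        simp only [← liftHom_apply]
        rw [← map_sum, show ∑ k, A k k = 0 from h.trace i, map_zero, fn_zero]
      have h2 : Ψ (del (Sum.inl i) + ∑ j, fn (liftX p (pderivEnd i (f j))) * del (Sum.inr j)) =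
          (del (Sum.inl i) + ∑ j, fn (liftX p (pderivEnd i (f' j))) * del (Sum.inr j)) +
          ∑ k, ∑ m, fn (liftX p (A k m)) * del (Sum.inr k) *
            (fn (coord (Sum.inr m)) - fn (liftX p (f' m))) := by
        have h3 : ∑ k, ∑ m, fn (liftX p (A k m)) * del (Sum.inr k) *
            (fn (coord (Sum.inr m)) - fn (liftX p (f' m))) =
            ∑ k, ∑ m, (fn (liftX p (A k m)) * fn (coord (Sum.inr m)) * del (Sum.inr k) -
              fn (liftX p (A k m)) * fn (liftX p (f' m)) * del (Sum.inr k) +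
              fn (liftX p (A k m)) * (if k = m then 1 else 0)) := by
          refine Finset.sum_congr rfl fun k _ => Finset.sum_congr rfl fun m _ => ?_
          rw [mul_assoc, ← sub_add_cancel (del (Sum.inr k) * (fn (coord (Sum.inr m)) -
            fn (liftX p (f' m)))) (if k = m then 1 else 0), ← hcomm k m]
          rw [mul_add, sub_mul, mul_sub, mul_assoc, mul_assoc]
        rw [h3]
        simp only [Finset.sum_add_distrib, Finset.sum_sub_distrib]
        rw [htr, add_zero, map_add, h1, hΨ, opConj_linEquiv_inl]
        abel
      rw [h2]
      refine add_mem (Submodule.subset_span (Or.inr ⟨i, rfl⟩))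
        (sum_mem fun k _ => sum_mem fun m _ => coord_sub_mem f' m _)

theorem opConj_mem_iff (h : IsTransition M N f f') (P : DiffOp (Fin n ⊕ Fin p)) :
    P ∈ geomIdeal f ↔ opConj (linEquiv M N h.mul_eq_one h.mul_eq_one') P ∈ geomIdeal f' := by
  refine ⟨h.opConj_mem, fun hP => ?_⟩
  have := h.symm.opConj_mem hP
  rwa [show opConj (linEquiv N M _ _) (opConj (linEquiv M N h.mul_eq_one h.mul_eq_one') P) = P from
    (opConj (linEquiv M N h.mul_eq_one h.mul_eq_one')).symm_apply_apply P] at this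

end IsTransition

end

section

variable {n p : ℕ}

/-! ### Adjoining the zero function -/

/-- The inclusion of the variables `x, t_1, …, t_p` into `x, t_1, …, t_{p+1}`. -/
def varEmb (n p : ℕ) : Fin n ⊕ Fin p ↪ Fin n ⊕ Fin (p + 1) :=
  ⟨Sum.map id Fin.castSucc, Function.injective_id.sumMap (Fin.castSucc_injective p)⟩

theorem addsOne_varEmb (n p : ℕ) : AddsOne (varEmb n p) (Sum.inr (Fin.last p)) where
  ne i := by
    cases i with
    | inl i => exact Sum.inl_ne_inr
    | inr j => exact fun h => j.castSucc_ne_last (Sum.inr_injective h)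
  cover k := by
    cases k with
    | inl i => exact Or.inr ⟨Sum.inl i, rfl⟩
    | inr j =>
      induction j using Fin.lastCases with
      | last => exact Or.inl rfl
      | cast j => exact Or.inr ⟨Sum.inr j, rfl⟩

theorem weights_varEmb (n p : ℕ) : AddsOne.Weights (varEmb n p) (Sum.inr (Fin.last p))
    (vU n p) (vV n p) (vU n (p + 1)) (vV n (p + 1)) where
  u_eq i := by cases i <;> rfl
  v_eq i := by cases i <;> rfl
  u_s := rfl
  v_s := rfl

theorem incl_liftX (a : Conv (Fin n)) : incl (varEmb n p) (liftX p a) = liftX (p + 1) a := by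
  have h1 : ∀ i, (inclHom (varEmb n p)).comp (liftHom n p) (coord i) = coord (Sum.inl i) :=
    fun i => by
      rw [AlgHom.comp_apply, liftHom_apply, liftX_coord, inclHom_apply, incl_coord]
      rfl
  have h : (inclHom (varEmb n p)).comp (liftHom n p) = liftHom n (p + 1) :=
    Conv.algHom_ext (fun i => by rw [h1, Conv.const_coord])
      fun i => by rw [h1, liftHom_apply, liftX_coord]
  exact DFunLike.congr_fun h a

theorem adjoinFn_castSucc (f : Fin p → Conv (Fin n)) (g : Conv (Fin n)) (j : Fin p) :
    adjoinFn f g j.castSucc = f j := Fin.snoc_castSucc (α := fun _ => Conv (Fin n)) g f j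

theorem adjoinFn_last (f : Fin p → Conv (Fin n)) (g : Conv (Fin n)) :
    adjoinFn f g (Fin.last p) = g := Fin.snoc_last (α := fun _ => Conv (Fin n)) g f

/-- The ideal of `(f, 0)` is generated by that of `f` and the new variable `t_{p+1}`. -/
theorem extIdeal_geomIdeal (f : Fin p → Conv (Fin n)) :
    (addsOne_varEmb n p).extIdeal (geomIdeal f) = geomIdeal (adjoinFn f 0) := by
  set h := addsOne_varEmb n p with hh
  have ht : ∀ j, h.opIncl (fn (coord (Sum.inr j)) - fn (liftX p (f j))) =
      fn (coord (Sum.inr j.castSucc)) - fn (liftX (p + 1) (adjoinFn f 0 j.castSucc)) := fun j => by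
    rw [map_sub, h.opIncl_fn, h.opIncl_fn, incl_coord, incl_liftX, adjoinFn_castSucc]
    rfl
  have hx : ∀ i, h.opIncl (del (Sum.inl i) +
      ∑ j, fn (liftX p (pderivEnd i (f j))) * del (Sum.inr j)) = del (Sum.inl i) +
      ∑ j, fn (liftX (p + 1) (pderivEnd i (adjoinFn f 0 j))) * del (Sum.inr j) := fun i => by
    rw [Fin.sum_univ_castSucc, adjoinFn_last, map_zero, ← liftHom_apply 0, map_zero, fn_zero,
      zero_mul, add_zero, map_add, map_sum, h.opIncl_del]
    congr 1
    refine Finset.sum_congr rfl fun j _ => ?_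
    rw [map_mul, h.opIncl_fn, h.opIncl_del, incl_liftX, adjoinFn_castSucc]
    rfl
  refine le_antisymm (Submodule.span_le.mpr ?_) (Submodule.span_le.mpr ?_)
  · rintro Q (⟨P, hP, rfl⟩ | rfl)
    · change h.opIncl P ∈ geomIdeal (adjoinFn f 0)
      induction hP using Submodule.span_induction with
      | zero => rw [map_zero]; exact zero_mem _
      | add P Q _ _ hP hQ => rw [map_add]; exact add_mem hP hQ
      | smul P Q _ hQ => rw [smul_eq_mul, map_mul]; exact Submodule.smul_mem _ _ hQ
      | mem P hP =>
        rcases hP with ⟨j, rfl⟩ | ⟨i, rfl⟩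
        · rw [ht]; exact Submodule.subset_span (Or.inl ⟨_, rfl⟩)
        · rw [hx]; exact Submodule.subset_span (Or.inr ⟨i, rfl⟩)
    · refine Submodule.subset_span (Or.inl ⟨Fin.last p, ?_⟩)
      dsimp only
      rw [adjoinFn_last, ← liftHom_apply, map_zero, fn_zero, sub_zero]
  · rintro Q (⟨j, rfl⟩ | ⟨i, rfl⟩)
    · induction j using Fin.lastCases with
      | last =>
        dsimp only
        rw [adjoinFn_last, ← liftHom_apply, map_zero, fn_zero, sub_zero]
        exact Submodule.subset_span (Or.inr rfl)
      | cast j =>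
        dsimp only
        rw [← ht]
        exact h.opIncl_mem_extIdeal (Submodule.subset_span (Or.inl ⟨j, rfl⟩))
    · dsimp only
      rw [← hx]
      exact h.opIncl_mem_extIdeal (Submodule.subset_span (Or.inr ⟨i, rfl⟩))

/-! ### Shifts of minimal resolutions of `N_f` -/

/-- `N_f` has a minimal bifiltered free resolution with the vector shifts `S i`. -/
def HasShifts (f : Fin p → Conv (Fin n)) (S : ℤ → Multiset (ℤ × ℤ)) : Prop :=
  ∃ R : GeomResolution f, ∀ i, R.shifts i = S i

/-- The effect on vector shifts of the mapping cone of a map of bidegree `(0,-1)`. -/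
def coneShifts (S : ℤ → Multiset (ℤ × ℤ)) (i : ℤ) : Multiset (ℤ × ℤ) :=
  S i + (S (i - 1)).map fun s => (s.1, s.2 - 1)

namespace HasShifts

variable {f f' : Fin p → Conv (Fin n)} {S S' : ℤ → Multiset (ℤ × ℤ)}

/-- The mapping cone of right multiplication by `t_{p+1}` resolves `N_{f,0}`. -/
theorem adjoin_zero (hf : HasShifts f S) : HasShifts (adjoinFn f 0) (coneShifts S) := by
  obtain ⟨R, hR⟩ := hf
  have huv : ∀ i, 0 ≤ vU n (p + 1) i + vV n (p + 1) i := fun i => (vU_add_vV i).ge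
  have h : ∃ R' : MinimalBifilteredFreeResolution (vU n (p + 1)) (vV n (p + 1))
      (quotFil (vU n (p + 1)) (vV n (p + 1)) ((addsOne_varEmb n p).extIdeal (geomIdeal f))),
      ∀ i, R'.shifts i = coneShifts S i :=
    ⟨AddsOne.cone R (addsOne_varEmb n p) huv vU_nonpos (weights_varEmb n p), fun i => by
      refine (AddsOne.shifts_cone _ _ _ _ _ i).trans ?_
      rw [coneShifts, ← hR, ← hR]
      rfl⟩
  rw [extIdeal_geomIdeal] at h
  exact h

theorem transition {M N : FnMatrix n p} (h : IsTransition M N f f') (hf : HasShifts f S) :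
    HasShifts f' S := by
  obtain ⟨R, hR⟩ := hf
  exact ⟨MinimalBifilteredFreeResolution.conj (I := geomIdeal f) (I' := geomIdeal f')
    (isBifilteredAut_linEquiv h.mul_eq_one h.mul_eq_one') (fun i => (vU_add_vV i).ge)
    h.opConj_mem_iff R, fun i =>
    (MinimalBifilteredFreeResolution.shifts_conj _ _ _ _ i).trans (hR i)⟩

theorem unique (hf : HasShifts f S) (R : GeomResolution f) (i : ℤ) : R.shifts i = S i := by
  obtain ⟨R', hR'⟩ := hf
  rw [← hR']
  exact R.shifts_eq R' (fun i => (vU_add_vV i).ge) i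

end HasShifts

/-! ### Shears and permutations -/

/-- The matrix with row `c` equal to `w` and all other rows `0`. -/
def rowMatrix (c : Fin p) (w : Fin p → Conv (Fin n)) : FnMatrix n p :=
  Matrix.of fun k l => if k = c then w l else 0

theorem one_add_rowMatrix_mul {c : Fin p} {w : Fin p → Conv (Fin n)} (hw : w c = 0) :
    (1 + rowMatrix c w) * (1 + rowMatrix c (-w)) = 1 := by
  have h1 : rowMatrix c w * rowMatrix c (-w) = 0 := by
    ext k l
    simp [rowMatrix, Matrix.mul_apply, hw]
  have h2 : rowMatrix c (-w) = -rowMatrix c w := by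
    ext k l
    simp only [rowMatrix, Matrix.of_apply, Matrix.neg_apply, Pi.neg_apply]
    split_ifs <;> simp
  rw [add_mul, mul_add, mul_add, h1, h2]
  noncomm_ring

theorem trace_one_add_rowMatrix {c : Fin p} {w w' : Fin p → Conv (Fin n)} (hw : w c = 0)
    (i : Fin n) : ∑ k, ∑ l, pderivEnd i ((1 + rowMatrix c w) k l) * (1 + rowMatrix c w') l k = 0 := by
  have h1 : ∀ k l, pderivEnd i ((1 + rowMatrix c w) k l) = if k = c then pderivEnd i (w l) else 0 :=
    fun k l => by
      rw [Matrix.add_apply, map_add, Matrix.one_apply, rowMatrix, Matrix.of_apply]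
      split_ifs <;> simp [pderivEnd_one]
  simp only [h1]
  rw [Finset.sum_eq_single c]
  · refine Finset.sum_eq_zero fun l _ => ?_
    rw [if_pos rfl]
    by_cases hl : l = c
    · rw [hl, hw, map_zero, zero_mul]
    · rw [Matrix.add_apply, Matrix.one_apply, if_neg hl, rowMatrix, Matrix.of_apply, if_neg hl,
        add_zero, mul_zero]
  · intro k _ hk
    exact Finset.sum_eq_zero fun l _ => by rw [if_neg hk, zero_mul]
  · exact fun h => absurd (Finset.mem_univ _) h

theorem sum_one_add_rowMatrix (c : Fin p) (w f : Fin p → Conv (Fin n)) (j : Fin p) :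
    ∑ k, (1 + rowMatrix c w) j k * f k = f j + if j = c then ∑ k, w k * f k else 0 := by
  simp only [Matrix.add_apply, Matrix.one_apply, rowMatrix, Matrix.of_apply, add_mul,
    Finset.sum_add_distrib, ite_mul, one_mul, zero_mul, Finset.sum_ite_eq, Finset.mem_univ, if_true]
  split_ifs
  · rfl
  · rw [Finset.sum_const_zero]

/-- Adding to one of the functions a combination of the others. -/
theorem isTransition_shear {c : Fin p} {w f f' : Fin p → Conv (Fin n)} (hw : w c = 0)
    (hne : ∀ j, j ≠ c → f' j = f j) (hc : f' c = f c + ∑ k, w k * f k) :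
    IsTransition (1 + rowMatrix c (-w)) (1 + rowMatrix c w) f f' := by
  have hw' : (-w) c = 0 := by rw [Pi.neg_apply, hw, neg_zero]
  have hsum : ∑ k, w k * f' k = ∑ k, w k * f k := Finset.sum_congr rfl fun k _ => by
    by_cases hk : k = c
    · rw [hk, hw, zero_mul, zero_mul]
    · rw [hne k hk]
  refine ⟨?_, one_add_rowMatrix_mul hw, trace_one_add_rowMatrix hw, trace_one_add_rowMatrix hw',
    fun j => ?_, fun j => ?_⟩
  · have := one_add_rowMatrix_mul hw'
    rwa [neg_neg] at this
  · rw [sum_one_add_rowMatrix]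
    simp only [Pi.neg_apply, neg_mul, Finset.sum_neg_distrib, hsum]
    split_ifs with hj
    · rw [hj, hc]; ring
    · rw [hne j hj, add_zero]
  · rw [sum_one_add_rowMatrix]
    split_ifs with hj
    · rw [hj, hc]
    · rw [hne j hj, add_zero]

/-- The matrix of a permutation. -/
def permFnMatrix (n : ℕ) (σ : Equiv.Perm (Fin p)) : FnMatrix n p :=
  Matrix.of fun j k => if σ j = k then 1 else 0

theorem sum_permFnMatrix (σ : Equiv.Perm (Fin p)) (f : Fin p → Conv (Fin n)) (j : Fin p) :
    ∑ k, permFnMatrix n σ j k * f k = f (σ j) := by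
  simp [permFnMatrix]

theorem permFnMatrix_mul (σ : Equiv.Perm (Fin p)) :
    permFnMatrix n σ * permFnMatrix n σ.symm = 1 := by
  ext j k
  rw [Matrix.mul_apply, sum_permFnMatrix σ fun l => permFnMatrix n σ.symm l k]
  simp [permFnMatrix, Matrix.one_apply]

theorem isTransition_perm (σ : Equiv.Perm (Fin p)) (f : Fin p → Conv (Fin n)) :
    IsTransition (permFnMatrix n σ) (permFnMatrix n σ.symm) (f ∘ σ) f := by
  have hd : ∀ (τ : Equiv.Perm (Fin p)) i k l, pderivEnd i (permFnMatrix n τ k l) = 0 :=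
    fun τ i k l => by
      rw [permFnMatrix, Matrix.of_apply]
      split_ifs
      · exact pderivEnd_one i
      · exact map_zero _
  refine ⟨permFnMatrix_mul σ, ?_, fun i => ?_, fun i => ?_, fun j => ?_, fun j => ?_⟩
  · exact permFnMatrix_mul σ.symm
  · simp [hd]
  · simp [hd]
  · rw [sum_permFnMatrix]; rfl
  · rw [sum_permFnMatrix, Function.comp_apply, σ.apply_symm_apply]

namespace HasShifts

variable {f f' : Fin p → Conv (Fin n)} {S S' : ℤ → Multiset (ℤ × ℤ)}

/-- Adjoining a function of the ideal amounts to adjoining `0` and a shear. -/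
theorem adjoin (hf : HasShifts f S) {g : Conv (Fin n)} (hg : g ∈ Ideal.span (Set.range f)) :
    HasShifts (adjoinFn f g) (coneShifts S) := by
  obtain ⟨a, rfl⟩ := Ideal.mem_span_range_iff_exists_fun.mp hg
  refine hf.adjoin_zero.transition (isTransition_shear (c := Fin.last p) (w := adjoinFn a 0)
    (adjoinFn_last a 0) (fun j hj => ?_) ?_)
  · obtain ⟨j, rfl⟩ := Fin.exists_castSucc_eq.mpr hj
    rw [adjoinFn_castSucc, adjoinFn_castSucc]
  · rw [adjoinFn_last, adjoinFn_last, Fin.sum_univ_castSucc, adjoinFn_last, zero_mul, add_zero,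
      zero_add]
    simp only [adjoinFn_castSucc]

/-- Adjoining several functions of the ideal one after the other. -/
theorem append (hf : HasShifts f S) : ∀ {q : ℕ} (h : Fin q → Conv (Fin n)),
    (∀ j, h j ∈ Ideal.span (Set.range f)) → HasShifts (Fin.append f h) (coneShifts^[q] S)
  | 0, h, _ => by
    rw [show Fin.append f h = f from by
      rw [Subsingleton.elim h Fin.elim0, Fin.append_elim0]; rfl]
    exact hf
  | q + 1, h, hh => by
    have hle : Ideal.span (Set.range f) ≤
        Ideal.span (Set.range (Fin.append f fun j => h (Fin.castSucc j))) := by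
      refine Ideal.span_mono ?_
      rintro - ⟨j, rfl⟩
      exact ⟨Fin.castAdd q j, Fin.append_left _ _ _⟩
    have h1 := (hf.append (fun j => h (Fin.castSucc j)) fun j => hh _).adjoin
      (hle (hh (Fin.last q)))
    rw [Function.iterate_succ_apply']
    have h2 : adjoinFn (Fin.append f fun j => h (Fin.castSucc j)) (h (Fin.last q)) =
        (Fin.append f h : Fin (p + (q + 1)) → _) := by
      rw [adjoinFn, ← Fin.append_snoc]
      exact congrArg _ (Fin.snoc_init_self h)
    rwa [h2] at h1

theorem append_comm
    (hfh : HasShifts (Fin.append f f') S) : HasShifts (Fin.append f' f) S := by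
  have h1 : Fin.append f' f ∘ finAddFlip = Fin.append f f' := by
    funext j
    induction j using Fin.addCases with
    | left j => rw [Function.comp_apply, finAddFlip_apply_castAdd, Fin.append_right, Fin.append_left]
    | right j => rw [Function.comp_apply, finAddFlip_apply_natAdd, Fin.append_left, Fin.append_right]
  rw [← h1] at hfh
  exact hfh.transition (isTransition_perm _ _)

end HasShifts

/-- Vector shifts that vanish in negative degrees can be recovered from those of the cone, degree by
degree. -/
theorem coneShifts_injOn {S S' : ℤ → Multiset (ℤ × ℤ)} (hS : ∀ i < 0, S i = 0)
    (hS' : ∀ i < 0, S' i = 0) (h : coneShifts S = coneShifts S') : S = S' := by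
  have key : ∀ m : ℕ, S m = S' m := fun m => by
    induction m with
    | zero =>
      have h0 := congrFun h 0
      rw [coneShifts, coneShifts, hS (0 - 1) (by norm_num), hS' (0 - 1) (by norm_num)] at h0
      simpa using h0
    | succ m ih =>
      have h0 := congrFun h (m + 1 : ℕ)
      rw [coneShifts, coneShifts, show ((m + 1 : ℕ) : ℤ) - 1 = m by push_cast; ring, ih] at h0
      exact add_right_cancel h0
  funext i
  rcases lt_or_ge i 0 with hi | hi
  · rw [hS i hi, hS' i hi]
  · obtain ⟨m, rfl⟩ := Int.eq_ofNat_of_zero_le hi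
    exact key m

theorem coneShifts_of_neg {S : ℤ → Multiset (ℤ × ℤ)} (hS : ∀ i < 0, S i = 0) :
    ∀ i < 0, coneShifts S i = 0 := fun i hi => by
  rw [coneShifts, hS i hi, hS (i - 1) (by omega)]
  rfl

theorem iterate_coneShifts_injOn (q : ℕ) {S S' : ℤ → Multiset (ℤ × ℤ)} (hS : ∀ i < 0, S i = 0)
    (hS' : ∀ i < 0, S' i = 0) (h : coneShifts^[q] S = coneShifts^[q] S') : S = S' := by
  induction q generalizing S S' with
  | zero => exact h
  | succ q ih =>
    exact coneShifts_injOn hS hS' (ih (coneShifts_of_neg hS) (coneShifts_of_neg hS') h)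

theorem MinimalBifilteredFreeResolution.shifts_of_neg [Fintype ι] {u v : ι → ℤ} {M : Type}
    [AddCommGroup M] [Module (DiffOp ι) M] {F : ℤ → ℤ → AddSubgroup M}
    (R : MinimalBifilteredFreeResolution u v F) : ∀ i < 0, R.shifts i = 0 := fun i hi => by
  cases i with
  | ofNat i => exact absurd hi (not_lt.mpr (Int.natCast_nonneg i))
  | negSucc i => rfl

/-- If `f` and `f'` generate the same ideal then `(f, f')` is obtained, up to order, both from `f`
and from `f'` by adjoining `p` functions of the ideal. -/
theorem shifts_eq_of_span_eq {f f' : Fin p → Conv (Fin n)}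
    (h : Ideal.span (Set.range f) = Ideal.span (Set.range f')) (R : GeomResolution f)
    (R' : GeomResolution f') : R.shifts = R'.shifts := by
  have h1 : HasShifts (Fin.append f f') (coneShifts^[p] R.shifts) :=
    HasShifts.append ⟨R, fun _ => rfl⟩ f' fun j => h ▸ Ideal.subset_span ⟨j, rfl⟩
  have h2 : HasShifts (Fin.append f' f) (coneShifts^[p] R'.shifts) :=
    HasShifts.append ⟨R', fun _ => rfl⟩ f fun j => h ▸ Ideal.subset_span ⟨j, rfl⟩
  obtain ⟨R₁, hR₁⟩ := h1
  refine iterate_coneShifts_injOn p R.shifts_of_neg R'.shifts_of_neg (funext fun i => ?_)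
  rw [← hR₁]
  exact h2.append_comm.unique R₁ i

end

end

end AnalyticDMod

theorem mainTheorem6 (n p : ℕ) :
    (∀ (f : Fin p → AnalyticDMod.Conv (Fin n)) (g : AnalyticDMod.Conv (Fin n)),
      g ∈ Ideal.span (Set.range f) →
      ∀ R : AnalyticDMod.GeomResolution f,
        Nonempty (AnalyticDMod.GeomResolution (AnalyticDMod.adjoinFn f g)) ∧
        ∀ R' : AnalyticDMod.GeomResolution (AnalyticDMod.adjoinFn f g),
          (∀ i : ℤ, R'.betti i = R.betti i + R.betti (i - 1)) ∧
          R'.bettiSeries = (1 + PowerSeries.X) * R.bettiSeries ∧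
          (∀ i : ℤ, R'.shifts i =
            R.shifts i + (R.shifts (i - 1)).map fun s => (s.1, s.2 - 1))) ∧
    (∀ f f' : Fin p → AnalyticDMod.Conv (Fin n),
      Ideal.span (Set.range f) = Ideal.span (Set.range f') →
      ∀ (R : AnalyticDMod.GeomResolution f) (R' : AnalyticDMod.GeomResolution f'),
        ∀ i : ℤ, R.betti i = R'.betti i ∧ R.shifts i = R'.shifts i) := by
  refine ⟨fun f g hg R => ?_, fun f f' h R R' i => ?_⟩
  · have hfg := AnalyticDMod.HasShifts.adjoin ⟨R, fun _ => rfl⟩ hg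
    refine ⟨hfg.elim fun R₁ _ => ⟨R₁⟩, fun R' => ?_⟩
    have hs : ∀ i : ℤ, R'.shifts i =
        R.shifts i + (R.shifts (i - 1)).map fun s => (s.1, s.2 - 1) := hfg.unique R'
    have hb : ∀ i : ℤ, R'.betti i = R.betti i + R.betti (i - 1) := fun i => by
      rw [← R'.card_shifts, hs, Multiset.card_add, Multiset.card_map, R.card_shifts, R.card_shifts]
    refine ⟨hb, PowerSeries.ext fun i => ?_, hs⟩
    rw [add_mul, one_mul, map_add]
    cases i with
    | zero =>
      rw [PowerSeries.coeff_zero_X_mul, add_zero]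
      simp only [AnalyticDMod.MinimalBifilteredFreeResolution.bettiSeries, PowerSeries.coeff_mk]
      rw [hb]
      exact congrArg Nat.cast (add_zero _)
    | succ i =>
      rw [PowerSeries.coeff_succ_X_mul]
      simp only [AnalyticDMod.MinimalBifilteredFreeResolution.bettiSeries, PowerSeries.coeff_mk]
      rw [hb, show ((i + 1 : ℕ) : ℤ) - 1 = i by push_cast; ring]
      push_cast
      rfl
  · have hs := congrFun (AnalyticDMod.shifts_eq_of_span_eq h R R') i
    exact ⟨by rw [← R.card_shifts, ← R'.card_shifts, hs], hs⟩
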